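/- Let $M$ be a (connected, Hausdorff) Riemann surface, and identify $S^3\subset\mathbb R^4$ with the projectivized light cone of $\mathbb R^{4,1}$ by $x\mapsto[1:x]$, where $\langle v,v\rangle=-v_0^2+v_1^2+\dots+v_4^2$ (extended complex bilinearly). Möbius transformations of $S^3$ are the maps induced by linear isometries of $\mathbb R^{4,1}$. Let $f:M\to S^3$ be a smooth conformal immersion and $\phi=(1,f)$. For a holomorphic coordinate $z$ write $|df|^2=e^{2u}|dz|^2$ and let $\psi=e^{-u}(1,f)$ be the normalized lift, so that $|d\psi|^2=|dz|^2$. Let $V=\mathrm{span}\{\phi,d\phi,\phi_{z\bar z}\}$, a rank $4$ bundle independent of $z$, and let $n$ be a smooth unit section of the line bundle $V^\perp$. Then $$\psi_{zz}+\tfrac c2\,\psi=\kappa\, n$$ for unique complex valued functions $\kappa$ and $c$ of $z$, called the Hopf differential of $f$ (with respect to $n$) and the Schwarzian derivative of $f$ in the coordinate $z$. Theorem (fundamental theorem of conformal surface theory). (Uniqueness) Let $f_1,f_2:M\to S^3$ be smooth conformal immersions with smooth unit sections $n_1,n_2$ of $V_1^\perp,V_2^\perp$. If in every holomorphic coordinate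 $f_1$ and $f_2$ have the same Hopf differential $\kappa$ (with respect to $n_1$, $n_2$) and the same Schwarzian derivative $c$, then there is a Möbius transformation $T$ of $S^3$ with $T\circ f_1=f_2$. (Existence) Suppose given, for each holomorphic coordinate $z$ on $M$, smooth complex valued functions $\kappa$ and $c$ of $z$ such that for any two holomorphic coordinates $z,w$, with corresponding functions $\kappa,c$ and $\tilde\kappa,\tilde c$, $$\tilde\kappa\,\frac{dw^2}{|dw|}=\kappa\,\frac{dz^2}{|dz|},\qquad \tilde c\,dw^2=(c-S_z(w))\,dz^2,\qquad S_z(w)=\Big(\frac{w''}{w'}\Big)'-\frac12\Big(\frac{w''}{w'}\Big)^2 ,$$ that is, $\kappa\,dz^2/|dz|$ is a smooth section of $LK^2$, where $K$ is the canonical bundle of $M$ and $L=(K\bar K)^{-1/2}$, and $c$ transforms like a Schwarzian derivative. Suppose that in every holomorphic coordinate the conformal Gauss and Codazzi equations hold: $$\tfrac12c_{\bar z}=3\,\bar\kappa_z\,\kappa+\bar\kappa\,\kappa_z,\qquad \mathrm{Im}\big(\kappa_{\bar z\bar z}+\tfrac12\bar c\,\kappa\big)=0 .$$ Then there is a conformal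 immersion of $M$ into $S^3$ with Möbius holonomy that has Hopf differential $\kappa$ and Schwarzian derivative $c$. That is, for every universal covering $\pi:M'\to M$ (a holomorphic covering map from a simply connected Riemann surface) there are a smooth conformal immersion $f:M'\to S^3$, a smooth unit section $n$ of its bundle $V^\perp$, and a homomorphism $\rho$ from the group of deck transformations of $\pi$ to the Möbius group of $S^3$ such that $f\circ\gamma=\rho(\gamma)\circ f$ for every deck transformation $\gamma$, and for every holomorphic coordinate $z$ on $M$ the Hopf differential (with respect to $n$) and the Schwarzian derivative of $f$ in the local coordinates $z\circ\pi$ of $M'$ are $\kappa$ and $c$. -/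

import Mathlib

open scoped Manifold ContDiff ComplexConjugate

noncomputable section

namespace ConformalSurface

/-! ### Wirtinger derivatives and the classical Schwarzian -/

/-- `∂g/∂z = (g_x - i g_y) / 2`. -/
def dz (g : ℂ → ℂ) (w : ℂ) : ℂ :=
  (1 / 2 : ℂ) * (fderiv ℝ g w 1 - Complex.I * fderiv ℝ g w Complex.I)

/-- `∂g/∂z̄ = (g_x + i g_y) / 2`. -/
def dzbar (g : ℂ → ℂ) (w : ℂ) : ℂ :=
  (1 / 2 : ℂ) * (fderiv ℝ g w 1 + Complex.I * fderiv ℝ g w Complex.I)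

/-- Componentwise `∂/∂z` of a vector valued function. -/
def dzVec (g : ℂ → Fin 5 → ℂ) (w : ℂ) : Fin 5 → ℂ := fun i => dz (fun x => g x i) w

/-- Componentwise `∂/∂z̄` of a vector valued function. -/
def dzbarVec (g : ℂ → Fin 5 → ℂ) (w : ℂ) : Fin 5 → ℂ := fun i => dzbar (fun x => g x i) w

/-- The classical Schwarzian derivative `(t''/t')' - (t''/t')²/2` of a holomorphic function. -/
def classicalSchwarzian (t : ℂ → ℂ) (w : ℂ) : ℂ :=
  deriv (fun x => deriv (deriv t) x / deriv t x) w
    - (1 / 2 : ℂ) * (deriv (deriv t) w / deriv t w) ^ 2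

/-! ### The light-cone model of the 3-sphere and its Möbius group -/

/-- Euclidean four-space. -/
abbrev E4 : Type := EuclideanSpace ℝ (Fin 4)

/-- The unit sphere in Euclidean four-space. -/
abbrev S3 : Type := Metric.sphere (0 : E4) 1

/-- The Minkowski form `-v₀ w₀ + v₁ w₁ + ⋯ + v₄ w₄`: over `ℝ` the Lorentzian inner product, over
`ℂ` its complex bilinear extension. -/
def mink {R : Type*} [CommRing R] (v w : Fin 5 → R) : R :=
  -(v 0 * w 0) + ∑ i : Fin 4, v i.succ * w i.succ

/-- The point `(1, x)` of the forward light cone; it spans the null line corresponding to `x`. -/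
def coneLift (x : S3) : Fin 5 → ℝ := Matrix.vecCons 1 (fun i => (x : E4) i)

/-- Lorentz transformations: linear automorphisms preserving the Minkowski form. -/
def IsLorentz (A : (Fin 5 → ℝ) ≃ₗ[ℝ] (Fin 5 → ℝ)) : Prop :=
  ∀ v w, mink (A v) (A w) = mink v w

/-- The Möbius group of the 3-sphere: all transformations of `S3`, identified with the projectivized
light cone, that are induced by Lorentz transformations. -/
def moebiusGroup : Subgroup (Equiv.Perm S3) where
  carrier := {T | ∃ A : (Fin 5 → ℝ) ≃ₗ[ℝ] (Fin 5 → ℝ), IsLorentz A ∧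
    ∀ x, ∃ r : ℝ, r ≠ 0 ∧ A (coneLift x) = r • coneLift (T x)}
  one_mem' := ⟨LinearEquiv.refl ℝ _, fun _ _ => rfl, fun x => ⟨1, one_ne_zero, by simp⟩⟩
  mul_mem' := by
    rintro S T ⟨A, hA, hS⟩ ⟨B, hB, hT⟩
    refine ⟨B.trans A, fun v w => ?_, fun x => ?_⟩
    · simp only [LinearEquiv.trans_apply]
      rw [hA, hB]
    · obtain ⟨r, hr, h1⟩ := hT x
      obtain ⟨s, hs, h2⟩ := hS (T x)
      refine ⟨r * s, mul_ne_zero hr hs, ?_⟩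
      simp only [LinearEquiv.trans_apply, h1, map_smul, h2, smul_smul, Equiv.Perm.mul_apply]
  inv_mem' := by
    rintro T ⟨A, hA, hT⟩
    refine ⟨A.symm, fun v w => ?_, fun x => ?_⟩
    · rw [← hA]
      simp
    · obtain ⟨r, hr, h1⟩ := hT (T⁻¹ x)
      refine ⟨r⁻¹, inv_ne_zero hr, ?_⟩
      rw [LinearEquiv.symm_apply_eq, map_smul, h1, smul_smul, inv_mul_cancel₀ hr, one_smul]
      simp

/-! ### Invariants of conformal immersions of a Riemann surface into the 3-sphere -/

section Surface

variable {M : Type*} [TopologicalSpace M] [ChartedSpace ℂ M]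

variable (M) in
/-- The holomorphic coordinates of a Riemann surface: all charts of its maximal holomorphic
atlas. -/
def holomorphicCoordinates : Set (OpenPartialHomeomorph M ℂ) :=
  IsManifold.maximalAtlas 𝓘(ℂ) ω M

/-- The map `f` in the coordinate `z`, as a map into Euclidean four-space. -/
def inCoord (f : M → S3) (z : OpenPartialHomeomorph M ℂ) (w : ℂ) : E4 := (f (z.symm w) : E4)

/-- Smooth conformal immersions into the round sphere. (`ConformalAt` includes that the differential
is a nonzero multiple of an isometry, hence injective.) -/
def IsConformalImmersion (f : M → S3) : Prop :=
  ∀ z ∈ holomorphicCoordinates M, ContDiffOn ℝ ∞ (inCoord f z) z.target ∧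
    ∀ w ∈ z.target, ConformalAt (inCoord f z) w

/-- The Euclidean lift `φ = (1, f)` in the coordinate `z`, with values in the complexified Minkowski
space. -/
def euclideanLift (f : M → S3) (z : OpenPartialHomeomorph M ℂ) (w : ℂ) : Fin 5 → ℂ :=
  fun i => (coneLift (f (z.symm w)) i : ℂ)

/-- The normalized lift `ψ = e^{-u} (1, f)` of a conformal immersion with respect to the coordinate
`z = x + iy`, where `e^u = |f_x|`, so that `|df|² = e^{2u} |dz|²`; it is the only positive multiple
of `(1, f)` with `|dψ|² = |dz|²`. -/
def normalizedLift (f : M → S3) (z : OpenPartialHomeomorph M ℂ) (w : ℂ) : Fin 5 → ℂ :=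
  fun i => ((‖fderiv ℝ (inCoord f z) w 1‖⁻¹ * coneLift (f (z.symm w)) i : ℝ) : ℂ)

/-- The complexified fibre of the bundle `V = span {φ, dφ, φ_{z z̄}}`, the mean curvature sphere
congruence of `f`. -/
def centralSphere (f : M → S3) (z : OpenPartialHomeomorph M ℂ) (w : ℂ) :
    Submodule ℂ (Fin 5 → ℂ) :=
  Submodule.span ℂ {euclideanLift f z w, dzVec (euclideanLift f z) w,
    dzbarVec (euclideanLift f z) w, dzVec (dzbarVec (euclideanLift f z)) w}

/-- `n` is a smooth section of length one of the real line bundle `V^⊥`. -/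
def IsUnitNormal (f : M → S3) (n : M → Fin 5 → ℝ) : Prop :=
  (∀ p, mink (n p) (n p) = 1) ∧
  ∀ z ∈ holomorphicCoordinates M, ContDiffOn ℝ ∞ (fun w => n (z.symm w)) z.target ∧
    ∀ w ∈ z.target, ∀ v ∈ centralSphere f z w, mink (fun i => (n (z.symm w) i : ℂ)) v = 0

/-- The inhomogeneous Hill equation `ψ_zz + (c/2) ψ = κ n` for the normalized lift `ψ` of `f` in the
coordinate `z`. For a unit normal `n` it determines the functions `κ` and `c` of `z`: the Hopf
differential (trivialized by `n`) and the Schwarzian derivative `S_z(f)`. -/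
def HasHopfSchwarzian (f : M → S3) (n : M → Fin 5 → ℝ) (z : OpenPartialHomeomorph M ℂ)
    (κ c : ℂ → ℂ) : Prop :=
  ∀ w ∈ z.target,
    dzVec (dzVec (normalizedLift f z)) w + (c w / 2) • normalizedLift f z w
      = κ w • (fun i => (n (z.symm w) i : ℂ))

/-! ### Abstract invariants

An object given in each holomorphic coordinate `z` by a function of `z` is a family
`OpenPartialHomeomorph M ℂ → ℂ → ℂ`; only the values at holomorphic coordinates `z` and at points of
`z.target` matter. -/

/-- Smooth sections `κ dz²/|dz|` of `L K²`, where `L = (K K̄)^{-1/2}`: if `t` is the transition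
function from `z` to another holomorphic coordinate, then `κ' (dt)²/|dt| = κ dz²/|dz|`. -/
def IsDensityQuadraticDifferential (κ : OpenPartialHomeomorph M ℂ → ℂ → ℂ) : Prop :=
  (∀ z ∈ holomorphicCoordinates M, ContDiffOn ℝ ∞ (κ z) z.target) ∧
  ∀ z ∈ holomorphicCoordinates M, ∀ z' ∈ holomorphicCoordinates M,
    ∀ w ∈ (z.symm.trans z').source,
      κ z' (z' (z.symm w)) * (deriv (fun x => z' (z.symm x)) w ^ 2
        / (‖deriv (fun x => z' (z.symm x)) w‖ : ℂ)) = κ z w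

/-- Smooth objects transforming like a Schwarzian derivative: if `t` is the transition function from
`z` to another holomorphic coordinate, then `c' (dt)² = (c - S_z(t)) dz²`. -/
def IsSchwarzianType (c : OpenPartialHomeomorph M ℂ → ℂ → ℂ) : Prop :=
  (∀ z ∈ holomorphicCoordinates M, ContDiffOn ℝ ∞ (c z) z.target) ∧
  ∀ z ∈ holomorphicCoordinates M, ∀ z' ∈ holomorphicCoordinates M,
    ∀ w ∈ (z.symm.trans z').source,
      c z' (z' (z.symm w)) * deriv (fun x => z' (z.symm x)) w ^ 2
        = c z w - classicalSchwarzian (fun x => z' (z.symm x)) w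

/-- The conformal Gauss equation `c_{z̄}/2 = 3 (κ̄)_z κ + κ̄ κ_z`. -/
def ConformalGauss (κ c : OpenPartialHomeomorph M ℂ → ℂ → ℂ) : Prop :=
  ∀ z ∈ holomorphicCoordinates M, ∀ w ∈ z.target,
    (1 / 2 : ℂ) * dzbar (c z) w
      = 3 * dz (fun x => conj (κ z x)) w * κ z w + conj (κ z w) * dz (κ z) w

/-- The conformal Codazzi equation `Im (κ_{z̄ z̄} + c̄ κ / 2) = 0`. -/
def ConformalCodazzi (κ c : OpenPartialHomeomorph M ℂ → ℂ → ℂ) : Prop :=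
  ∀ z ∈ holomorphicCoordinates M, ∀ w ∈ z.target,
    (dzbar (dzbar (κ z)) w + (1 / 2 : ℂ) * conj (c z w) * κ z w).im = 0

end Surface

/-! ### Möbius holonomy -/

section Holonomy

variable {M M' : Type*} [TopologicalSpace M'] (π : M' → M)

/-- The group of deck transformations of `π`. -/
def deckGroup : Subgroup (M' ≃ₜ M') where
  carrier := {γ | ∀ x, π (γ x) = π x}
  one_mem' := fun _ => rfl
  mul_mem' := fun {a b} ha hb x => (ha (b x)).trans (hb x)
  inv_mem' := fun {a} ha x => by
    have h := ha (a⁻¹ x)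
    rw [show a (a⁻¹ x) = x from a.apply_symm_apply x] at h
    exact h.symm

/-- A map on the universal covering surface has Möbius holonomy if it is equivariant with respect to
a homomorphism from the group of deck transformations to the Möbius group. -/
def HasMoebiusHolonomy (f : M' → S3) : Prop :=
  ∃ ρ : deckGroup π →* moebiusGroup, ∀ (γ : deckGroup π) (x : M'),
    f ((γ : M' ≃ₜ M') x) = (ρ γ : Equiv.Perm S3) (f x)

end Holonomy

end ConformalSurface

end

open scoped Manifold ContDiff ComplexConjugate

noncomputable section

namespace ConformalSurface

/-! ### Flat connections in trivial bundles -/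

section Frobenius

open Set Metric

/-! The proof is the method of moving frames in complexified Minkowski space. To a normalized lift
`ψ` with unit normal `n` belongs the frame `F = (ψ, ψ_z, ψ_z̄, ψ̂, n)`, where `ψ̂ = 2 ψ_zz̄ + 2|κ|²
ψ` is the null vector of `V` orthogonal to `ψ_z`, `ψ_z̄` with `⟨ψ, ψ̂⟩ = -1`. Its Gram matrix is
constant (`IsNormalizedLift.liftFrame_gram`), and taking products with the frame turns the Hill
equation into a linear system `F_z = F P`, `F_z̄ = F Q` whose coefficients involve only `κ`, `c`,
`κ_z̄` and their conjugates (`IsNormalizedLift.isParallelFrame`).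

Uniqueness: the coefficients are infinitesimal isometries, so for two solutions `F`, `G` of the same
system `G F⁻¹` is locally constant. It is a real Lorentz matrix (`IsNormalizedLift.exists_lorentz`);
positivity of the scale factors makes it orthochronous, so it acts on the sphere. The orthochronous
transformation matching two surfaces together with their normals is unique near each point, hence
locally constant, hence global on a connected surface (`exists_lorentz_of_isSurfaceAt`).

Local existence: the Gauss and Codazzi equations give `P_z̄ - Q_z = P Q - Q P` (`zero_curvature`),
so the connection `P dz + Q dz̄` is flat and has local parallel frames (`exists_parallel_frame`).
With a suitable initial value, after averaging with the conjugate solution, the frame is real and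
has the right Gram matrix, and its first and last columns are the lift and the normal of a surface
(`exists_isLocalSurface`).

Global existence: the transformation laws of `κ` and `c` are exactly those of the invariants of a
surface under a holomorphic change of coordinate (`IsNormalizedLift.comp_holomorphic`). Hence two
local surfaces over overlapping patches of the covering differ by a locally constant Lorentz
transformation. These form a cocycle, which is a coboundary on a simply connected space
(`exists_trivialization_of_cocycle`), so the pieces can be moved to fit together. A deck
transformation produces another surface with the same invariants; uniqueness supplies its Möbius
transformation and makes the assignment a homomorphism (`hasMoebiusHolonomy_of_isSurfaceAt`). -/

theorem norm_le_of_norm_deriv_le_half {E : Type*} [NormedAddCommGroup E] [NormedSpace ℝ E]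
    {f f' : ℝ → E} {d ε : ℝ}
    (hf : ∀ t ∈ Icc (0 : ℝ) 1, HasDerivWithinAt f (f' t) (Icc 0 1) t) (hε : 0 ≤ ε)
    (h0 : ‖f 0‖ ≤ d) (bound : ∀ t ∈ Icc (0 : ℝ) 1, ‖f' t‖ ≤ 1 / 2 * ‖f t‖ + ε) :
    ∀ t ∈ Icc (0 : ℝ) 1, ‖f t‖ ≤ 2 * d + 2 * ε := by
  intro t ht
  have hd : 0 ≤ d := (norm_nonneg _).trans h0
  have h := norm_le_gronwallBound_of_norm_deriv_right_le (f := f) (f' := f') (a := 0) (b := 1)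
    (fun t ht => (hf t ht).continuousWithinAt)
    (fun t ht => (hf t (Ico_subset_Icc_self ht)).mono_of_mem_nhdsWithin
      (Icc_mem_nhdsGE_of_mem ht)) h0 (fun t ht => bound t (Ico_subset_Icc_self ht)) t ht
  refine h.trans ?_
  rw [gronwallBound_of_K_ne_0 (by norm_num)]
  -- The Grönwall factor for the rate `1/2` on the unit interval is at most `√e < 2`; this is where
  -- both factors `2` in the bound come from.
  have he : Real.exp (1 / 2 * (t - 0)) ≤ 2 := by
    have h1 : Real.exp (1 / 2 * (t - 0)) ≤ Real.exp (1 / 2) :=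
      Real.exp_le_exp.2 (by linarith [ht.2])
    have h2 : Real.exp (1 / 2) ^ 2 = Real.exp 1 := by rw [← Real.exp_nat_mul]; norm_num
    have h3 := Real.exp_one_lt_d9
    nlinarith [Real.exp_pos (1 / 2)]
  have h1 : d * Real.exp (1 / 2 * (t - 0)) ≤ d * 2 := mul_le_mul_of_nonneg_left he hd
  have h2 : ε / (1 / 2) * (Real.exp (1 / 2 * (t - 0)) - 1) ≤ ε / (1 / 2) * 1 :=
    mul_le_mul_of_nonneg_left (by linarith) (by positivity)
  simp only at *
  linarith

variable {E 𝔸 : Type*} [NormedAddCommGroup E] [NormedSpace ℝ E] [NormedRing 𝔸]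
  [NormedAlgebra ℝ 𝔸]

/-- On the ball of radius `‖F₀‖` about `F₀` the field `x A` has norm at most `2‖F₀‖ · 1/2`, so a
solution cannot leave the ball in unit time. One application of Picard–Lindelöf therefore covers the
whole interval, with no continuation argument. -/
theorem exists_linear_ode_solution [CompleteSpace 𝔸] {A : ℝ → 𝔸} (hA : ContinuousOn A (Icc 0 1))
    (hA' : ∀ t ∈ Icc (0 : ℝ) 1, ‖A t‖ ≤ 1 / 2) (F₀ : 𝔸) :
    ∃ F : ℝ → 𝔸, F 0 = F₀ ∧ ∀ t ∈ Icc (0 : ℝ) 1, HasDerivWithinAt F (F t * A t) (Icc 0 1) t := by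
  have hP : IsPicardLindelof (fun t x => x * A t) (⟨0, by simp⟩ : Icc (0 : ℝ) 1) F₀
      ‖F₀‖₊ 0 ‖F₀‖₊ (1 / 2) := by
    refine ⟨fun t ht => ?_, fun x _ => continuousOn_const.mul hA, fun t ht x hx => ?_, ?_⟩
    · refine LipschitzOnWith.of_dist_le_mul fun x _ y _ => ?_
      rw [dist_eq_norm, dist_eq_norm, ← sub_mul, mul_comm]
      refine (norm_mul_le _ _).trans ?_
      have := hA' t ht
      gcongr
      simpa using this
    · have h1 : ‖x‖ ≤ 2 * ‖F₀‖ := by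
        have h2 : ‖x - F₀‖ ≤ ‖F₀‖ := by simpa [dist_eq_norm] using hx
        have h3 := norm_add_le (x - F₀) F₀
        rw [sub_add_cancel] at h3
        linarith
      calc ‖x * A t‖ ≤ ‖x‖ * ‖A t‖ := norm_mul_le _ _
        _ ≤ (2 * ‖F₀‖) * (1 / 2) := by gcongr; exact hA' t ht
        _ = ‖F₀‖ := by ring
    · simp
  exact hP.exists_eq_forall_mem_Icc_hasDerivWithinAt₀

/-- A `C²` map and its derivative are both Lipschitz near the point. The mean value inequality on
segments turns the second fact into a Taylor estimate, uniform in the base point. A single constant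
serves all three bounds. -/
theorem exists_bounds_of_contDiffAt {F : Type*} [NormedAddCommGroup F] [NormedSpace ℝ F]
    {f : E → F} {x₀ : E} (hf : ContDiffAt ℝ 2 f x₀) :
    ∃ r > 0, ∃ C ≥ 0, (∀ x ∈ ball x₀ r, DifferentiableAt ℝ f x) ∧ (∀ x ∈ ball x₀ r, ‖f x‖ ≤ C) ∧
      (∀ x ∈ ball x₀ r, ∀ y ∈ ball x₀ r, ‖f y - f x‖ ≤ C * ‖y - x‖) ∧
      ∀ x ∈ ball x₀ r, ∀ y ∈ ball x₀ r,
        ‖f y - f x - fderiv ℝ f x (y - x)‖ ≤ C * ‖y - x‖ ^ 2 := by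
  obtain ⟨K, s, hs, hK⟩ := (hf.of_le (m := 1) (by norm_num)).exists_lipschitzOnWith
  obtain ⟨K', s', hs', hK'⟩ :=
    (hf.fderiv_right (m := 1) (by norm_num)).exists_lipschitzOnWith
  have hd : ∀ᶠ x in nhds x₀, DifferentiableAt ℝ f x :=
    (hf.eventually (by simp)).mono fun x hx => hx.differentiableAt (by norm_num)
  obtain ⟨r, hr, hr'⟩ := Metric.eventually_nhds_iff_ball.1 (hd.and (Filter.inter_mem hs hs'))
  refine ⟨r, hr, K * r + ‖f x₀‖ + K + K', by positivity, fun x hx => (hr' x hx).1, ?_, ?_, ?_⟩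
  · intro x hx
    have h1 := hK.norm_sub_le (hr' x hx).2.1 (hr' x₀ (mem_ball_self hr)).2.1
    have h2 : ‖x - x₀‖ ≤ r := by simpa [dist_eq_norm] using (mem_ball.1 hx).le
    have h3 := norm_add_le (f x - f x₀) (f x₀)
    rw [sub_add_cancel] at h3
    have h4 : (K : ℝ) * ‖x - x₀‖ ≤ K * r := by gcongr
    have := K.2; have := K'.2
    simp only [NNReal.val_eq_coe] at *
    linarith
  · intro x hx y hy
    refine (hK.norm_sub_le (hr' y hy).2.1 (hr' x hx).2.1).trans ?_
    gcongr
    have := K'.2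
    have : 0 ≤ K * r + ‖f x₀‖ := by positivity
    simp only [NNReal.val_eq_coe] at *
    linarith
  · intro x hx y hy
    have h1 : ∀ z ∈ segment ℝ x y, z ∈ ball x₀ r := fun z hz =>
      (convex_ball x₀ r).segment_subset hx hy hz
    have h := (convex_segment x y).norm_image_sub_le_of_norm_hasFDerivWithin_le'
      (f := f) (f' := fderiv ℝ f) (φ := fderiv ℝ f x) (C := K' * ‖y - x‖)
      (fun z hz => (hr' z (h1 z hz)).1.hasFDerivAt.hasFDerivWithinAt) (fun z hz => ?_)
      (left_mem_segment ℝ x y) (right_mem_segment ℝ x y)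
    · refine h.trans ?_
      rw [pow_two, ← mul_assoc]
      gcongr
      have : 0 ≤ K * r + ‖f x₀‖ + K := by positivity
      linarith
    · refine (hK'.norm_sub_le (hr' z (h1 z hz)).2.2 (hr' x hx).2.2).trans ?_
      gcongr
      obtain ⟨a, b, ha, hb, hab, rfl⟩ := hz
      have : a • x + b • y - x = b • (y - x) := by
        rw [smul_sub, ← sub_eq_zero]
        have : a = 1 - b := by linarith
        rw [this]; module
      rw [this, norm_smul, Real.norm_of_nonneg hb]
      exact mul_le_of_le_one_left (norm_nonneg _) (by linarith)

/-- Local existence of parallel frames for flat connections. -/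
theorem exists_parallel_frame [CompleteSpace 𝔸] {α : E → E →L[ℝ] 𝔸} {x₀ : E}
    (hα : ContDiffAt ℝ 2 α x₀)
    (flat : ∀ᶠ x in nhds x₀, ∀ u v,
      fderiv ℝ α x u v + α x u * α x v = fderiv ℝ α x v u + α x v * α x u) (F₀ : 𝔸) :
    ∃ F : E → 𝔸, F x₀ = F₀ ∧ ∀ᶠ x in nhds x₀,
      HasFDerivAt F ((ContinuousLinearMap.mul ℝ 𝔸 (F x)).comp (α x)) x := by
  obtain ⟨r, hr, C, hC, hd, hb, hL, hT⟩ := exists_bounds_of_contDiffAt hα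
  obtain ⟨r', hr', hflat⟩ := Metric.eventually_nhds_iff_ball.1 flat
  -- The condition `C ρ ≤ 1/2` bounds the coefficient `α (x₀ + t w) w` of the radial equation by
  -- `1/2`, as the two preceding results on ordinary differential equations require.
  obtain ⟨ρ, hρ, hρr, hρr', hρC⟩ : ∃ ρ > 0, ρ ≤ r ∧ ρ ≤ r' ∧ C * ρ ≤ 1 / 2 := by
    refine ⟨min (min r r') (1 / (2 * (C + 1))), by positivity,
      (min_le_left _ _).trans (min_le_left _ _), (min_le_left _ _).trans (min_le_right _ _), ?_⟩
    have h1 : C * min (min r r') (1 / (2 * (C + 1))) ≤ C * (1 / (2 * (C + 1))) := by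
      gcongr; exact min_le_right _ _
    refine h1.trans ?_
    rw [mul_one_div, div_le_div_iff₀ (by positivity) (by norm_num)]
    linarith
  have hmem : ∀ w : E, ‖w‖ < ρ → ∀ t ∈ Icc (0 : ℝ) 1, x₀ + t • w ∈ ball x₀ ρ := by
    intro w hw t ht
    rw [mem_ball, dist_eq_norm, add_sub_cancel_left, norm_smul, Real.norm_of_nonneg ht.1]
    exact (mul_le_of_le_one_left (norm_nonneg _) ht.2).trans_lt hw
  have hmr := fun w hw t ht => ball_subset_ball hρr (hmem w hw t ht)
  have hray : ∀ (w : E) (t : ℝ), HasDerivAt (fun t : ℝ => x₀ + t • w) w t := fun w t => by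
    simpa using ((hasDerivAt_id t).smul_const w).const_add x₀
  have hαray : ∀ w : E, ‖w‖ < ρ → ∀ t ∈ Icc (0 : ℝ) 1,
      HasDerivAt (fun t : ℝ => α (x₀ + t • w)) (fderiv ℝ α (x₀ + t • w) w) t := fun w hw t ht =>
    (hd _ (hmr w hw t ht)).hasFDerivAt.comp_hasDerivAt t (hray w t)
  have hA : ∀ w : E, ‖w‖ < ρ → ∀ t ∈ Icc (0 : ℝ) 1, ‖α (x₀ + t • w) w‖ ≤ 1 / 2 := by
    intro w hw t ht
    refine ((α (x₀ + t • w)).le_opNorm w).trans (le_trans ?_ hρC)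
    have := hb _ (hmr w hw t ht)
    gcongr
  -- Parallel transport along the ray `t ↦ x₀ + t w`; its value at time `1` will be the frame at `x₀
  -- + w`.
  have hsol : ∀ w : E, ∃ F : ℝ → 𝔸, ‖w‖ < ρ → F 0 = F₀ ∧ ∀ t ∈ Icc (0 : ℝ) 1,
      HasDerivWithinAt F (F t * α (x₀ + t • w) w) (Icc 0 1) t := by
    intro w
    by_cases hw : ‖w‖ < ρ
    · obtain ⟨F, hF⟩ := exists_linear_ode_solution (A := fun t => α (x₀ + t • w) w)
        (fun t ht => ((hαray w hw t ht).continuousAt.clm_apply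
          continuousAt_const).continuousWithinAt) (hA w hw) F₀
      exact ⟨F, fun _ => hF⟩
    · exact ⟨0, fun h => absurd h hw⟩
  choose S hS using hsol
  have hN : ∀ w : E, ‖w‖ < ρ → ∀ t ∈ Icc (0 : ℝ) 1, ‖S w t‖ ≤ 2 * ‖F₀‖ := by
    intro w hw t ht
    have := norm_le_of_norm_deriv_le_half (ε := 0) (hS w hw).2 le_rfl (by rw [(hS w hw).1])
      (fun t ht => ?_) t ht
    · simpa using this
    · rw [add_zero, mul_comm]
      refine (norm_mul_le _ _).trans ?_
      have := hA w hw t ht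
      gcongr
  -- the connection form along two neighbouring rays
  have hAdiff : ∀ w h : E, ‖w‖ < ρ → ‖w + h‖ < ρ → ∀ t ∈ Icc (0 : ℝ) 1,
      ‖α (x₀ + t • (w + h)) (w + h) - α (x₀ + t • w) w‖ ≤ C * (ρ + 1) * ‖h‖ := by
    intro w h hw hwh t ht
    have e : α (x₀ + t • (w + h)) (w + h) - α (x₀ + t • w) w
        = (α (x₀ + t • (w + h)) - α (x₀ + t • w)) (w + h) + α (x₀ + t • w) h := by
      simp only [sub_apply, map_add]; abel
    have h1 := hL _ (hmr w hw t ht) _ (hmr (w + h) hwh t ht)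
    have e2 : x₀ + t • (w + h) - (x₀ + t • w) = t • h := by module
    have h2 : ‖t • h‖ ≤ ‖h‖ := by
      rw [norm_smul, Real.norm_of_nonneg ht.1]
      exact mul_le_of_le_one_left (norm_nonneg _) ht.2
    rw [e2] at h1
    have h3 := hb _ (hmr w hw t ht)
    rw [e]
    calc _ ≤ ‖α (x₀ + t • (w + h)) - α (x₀ + t • w)‖ * ‖w + h‖ + ‖α (x₀ + t • w)‖ * ‖h‖ :=
          (norm_add_le _ _).trans (add_le_add (ContinuousLinearMap.le_opNorm _ _)
            (ContinuousLinearMap.le_opNorm _ _))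
      _ ≤ (C * ‖h‖) * ρ + C * ‖h‖ := by
          gcongr
          exact h1.trans (by gcongr)
      _ = _ := by ring
  -- The difference of two radial solutions starts at zero and solves the linear equation with a
  -- forcing term of order `‖h‖`, coming from the difference of the coefficients.
  have hSdiff : ∀ w h : E, ‖w‖ < ρ → ‖w + h‖ < ρ → ∀ t ∈ Icc (0 : ℝ) 1,
      ‖S (w + h) t - S w t‖ ≤ 4 * ‖F₀‖ * (C * (ρ + 1)) * ‖h‖ := by
    intro w h hw hwh t ht
    have := norm_le_of_norm_deriv_le_half (f := fun t => S (w + h) t - S w t) (d := 0)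
      (ε := 2 * ‖F₀‖ * (C * (ρ + 1) * ‖h‖))
      (fun t ht => ((hS (w + h) hwh).2 t ht).sub ((hS w hw).2 t ht)) (by positivity)
      (by simp [(hS w hw).1, (hS (w + h) hwh).1]) (fun t ht => ?_) t ht
    · exact this.trans (by ring_nf; rfl)
    · have e : S (w + h) t * α (x₀ + t • (w + h)) (w + h) - S w t * α (x₀ + t • w) w
          = (S (w + h) t - S w t) * α (x₀ + t • w) w
            + S (w + h) t * (α (x₀ + t • (w + h)) (w + h) - α (x₀ + t • w) w) := by noncomm_ring
      rw [e]
      refine (norm_add_le _ _).trans (add_le_add ?_ ?_)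
      · rw [mul_comm (1 / 2 : ℝ)]
        refine (norm_mul_le _ _).trans ?_
        have := hA w hw t ht
        gcongr
      · refine (norm_mul_le _ _).trans ?_
        have := hAdiff w h hw hwh t ht
        have := hN (w + h) hwh t ht
        gcongr
  -- `K / 2` is the sum of the constants of the two quadratic error terms below; the Grönwall
  -- estimate doubles it.
  set K : ℝ := 2 * ((4 * ‖F₀‖ * (C * (ρ + 1))) * (C * (ρ + 1)) + 2 * ‖F₀‖ * (C * (ρ + 1))) with hK
  -- The frame is parallel in all directions, not only radially, up to a quadratic error. The defect
  -- `S (w + h) t - S w t - S w t * α (x₀ + t w) (t h)` vanishes at `t = 0`, and flatness makes its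
  -- derivative equal to the defect times the radial coefficient plus terms of order `‖h‖²`.
  have key : ∀ w h : E, ‖w‖ < ρ → ‖w + h‖ < ρ →
      ‖S (w + h) 1 - S w 1 - S w 1 * α (x₀ + w) h‖ ≤ K * ‖h‖ ^ 2 := by
    intro w h hw hwh
    have := norm_le_of_norm_deriv_le_half
      (f := fun t => S (w + h) t - S w t - S w t * α (x₀ + t • w) (t • h)) (d := 0)
      (ε := (K / 2) * ‖h‖ ^ 2)
      (fun t ht => (((hS (w + h) hwh).2 t ht).sub ((hS w hw).2 t ht)).sub
        (((hS w hw).2 t ht).mul ((hαray w hw t ht).hasDerivWithinAt.clm_apply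
          ((hasDerivWithinAt_id t _).smul_const h))))
      (by positivity) (by simp [(hS w hw).1, (hS (w + h) hwh).1]) (fun t ht => ?_) 1
      (right_mem_Icc.2 zero_le_one)
    · simp only [one_smul] at this
      exact this.trans (by ring_nf; rfl)
    · have hfl := hflat _ (ball_subset_ball hρr' (hmem w hw t ht)) w h
      set a := α (x₀ + t • w) with ha
      set b := α (x₀ + t • (w + h)) with hb'
      set a' := fderiv ℝ α (x₀ + t • w) with ha'
      have e : S (w + h) t * b (w + h) - S w t * a w
            - (S w t * a w * a (t • h) + S w t * (a' w (t • h) + a ((1 : ℝ) • h)))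
          = (S (w + h) t - S w t - S w t * a (t • h)) * a w
            + (S (w + h) t - S w t) * (b (w + h) - a w)
            + S w t * ((b - a - a' (t • h)) w + (b - a) h) := by
        -- Flatness enters only here: the Taylor expansion of the connection form produces `a' h w`,
        -- whereas differentiating along the ray produces `a' w h`.
        have e1 : t • (a' h w) = t • (a' w h + a w * a h - a h * a w) := by
          rw [hfl]; simp
        simp only [map_smul, one_smul, sub_apply, map_add,
          smul_apply, e1, smul_add, smul_sub]
        simp only [mul_add, mul_sub, sub_mul, mul_smul_comm, smul_mul_assoc, mul_assoc]
        abel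
      have e2 : x₀ + t • (w + h) - (x₀ + t • w) = t • h := by module
      have h2 : ‖t • h‖ ≤ ‖h‖ := by
        rw [norm_smul, Real.norm_of_nonneg ht.1]
        exact mul_le_of_le_one_left (norm_nonneg _) ht.2
      have hL' := hL _ (hmr w hw t ht) _ (hmr (w + h) hwh t ht)
      have hT' := hT _ (hmr w hw t ht) _ (hmr (w + h) hwh t ht)
      rw [e2] at hL' hT'
      rw [e, add_assoc]
      refine (norm_add_le _ _).trans (add_le_add ?_ ?_)
      · rw [mul_comm (1 / 2 : ℝ)]
        refine (norm_mul_le _ _).trans ?_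
        have := hA w hw t ht
        gcongr
      · have h3 : ‖(S (w + h) t - S w t) * (b (w + h) - a w)‖
            ≤ (4 * ‖F₀‖ * (C * (ρ + 1)) * ‖h‖) * (C * (ρ + 1) * ‖h‖) := by
          refine (norm_mul_le _ _).trans ?_
          have := hSdiff w h hw hwh t ht
          have := hAdiff w h hw hwh t ht
          gcongr
        have h4 : ‖(b - a - a' (t • h)) w + (b - a) h‖ ≤ (C * ‖h‖ ^ 2) * ρ + (C * ‖h‖) * ‖h‖ := by
          refine (norm_add_le _ _).trans (add_le_add ?_ ?_)
          · refine (ContinuousLinearMap.le_opNorm _ _).trans ?_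
            gcongr
            exact hT'.trans (by gcongr)
          · refine (ContinuousLinearMap.le_opNorm _ _).trans ?_
            gcongr
            exact hL'.trans (by gcongr)
        have h5 : ‖S w t * ((b - a - a' (t • h)) w + (b - a) h)‖
            ≤ (2 * ‖F₀‖) * ((C * ‖h‖ ^ 2) * ρ + (C * ‖h‖) * ‖h‖) := by
          refine (norm_mul_le _ _).trans ?_
          have := hN w hw t ht
          gcongr
        refine (norm_add_le _ _).trans ((add_le_add h3 h5).trans (le_of_eq ?_))
        rw [hK]; ring
  refine ⟨fun x => S (x - x₀) 1, ?_, ?_⟩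
  · have h0 : ‖(0 : E)‖ < ρ := by simpa using hρ
    have := hN 0 h0
    have h1 := norm_le_of_norm_deriv_le_half (f := fun t => S 0 t - F₀) (d := 0) (ε := 0)
      (fun t ht => ((hS 0 h0).2 t ht).sub_const _) le_rfl (by simp [(hS 0 h0).1])
      (fun t ht => by simp) 1 (right_mem_Icc.2 zero_le_one)
    simpa [sub_eq_zero] using h1
  · filter_upwards [ball_mem_nhds x₀ hρ] with x hx
    have hw : ‖x - x₀‖ < ρ := by simpa [dist_eq_norm] using hx
    rw [hasFDerivAt_iff_isLittleO_nhds_zero]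
    have hbig : (fun h : E => S (x + h - x₀) 1 - S (x - x₀) 1
        - ((ContinuousLinearMap.mul ℝ 𝔸 (S (x - x₀) 1)).comp (α x)) h)
          =O[nhds 0] fun h => ‖h‖ ^ 2 := by
      refine Asymptotics.IsBigO.of_bound K ?_
      have : ∀ᶠ h : E in nhds 0, ‖x - x₀ + h‖ < ρ :=
        ContinuousAt.eventually_lt (by fun_prop) continuousAt_const (by simpa using hw)
      filter_upwards [this] with h hh
      have := key (x - x₀) h hw hh
      have e : x + h - x₀ = x - x₀ + h := by abel
      simp only [ContinuousLinearMap.comp_apply, ContinuousLinearMap.mul_apply', e]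
      simpa using this
    refine hbig.trans_isLittleO ?_
    exact (Asymptotics.isLittleO_norm_pow_id one_lt_two)

/-- Bootstrapping: since `dF = F α`, each derivative gained by `F` is passed on to `dF`. -/
theorem contDiffOn_of_hasFDerivAt_mul {α : E → E →L[ℝ] 𝔸} {F : E → 𝔸} {s : Set E}
    (hs : IsOpen s) (hα : ContDiffOn ℝ ∞ α s)
    (hF : ∀ x ∈ s, HasFDerivAt F ((ContinuousLinearMap.mul ℝ 𝔸 (F x)).comp (α x)) x) :
    ContDiffOn ℝ ∞ F s := by
  have hdiff : DifferentiableOn ℝ F s := fun x hx =>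
    (hF x hx).differentiableAt.differentiableWithinAt
  rw [contDiffOn_infty]
  intro n
  induction n with
  | zero => exact contDiffOn_zero.2 hdiff.continuousOn
  | succ n ih =>
    rw [Nat.cast_succ, contDiffOn_succ_iff_fderiv_of_isOpen hs]
    refine ⟨hdiff, by simp, ?_⟩
    refine ContDiffOn.congr (f := fun x => (ContinuousLinearMap.mul ℝ 𝔸 (F x)).comp (α x)) ?_
      fun x hx => (hF x hx).fderiv
    exact ((ContinuousLinearMap.mul ℝ 𝔸).contDiff.comp_contDiffOn ih).clm_comp
      (hα.of_le (by exact_mod_cast le_top))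

end Frobenius

/-! ### Calculus of Wirtinger derivatives -/

section Wirtinger

open Filter Topology

variable {g h : ℂ → ℂ} {w : ℂ} {U : Set ℂ}

theorem _root_.HasFDerivAt.dz_eq {L : ℂ →L[ℝ] ℂ} (hg : HasFDerivAt g L w) :
    dz g w = (1 / 2 : ℂ) * (L 1 - Complex.I * L Complex.I) := by
  rw [dz, hg.fderiv]

theorem _root_.HasFDerivAt.dzbar_eq {L : ℂ →L[ℝ] ℂ} (hg : HasFDerivAt g L w) :
    dzbar g w = (1 / 2 : ℂ) * (L 1 + Complex.I * L Complex.I) := by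
  rw [dzbar, hg.fderiv]

theorem fderiv_eq_dz_dzbar (g : ℂ → ℂ) (w v : ℂ) :
    fderiv ℝ g w v = v * dz g w + conj v * dzbar g w := by
  have h1 : fderiv ℝ g w v = v.re * fderiv ℝ g w 1 + v.im * fderiv ℝ g w Complex.I := by
    conv_lhs => rw [show v = v.re • (1 : ℂ) + v.im • Complex.I by
      simp [Complex.re_add_im]]
    rw [map_add, map_smul, map_smul]
    simp
  rw [h1, dz, dzbar]
  have hv : v = v.re + v.im * Complex.I := (Complex.re_add_im v).symm
  have hc : conj v = v.re - v.im * Complex.I := by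
    apply Complex.ext <;> simp
  linear_combination (-(1 / 2) * (fderiv ℝ g w 1 - Complex.I * fderiv ℝ g w Complex.I)) * hv
    - (1 / 2) * (fderiv ℝ g w 1 + Complex.I * fderiv ℝ g w Complex.I) * hc
    + (v.im * fderiv ℝ g w Complex.I) * Complex.I_mul_I

theorem dz_congr (hgh : g =ᶠ[𝓝 w] h) : dz g w = dz h w := by
  rw [dz, dz, hgh.fderiv_eq]

theorem dzbar_congr (hgh : g =ᶠ[𝓝 w] h) : dzbar g w = dzbar h w := by
  rw [dzbar, dzbar, hgh.fderiv_eq]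

@[simp] theorem dz_const (a w : ℂ) : dz (fun _ => a) w = 0 := by simp [dz]

@[simp] theorem dzbar_const (a w : ℂ) : dzbar (fun _ => a) w = 0 := by simp [dzbar]

theorem dz_add (hg : DifferentiableAt ℝ g w) (hh : DifferentiableAt ℝ h w) :
    dz (fun x => g x + h x) w = dz g w + dz h w := by
  rw [(hg.hasFDerivAt.fun_add hh.hasFDerivAt).dz_eq, dz, dz]
  simp; ring

theorem dzbar_add (hg : DifferentiableAt ℝ g w) (hh : DifferentiableAt ℝ h w) :
    dzbar (fun x => g x + h x) w = dzbar g w + dzbar h w := by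
  rw [(hg.hasFDerivAt.fun_add hh.hasFDerivAt).dzbar_eq, dzbar, dzbar]
  simp; ring

theorem dz_neg (g : ℂ → ℂ) (w : ℂ) : dz (fun x => -g x) w = -dz g w := by
  rw [dz, fderiv_fun_neg, dz]
  simp; ring

theorem dzbar_neg (g : ℂ → ℂ) (w : ℂ) : dzbar (fun x => -g x) w = -dzbar g w := by
  rw [dzbar, fderiv_fun_neg, dzbar]
  simp; ring

theorem dz_mul (hg : DifferentiableAt ℝ g w) (hh : DifferentiableAt ℝ h w) :
    dz (fun x => g x * h x) w = dz g w * h w + g w * dz h w := by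
  rw [(hg.hasFDerivAt.fun_mul hh.hasFDerivAt).dz_eq, dz, dz]
  simp; ring

theorem dzbar_mul (hg : DifferentiableAt ℝ g w) (hh : DifferentiableAt ℝ h w) :
    dzbar (fun x => g x * h x) w = dzbar g w * h w + g w * dzbar h w := by
  rw [(hg.hasFDerivAt.fun_mul hh.hasFDerivAt).dzbar_eq, dzbar, dzbar]
  simp; ring

theorem fderiv_conj (g : ℂ → ℂ) (w v : ℂ) :
    fderiv ℝ (fun x => conj (g x)) w v = conj (fderiv ℝ g w v) := by
  have := Complex.conjCLE.comp_fderiv (f := g) (x := w)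
  change fderiv ℝ (Complex.conjCLE ∘ g) w v = _
  rw [this]; rfl

theorem dz_conj (g : ℂ → ℂ) (w : ℂ) : dz (fun x => conj (g x)) w = conj (dzbar g w) := by
  simp only [dz, dzbar, fderiv_conj, map_mul, map_add, Complex.conj_I]
  simp [map_ofNat]; ring

theorem dzbar_conj (g : ℂ → ℂ) (w : ℂ) : dzbar (fun x => conj (g x)) w = conj (dz g w) := by
  simp only [dz, dzbar, fderiv_conj, map_mul, map_sub, Complex.conj_I]
  simp [map_ofNat]

theorem contDiffOn_dz (hU : IsOpen U) (hg : ContDiffOn ℝ ∞ g U) : ContDiffOn ℝ ∞ (dz g) U := by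
  have h := hg.fderiv_of_isOpen hU (m := ∞) (by simp)
  unfold dz
  fun_prop

theorem contDiffOn_dzbar (hU : IsOpen U) (hg : ContDiffOn ℝ ∞ g U) :
    ContDiffOn ℝ ∞ (dzbar g) U := by
  have h := hg.fderiv_of_isOpen hU (m := ∞) (by simp)
  unfold dzbar
  fun_prop

theorem contDiffOn_conj (hg : ContDiffOn ℝ ∞ g U) : ContDiffOn ℝ ∞ (fun x => conj (g x)) U :=
  Complex.conjCLE.contDiff.comp_contDiffOn hg

/-- Both sides are a quarter of the Laplacian; the mixed terms cancel by symmetry of the second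
derivative. -/
theorem dz_dzbar_comm (hg : ContDiffAt ℝ 2 g w) : dz (dzbar g) w = dzbar (dz g) w := by
  have hs := hg.isSymmSndFDerivAt (by simp)
  have h1 : DifferentiableAt ℝ (fderiv ℝ g) w :=
    (hg.fderiv_right (m := 1) (by norm_num)).differentiableAt (by norm_num)
  have e : ∀ v : ℂ, HasFDerivAt (fun x => fderiv ℝ g x v)
      ((fderiv ℝ (fderiv ℝ g) w).flip v) w := fun v => by
    have := h1.hasFDerivAt.clm_apply (hasFDerivAt_const v w)
    exact this.congr_fderiv (by ext; simp)
  have hz : HasFDerivAt (dzbar g) _ w :=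
    ((e 1).add ((e Complex.I).const_mul Complex.I)).const_mul (1 / 2 : ℂ)
  have hz' : HasFDerivAt (dz g) _ w :=
    ((e 1).sub ((e Complex.I).const_mul Complex.I)).const_mul (1 / 2 : ℂ)
  rw [hz.dz_eq, hz'.dzbar_eq]
  have := hs.eq 1 Complex.I
  simp [this]
  ring

theorem dz_comp_holomorphic {t : ℂ → ℂ} (hg : DifferentiableAt ℝ g (t w))
    (ht : DifferentiableAt ℂ t w) : dz (fun x => g (t x)) w = dz g (t w) * deriv t w := by
  have h1 := hg.hasFDerivAt.comp w (ht.hasDerivAt.hasFDerivAt.restrictScalars ℝ)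
  have h2 : HasFDerivAt (fun x => g (t x)) _ w := h1
  rw [h2.dz_eq]
  simp [fderiv_eq_dz_dzbar]
  linear_combination (-(dz g (t w) * deriv t w) + conj (deriv t w) * dzbar g (t w)) / 2
    * Complex.I_mul_I

theorem dzbar_comp_holomorphic {t : ℂ → ℂ} (hg : DifferentiableAt ℝ g (t w))
    (ht : DifferentiableAt ℂ t w) :
    dzbar (fun x => g (t x)) w = dzbar g (t w) * conj (deriv t w) := by
  have h1 := hg.hasFDerivAt.comp w (ht.hasDerivAt.hasFDerivAt.restrictScalars ℝ)
  have h2 : HasFDerivAt (fun x => g (t x)) _ w := h1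
  rw [h2.dzbar_eq]
  simp [fderiv_eq_dz_dzbar]
  linear_combination ((dz g (t w) * deriv t w) - conj (deriv t w) * dzbar g (t w)) / 2
    * Complex.I_mul_I

theorem dz_of_holomorphic (hg : DifferentiableAt ℂ g w) : dz g w = deriv g w := by
  rw [(hg.hasDerivAt.hasFDerivAt.restrictScalars ℝ).dz_eq]
  simp
  linear_combination (-(deriv g w) / 2) * Complex.I_mul_I

theorem dzbar_of_holomorphic (hg : DifferentiableAt ℂ g w) : dzbar g w = 0 := by
  rw [(hg.hasDerivAt.hasFDerivAt.restrictScalars ℝ).dzbar_eq]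
  simp
  linear_combination ((deriv g w)) * Complex.I_mul_I

end Wirtinger

/-! ### Vector valued functions and the Minkowski form -/

section Mink

open Filter Topology

variable {R : Type*} [CommRing R]

theorem mink_expand (v w : Fin 5 → R) :
    mink v w = -(v 0 * w 0) + (v 1 * w 1 + v 2 * w 2 + v 3 * w 3 + v 4 * w 4) := by
  simp only [mink, Fin.sum_univ_four]; rfl

theorem mink_comm (v w : Fin 5 → R) : mink v w = mink w v := by
  simp only [mink_expand]; ring

theorem mink_add_left (u v w : Fin 5 → R) : mink (u + v) w = mink u w + mink v w := by
  simp only [mink_expand, Pi.add_apply]; ring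

theorem mink_add_right (u v w : Fin 5 → R) : mink u (v + w) = mink u v + mink u w := by
  simp only [mink_expand, Pi.add_apply]; ring

theorem mink_smul_left (a : R) (v w : Fin 5 → R) : mink (a • v) w = a * mink v w := by
  simp only [mink_expand, Pi.smul_apply, smul_eq_mul]; ring

theorem mink_smul_right (a : R) (v w : Fin 5 → R) : mink v (a • w) = a * mink v w := by
  simp only [mink_expand, Pi.smul_apply, smul_eq_mul]; ring

theorem mink_map {S : Type*} [CommRing S] (φ : R →+* S) (v w : Fin 5 → R) :
    mink (fun i => φ (v i)) (fun i => φ (w i)) = φ (mink v w) := by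
  simp [mink]

theorem mink_ofReal (v w : Fin 5 → ℝ) :
    mink (fun i => (v i : ℂ)) (fun i => (w i : ℂ)) = ((mink v w : ℝ) : ℂ) :=
  mink_map Complex.ofRealHom v w

theorem mink_conj (v w : Fin 5 → ℂ) :
    mink (fun i => conj (v i)) (fun i => conj (w i)) = conj (mink v w) :=
  mink_map (starRingEnd ℂ) v w

variable {v u : ℂ → Fin 5 → ℂ} {l : ℂ → ℂ} {w : ℂ} {U : Set ℂ}

theorem dz_mink (hv : DifferentiableAt ℝ v w) (hu : DifferentiableAt ℝ u w) :
    dz (fun x => mink (v x) (u x)) w = mink (dzVec v w) (u w) + mink (v w) (dzVec u w) := by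
  have hv := fun i => (hasFDerivAt_pi'.1 hv.hasFDerivAt i).differentiableAt
  have hu := fun i => (hasFDerivAt_pi'.1 hu.hasFDerivAt i).differentiableAt
  simp only [mink_expand]
  have hm : ∀ i, DifferentiableAt ℝ (fun x => v x i * u x i) w := fun i => (hv i).mul (hu i)
  have e : ∀ i, dz (fun x => v x i * u x i) w = _ := fun i => dz_mul (hv i) (hu i)
  rw [dz_add (hm 0).fun_neg ((((hm 1).fun_add (hm 2)).fun_add (hm 3)).fun_add (hm 4)), dz_neg,
    dz_add (((hm 1).fun_add (hm 2)).fun_add (hm 3)) (hm 4),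
    dz_add ((hm 1).fun_add (hm 2)) (hm 3), dz_add (hm 1) (hm 2)]
  simp only [e, dzVec]
  ring

theorem dzbar_mink (hv : DifferentiableAt ℝ v w) (hu : DifferentiableAt ℝ u w) :
    dzbar (fun x => mink (v x) (u x)) w
      = mink (dzbarVec v w) (u w) + mink (v w) (dzbarVec u w) := by
  have hv := fun i => (hasFDerivAt_pi'.1 hv.hasFDerivAt i).differentiableAt
  have hu := fun i => (hasFDerivAt_pi'.1 hu.hasFDerivAt i).differentiableAt
  simp only [mink_expand]
  have hm : ∀ i, DifferentiableAt ℝ (fun x => v x i * u x i) w := fun i => (hv i).mul (hu i)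
  have e : ∀ i, dzbar (fun x => v x i * u x i) w = _ := fun i => dzbar_mul (hv i) (hu i)
  rw [dzbar_add (hm 0).fun_neg ((((hm 1).fun_add (hm 2)).fun_add (hm 3)).fun_add (hm 4)),
    dzbar_neg, dzbar_add (((hm 1).fun_add (hm 2)).fun_add (hm 3)) (hm 4),
    dzbar_add ((hm 1).fun_add (hm 2)) (hm 3), dzbar_add (hm 1) (hm 2)]
  simp only [e, dzbarVec]
  ring

theorem dzVec_congr (h : v =ᶠ[𝓝 w] u) : dzVec v w = dzVec u w :=
  funext fun i => dz_congr (h.mono fun _ hx => congrFun hx i)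

theorem dzbarVec_congr (h : v =ᶠ[𝓝 w] u) : dzbarVec v w = dzbarVec u w :=
  funext fun i => dzbar_congr (h.mono fun _ hx => congrFun hx i)

theorem dzVec_add (hv : DifferentiableAt ℝ v w) (hu : DifferentiableAt ℝ u w) :
    dzVec (fun x => v x + u x) w = dzVec v w + dzVec u w :=
  funext fun i => dz_add (hasFDerivAt_pi'.1 hv.hasFDerivAt i).differentiableAt
    (hasFDerivAt_pi'.1 hu.hasFDerivAt i).differentiableAt

theorem dzVec_smul (hl : DifferentiableAt ℝ l w) (hv : DifferentiableAt ℝ v w) :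
    dzVec (fun x => l x • v x) w = dz l w • v w + l w • dzVec v w :=
  funext fun i => dz_mul hl (hasFDerivAt_pi'.1 hv.hasFDerivAt i).differentiableAt

theorem dzbarVec_smul (hl : DifferentiableAt ℝ l w) (hv : DifferentiableAt ℝ v w) :
    dzbarVec (fun x => l x • v x) w = dzbar l w • v w + l w • dzbarVec v w :=
  funext fun i => dzbar_mul hl (hasFDerivAt_pi'.1 hv.hasFDerivAt i).differentiableAt

theorem dzVec_comp_holomorphic {t : ℂ → ℂ} (hv : DifferentiableAt ℝ v (t w))
    (ht : DifferentiableAt ℂ t w) : dzVec (fun x => v (t x)) w = deriv t w • dzVec v (t w) :=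
  funext fun i => (dz_comp_holomorphic (hasFDerivAt_pi'.1 hv.hasFDerivAt i).differentiableAt
    ht).trans (mul_comm _ _)

theorem dzbarVec_comp_holomorphic {t : ℂ → ℂ} (hv : DifferentiableAt ℝ v (t w))
    (ht : DifferentiableAt ℂ t w) :
    dzbarVec (fun x => v (t x)) w = conj (deriv t w) • dzbarVec v (t w) :=
  funext fun i => (dzbar_comp_holomorphic (hasFDerivAt_pi'.1 hv.hasFDerivAt i).differentiableAt
    ht).trans (mul_comm _ _)

theorem contDiffOn_dzVec (hU : IsOpen U) (hv : ContDiffOn ℝ ∞ v U) :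
    ContDiffOn ℝ ∞ (dzVec v) U :=
  contDiffOn_pi.2 fun i => contDiffOn_dz hU (contDiffOn_pi.1 hv i)

theorem contDiffOn_dzbarVec (hU : IsOpen U) (hv : ContDiffOn ℝ ∞ v U) :
    ContDiffOn ℝ ∞ (dzbarVec v) U :=
  contDiffOn_pi.2 fun i => contDiffOn_dzbar hU (contDiffOn_pi.1 hv i)

theorem dzVec_dzbarVec_comm (hv : ContDiffAt ℝ 2 v w) :
    dzVec (dzbarVec v) w = dzbarVec (dzVec v) w :=
  funext fun i => dz_dzbar_comm (contDiffAt_pi.1 hv i)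

theorem dzbarVec_of_real (hv : ∀ x i, conj (v x i) = v x i) (w : ℂ) :
    dzbarVec v w = fun i => conj (dzVec v w i) := by
  funext i
  have h := dzbar_conj (fun x => v x i) w
  simp only [hv] at h
  exact h

theorem contDiffOn_mink (hv : ContDiffOn ℝ ∞ v U) (hu : ContDiffOn ℝ ∞ u U) :
    ContDiffOn ℝ ∞ (fun x => mink (v x) (u x)) U := by
  have hv := contDiffOn_pi.1 hv
  have hu := contDiffOn_pi.1 hu
  simp only [mink_expand]
  exact ((hv 0).mul (hu 0)).neg.add (((((hv 1).mul (hu 1)).add ((hv 2).mul (hu 2))).add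
    ((hv 3).mul (hu 3))).add ((hv 4).mul (hu 4)))

end Mink

/-! ### Moving frames -/

section Frames

open Filter Topology Matrix

/-- Matrix of the Minkowski form. -/
def minkMat : Matrix (Fin 5) (Fin 5) ℂ := Matrix.diagonal ![-1, 1, 1, 1, 1]

/-- Gram matrix of a moving frame `ψ, ψ_z, ψ_z̄, ψ̂, n`. -/
def gramMat : Matrix (Fin 5) (Fin 5) ℂ :=
  !![0, 0, 0, -1, 0; 0, 0, 1 / 2, 0, 0; 0, 1 / 2, 0, 0, 0; -1, 0, 0, 0, 0; 0, 0, 0, 0, 1]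

/-- Inverse of the Gram matrix of a moving frame. -/
def gramInv : Matrix (Fin 5) (Fin 5) ℂ :=
  !![0, 0, 0, -1, 0; 0, 0, 2, 0, 0; 0, 2, 0, 0, 0; -1, 0, 0, 0, 0; 0, 0, 0, 0, 1]

/-- The exchange of `ψ_z` and `ψ_z̄`. -/
def swapMat : Matrix (Fin 5) (Fin 5) ℂ :=
  !![1, 0, 0, 0, 0; 0, 0, 1, 0, 0; 0, 1, 0, 0, 0; 0, 0, 0, 1, 0; 0, 0, 0, 0, 1]

/-- Coefficient matrix of `∂/∂z` in a moving frame; `k, k', c, d` stand for `κ, κ̄, c, κ_z̄`. -/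
def connMat (k k' c d : ℂ) : Matrix (Fin 5) (Fin 5) ℂ :=
  !![0, -c / 2, -(k * k'), 0, 2 * d;
     1, 0, 0, -2 * (k * k'), 0;
     0, 0, 0, -c, -2 * k;
     0, 0, 1 / 2, 0, 0;
     0, k, 0, 2 * d, 0]

/-- Coefficient matrix of `∂/∂z̄` in a moving frame; `k, k', c', d'` stand for `κ, κ̄, c̄, κ̄_z`. -/
def connMatBar (k k' c' d' : ℂ) : Matrix (Fin 5) (Fin 5) ℂ :=
  !![0, -(k * k'), -c' / 2, 0, 2 * d';
     0, 0, 0, -c', -2 * k';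
     1, 0, 0, -2 * (k * k'), 0;
     0, 1 / 2, 0, 0, 0;
     0, 0, k', 2 * d', 0]

theorem gramInv_mul_gramMat : gramInv * gramMat = 1 := by
  ext i j
  fin_cases i <;> fin_cases j <;> simp [gramInv, gramMat, Matrix.mul_apply, Fin.sum_univ_five]

theorem minkMat_mul_self : minkMat * minkMat = 1 := by
  rw [minkMat, diagonal_mul_diagonal, ← diagonal_one]
  congr 1
  ext i
  fin_cases i <;> simp

/-- The coefficient matrix is an infinitesimal isometry of the Gram matrix, expressed through the
inverse Gram matrix. In this form it makes `G * gramInv * Fᵀ` constant for any two solutions,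
without inverting a frame. -/
theorem connMat_skew (k k' c d : ℂ) :
    connMat k k' c d * gramInv + gramInv * (connMat k k' c d)ᵀ = 0 := by
  ext i j
  fin_cases i <;> fin_cases j <;>
    simp only [Matrix.add_apply, Matrix.mul_apply, Fin.sum_univ_five, transpose_apply] <;>
    simp [gramInv, connMat] <;> ring

theorem connMatBar_skew (k k' c d : ℂ) :
    connMatBar k k' c d * gramInv + gramInv * (connMatBar k k' c d)ᵀ = 0 := by
  ext i j
  fin_cases i <;> fin_cases j <;>
    simp only [Matrix.add_apply, Matrix.mul_apply, Fin.sum_univ_five, transpose_apply] <;>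
    simp [gramInv, connMatBar] <;> ring

/-- The matrix with the given columns. -/
def colMat (a b c d e : Fin 5 → ℂ) : Matrix (Fin 5) (Fin 5) ℂ := fun i => ![a i, b i, c i, d i, e i]

theorem transpose_minkMat_mul (F G : Matrix (Fin 5) (Fin 5) ℂ) (i j : Fin 5) :
    (Fᵀ * minkMat * G) i j = mink (fun k => F k i) (fun k => G k j) := by
  rw [minkMat, Matrix.mul_apply, mink_expand]
  simp only [mul_diagonal, transpose_apply, Fin.sum_univ_five]
  simp
  ring

/-- Provides the explicit inverse of a frame, which is used wherever a frame has to be cancelled. -/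
theorem mul_gramInv_of_gram {F : Matrix (Fin 5) (Fin 5) ℂ} (h : Fᵀ * minkMat * F = gramMat) :
    F * (gramInv * Fᵀ * minkMat) = 1 := by
  rw [mul_eq_one_comm]
  rw [Matrix.mul_assoc, Matrix.mul_assoc, ← Matrix.mul_assoc Fᵀ, h, gramInv_mul_gramMat]

theorem eq_of_mink_frame {F : Matrix (Fin 5) (Fin 5) ℂ} (h : Fᵀ * minkMat * F = gramMat)
    {v w : Fin 5 → ℂ} (hvw : ∀ j, mink (fun k => F k j) v = mink (fun k => F k j) w) : v = w := by
  have e : ∀ v : Fin 5 → ℂ, (Fᵀ * minkMat) *ᵥ v = fun j => mink (fun k => F k j) v := fun v => by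
    funext j
    have := transpose_minkMat_mul F (Matrix.of fun k _ => v k) j 0
    exact (Matrix.mul_apply ..).symm.trans this
  have e2 : ∀ v : Fin 5 → ℂ, v = (F * gramInv) *ᵥ ((Fᵀ * minkMat) *ᵥ v) := fun v => by
    rw [mulVec_mulVec, Matrix.mul_assoc, ← Matrix.mul_assoc gramInv, mul_gramInv_of_gram h,
      one_mulVec]
  rw [e2 v, e2 w, e, e, funext hvw]

/-- Entrywise `∂/∂z` of a matrix valued function. -/
def dzMat (F : ℂ → Matrix (Fin 5) (Fin 5) ℂ) (w : ℂ) : Matrix (Fin 5) (Fin 5) ℂ :=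
  fun i j => dz (fun x => F x i j) w

/-- Entrywise `∂/∂z̄` of a matrix valued function. -/
def dzbarMat (F : ℂ → Matrix (Fin 5) (Fin 5) ℂ) (w : ℂ) : Matrix (Fin 5) (Fin 5) ℂ :=
  fun i j => dzbar (fun x => F x i j) w

variable {F G : ℂ → Matrix (Fin 5) (Fin 5) ℂ} {w : ℂ} {U : Set ℂ}

theorem differentiableAt_matrix_mul (hF : ∀ i j, DifferentiableAt ℝ (fun x => F x i j) w)
    (hG : ∀ i j, DifferentiableAt ℝ (fun x => G x i j) w) (i j : Fin 5) :
    DifferentiableAt ℝ (fun x => (F x * G x) i j) w := by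
  simp only [Matrix.mul_apply, Fin.sum_univ_five]
  have := fun k => (hF i k).fun_mul (hG k j)
  exact ((((this 0).fun_add (this 1)).fun_add (this 2)).fun_add (this 3)).fun_add (this 4)

theorem dzMat_mul (hF : ∀ i j, DifferentiableAt ℝ (fun x => F x i j) w)
    (hG : ∀ i j, DifferentiableAt ℝ (fun x => G x i j) w) :
    dzMat (fun x => F x * G x) w = dzMat F w * G w + F w * dzMat G w := by
  ext i j
  simp only [dzMat, Matrix.mul_apply, Fin.sum_univ_five, Matrix.add_apply]
  have := fun k => (hF i k).fun_mul (hG k j)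
  rw [dz_add ((((this 0).fun_add (this 1)).fun_add (this 2)).fun_add (this 3)) (this 4),
    dz_add (((this 0).fun_add (this 1)).fun_add (this 2)) (this 3),
    dz_add ((this 0).fun_add (this 1)) (this 2), dz_add (this 0) (this 1)]
  simp only [dz_mul (hF i _) (hG _ j)]
  ring

theorem dzbarMat_mul (hF : ∀ i j, DifferentiableAt ℝ (fun x => F x i j) w)
    (hG : ∀ i j, DifferentiableAt ℝ (fun x => G x i j) w) :
    dzbarMat (fun x => F x * G x) w = dzbarMat F w * G w + F w * dzbarMat G w := by
  ext i j
  simp only [dzbarMat, Matrix.mul_apply, Fin.sum_univ_five, Matrix.add_apply]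
  have := fun k => (hF i k).fun_mul (hG k j)
  rw [dzbar_add ((((this 0).fun_add (this 1)).fun_add (this 2)).fun_add (this 3)) (this 4),
    dzbar_add (((this 0).fun_add (this 1)).fun_add (this 2)) (this 3),
    dzbar_add ((this 0).fun_add (this 1)) (this 2), dzbar_add (this 0) (this 1)]
  simp only [dzbar_mul (hF i _) (hG _ j)]
  ring

theorem dzMat_const (M : Matrix (Fin 5) (Fin 5) ℂ) (w : ℂ) : dzMat (fun _ => M) w = 0 := by
  ext i j
  simp [dzMat]

theorem dzbarMat_const (M : Matrix (Fin 5) (Fin 5) ℂ) (w : ℂ) : dzbarMat (fun _ => M) w = 0 := by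
  ext i j
  simp [dzbarMat]

/-- A solution of the structure equations of conformal surface theory. -/
structure IsParallelFrame (κ c : ℂ → ℂ) (F : ℂ → Matrix (Fin 5) (Fin 5) ℂ) (U : Set ℂ) : Prop where
  differentiableAt : ∀ w ∈ U, ∀ i j, DifferentiableAt ℝ (fun x => F x i j) w
  dz_eq : ∀ w ∈ U,
    dzMat F w = F w * connMat (κ w) (conj (κ w)) (c w) (dzbar κ w)
  dzbar_eq : ∀ w ∈ U,
    dzbarMat F w = F w * connMatBar (κ w) (conj (κ w)) (conj (c w)) (conj (dzbar κ w))

variable {κ c : ℂ → ℂ}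

/-- Two solutions of the structure equations differ by a locally constant matrix. -/
theorem IsParallelFrame.mul_eq_of_eventually (hU : IsOpen U) (hF : IsParallelFrame κ c F U)
    (hG : IsParallelFrame κ c G U) (hw : w ∈ U) :
    ∀ᶠ x in 𝓝 w, G x * (gramInv * (F x)ᵀ) = G w * (gramInv * (F w)ᵀ) := by
  have hFt : ∀ x ∈ U, ∀ i j, DifferentiableAt ℝ (fun x => (F x)ᵀ i j) x :=
    fun x hx i j => hF.differentiableAt x hx j i
  have hc : ∀ x : ℂ, ∀ i j : Fin 5, DifferentiableAt ℝ (fun _ : ℂ => gramInv i j) x :=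
    fun x i j => differentiableAt_const _
  have hBF := fun x hx => differentiableAt_matrix_mul (hc x) (hFt x hx)
  have hA := fun x hx => differentiableAt_matrix_mul (hG.differentiableAt x hx) (hBF x hx)
  -- By the product rule the derivative is `G (P g + g Pᵀ) Fᵀ`, with `P` the coefficient matrix and
  -- `g` the inverse Gram matrix; the bracket vanishes by skewness.
  have h1 : ∀ x ∈ U, dzMat (fun x => G x * (gramInv * (F x)ᵀ)) x = 0 := by
    intro x hx
    have e : dzMat (fun x => (F x)ᵀ) x = (dzMat F x)ᵀ := rfl
    rw [dzMat_mul (hG.differentiableAt x hx) (hBF x hx), dzMat_mul (hc x) (hFt x hx), e,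
      hF.dz_eq x hx, hG.dz_eq x hx, dzMat_const, transpose_mul]
    have := congrArg (fun M => G x * M * (F x)ᵀ)
      (connMat_skew (κ x) (conj (κ x)) (c x) (dzbar κ x))
    simp only [Matrix.mul_add, Matrix.add_mul, Matrix.mul_zero, Matrix.zero_mul,
      Matrix.mul_assoc] at this
    simpa [Matrix.mul_assoc] using this
  have h2 : ∀ x ∈ U, dzbarMat (fun x => G x * (gramInv * (F x)ᵀ)) x = 0 := by
    intro x hx
    have e : dzbarMat (fun x => (F x)ᵀ) x = (dzbarMat F x)ᵀ := rfl
    rw [dzbarMat_mul (hG.differentiableAt x hx) (hBF x hx), dzbarMat_mul (hc x) (hFt x hx), e,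
      hF.dzbar_eq x hx, hG.dzbar_eq x hx, dzbarMat_const, transpose_mul]
    have := congrArg (fun M => G x * M * (F x)ᵀ)
      (connMatBar_skew (κ x) (conj (κ x)) (conj (c x)) (conj (dzbar κ x)))
    simp only [Matrix.mul_add, Matrix.add_mul, Matrix.mul_zero, Matrix.zero_mul,
      Matrix.mul_assoc] at this
    simpa [Matrix.mul_assoc] using this
  obtain ⟨r, hr, hrU⟩ := Metric.isOpen_iff.1 hU w hw
  filter_upwards [Metric.ball_mem_nhds w hr] with x hx
  ext i j
  refine Metric.isOpen_ball.is_const_of_fderiv_eq_zero (𝕜 := ℝ)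
    (f := fun x => (G x * (gramInv * (F x)ᵀ)) i j) (convex_ball w r).isPreconnected
    (fun y hy => (hA y (hrU hy) i j).differentiableWithinAt) (fun y hy => ?_) hx
    (Metric.mem_ball_self hr)
  ext v
  rw [fderiv_eq_dz_dzbar]
  have e1 := congrFun (congrFun (h1 y (hrU hy)) i) j
  have e2 := congrFun (congrFun (h2 y (hrU hy)) i) j
  simp only [dzMat, dzbarMat, Matrix.zero_apply] at e1 e2
  simp [e1, e2]

end Frames

/-! ### Normalized lifts and their structure equations -/

section NormalizedLifts

open Filter Topology Matrix

/-- Normalized lifts of conformal immersions together with unit normals, intrinsically in the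
complexified Minkowski space. -/
structure IsNormalizedLift (κ c : ℂ → ℂ) (ψ n : ℂ → Fin 5 → ℂ) (U : Set ℂ) : Prop where
  smooth : ContDiffOn ℝ ∞ ψ U
  smooth_normal : ContDiffOn ℝ ∞ n U
  real : ∀ w i, conj (ψ w i) = ψ w i
  real_normal : ∀ w i, conj (n w i) = n w i
  null : ∀ w ∈ U, mink (ψ w) (ψ w) = 0
  conformal : ∀ w ∈ U, mink (dzVec ψ w) (dzVec ψ w) = 0
  normalized : ∀ w ∈ U, mink (dzVec ψ w) (dzbarVec ψ w) = 1 / 2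
  unit_normal : ∀ w ∈ U, mink (n w) (n w) = 1
  normal_lift : ∀ w ∈ U, mink (n w) (ψ w) = 0
  normal_dz : ∀ w ∈ U, mink (n w) (dzVec ψ w) = 0
  normal_dz_dzbar : ∀ w ∈ U, mink (n w) (dzVec (dzbarVec ψ) w) = 0
  hill : ∀ w ∈ U, dzVec (dzVec ψ) w + (c w / 2) • ψ w = κ w • n w

/-- The moving frame of a normalized lift. -/
def liftFrame (κ : ℂ → ℂ) (ψ n : ℂ → Fin 5 → ℂ) (w : ℂ) : Matrix (Fin 5) (Fin 5) ℂ :=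
  colMat (ψ w) (dzVec ψ w) (dzbarVec ψ w)
    ((2 : ℂ) • dzVec (dzbarVec ψ) w + (2 * (κ w * conj (κ w))) • ψ w) (n w)

variable {κ c : ℂ → ℂ} {ψ n : ℂ → Fin 5 → ℂ} {U : Set ℂ}

/-- The working tool of the frame computations: every constant scalar product yields a relation
among scalar products with one more derivative. -/
theorem mink_dzVec_of_const {v u : ℂ → Fin 5 → ℂ} {a w : ℂ} (hU : IsOpen U)
    (hv : ContDiffOn ℝ ∞ v U) (hu : ContDiffOn ℝ ∞ u U) (h : ∀ x ∈ U, mink (v x) (u x) = a)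
    (hw : w ∈ U) : mink (dzVec v w) (u w) + mink (v w) (dzVec u w) = 0 := by
  have hn := hU.mem_nhds hw
  rw [← dz_mink ((hv.contDiffAt hn).differentiableAt (by simp))
    ((hu.contDiffAt hn).differentiableAt (by simp)), ← dz_const a w]
  exact dz_congr (eventually_of_mem hn h)

theorem mink_dzbarVec_of_const {v u : ℂ → Fin 5 → ℂ} {a w : ℂ} (hU : IsOpen U)
    (hv : ContDiffOn ℝ ∞ v U) (hu : ContDiffOn ℝ ∞ u U) (h : ∀ x ∈ U, mink (v x) (u x) = a)
    (hw : w ∈ U) : mink (dzbarVec v w) (u w) + mink (v w) (dzbarVec u w) = 0 := by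
  have hn := hU.mem_nhds hw
  rw [← dzbar_mink ((hv.contDiffAt hn).differentiableAt (by simp))
    ((hu.contDiffAt hn).differentiableAt (by simp)), ← dzbar_const a w]
  exact dzbar_congr (eventually_of_mem hn h)

namespace IsNormalizedLift

theorem dzbarVec_eq (h : IsNormalizedLift κ c ψ n U) (w : ℂ) :
    dzbarVec ψ w = fun i => conj (dzVec ψ w i) := dzbarVec_of_real h.real w

theorem dzbarVec_dzbarVec_eq (h : IsNormalizedLift κ c ψ n U) (w : ℂ) :
    dzbarVec (dzbarVec ψ) w = fun i => conj (dzVec (dzVec ψ) w i) := by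
  funext i
  have e : dzbarVec ψ = fun w i => conj (dzVec ψ w i) := funext h.dzbarVec_eq
  rw [e]
  exact dzbar_conj _ _

theorem mink_conj_lift (h : IsNormalizedLift κ c ψ n U) {a b : Fin 5 → ℂ} (w : ℂ)
    (hab : mink (ψ w) a = 0) (hb : b = fun i => conj (a i)) : mink (ψ w) b = 0 := by
  rw [hb, ← map_zero (starRingEnd ℂ), ← hab, ← mink_conj]
  simp only [h.real]

theorem mink_conj_normal (h : IsNormalizedLift κ c ψ n U) {a b : Fin 5 → ℂ} (w : ℂ)
    (hab : mink (n w) a = 0) (hb : b = fun i => conj (a i)) : mink (n w) b = 0 := by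
  rw [hb, ← map_zero (starRingEnd ℂ), ← hab, ← mink_conj]
  simp only [h.real_normal]

variable (hU : IsOpen U) (h : IsNormalizedLift κ c ψ n U)
include hU h

theorem dzbarVec_dzVec {w : ℂ} (hw : w ∈ U) :
    dzbarVec (dzVec ψ) w = dzVec (dzbarVec ψ) w :=
  (dzVec_dzbarVec_comm ((h.smooth.contDiffAt (hU.mem_nhds hw)).of_le (by norm_cast))).symm

theorem mink_dz_lift {w : ℂ} (hw : w ∈ U) : mink (dzVec ψ w) (ψ w) = 0 := by
  have := mink_dzVec_of_const hU h.smooth h.smooth h.null hw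
  rw [mink_comm (ψ w)] at this
  linear_combination this / 2

theorem mink_dzbar_lift {w : ℂ} (hw : w ∈ U) : mink (dzbarVec ψ w) (ψ w) = 0 := by
  have := mink_dzbarVec_of_const hU h.smooth h.smooth h.null hw
  rw [mink_comm (ψ w)] at this
  linear_combination this / 2

omit hU in
theorem mink_dzbar_dzbar {w : ℂ} (hw : w ∈ U) : mink (dzbarVec ψ w) (dzbarVec ψ w) = 0 := by
  rw [h.dzbarVec_eq w, mink_conj, h.conformal w hw, map_zero]

theorem mink_dz_dzbar_lift {w : ℂ} (hw : w ∈ U) : mink (dzVec (dzbarVec ψ) w) (ψ w) = -1 / 2 := by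
  have := mink_dzVec_of_const hU (contDiffOn_dzbarVec hU h.smooth) h.smooth
    (fun x hx => h.mink_dzbar_lift hU hx) hw
  rw [mink_comm (dzbarVec ψ w), h.normalized w hw] at this
  linear_combination this

theorem mink_dz_dzbar_dz {w : ℂ} (hw : w ∈ U) :
    mink (dzVec (dzbarVec ψ) w) (dzVec ψ w) = 0 := by
  have hp := contDiffOn_dzVec hU h.smooth
  have := mink_dzbarVec_of_const hU hp hp h.conformal hw
  rw [h.dzbarVec_dzVec hU hw, mink_comm (dzVec ψ w)] at this
  linear_combination this / 2

theorem mink_dz_dzbar_dzbar {w : ℂ} (hw : w ∈ U) :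
    mink (dzVec (dzbarVec ψ) w) (dzbarVec ψ w) = 0 := by
  have hq := contDiffOn_dzbarVec hU h.smooth
  have := mink_dzVec_of_const hU hq hq (fun x hx => h.mink_dzbar_dzbar hx) hw
  rw [mink_comm (dzbarVec ψ w)] at this
  linear_combination this / 2

theorem mink_dz_dz_dzbar {w : ℂ} (hw : w ∈ U) :
    mink (dzVec (dzVec ψ) w) (dzbarVec ψ w) = 0 := by
  have := mink_dzVec_of_const hU (contDiffOn_dzVec hU h.smooth) (contDiffOn_dzbarVec hU h.smooth)
    h.normalized hw
  rw [mink_comm (dzVec ψ w), h.mink_dz_dzbar_dz hU hw] at this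
  linear_combination this

omit hU in
theorem dzVec_dzVec_eq {w : ℂ} (hw : w ∈ U) :
    dzVec (dzVec ψ) w = (-c w / 2) • ψ w + κ w • n w := by
  rw [← h.hill w hw]; module

omit hU in
theorem dzbarVec_dzbarVec_eq' {w : ℂ} (hw : w ∈ U) :
    dzbarVec (dzbarVec ψ) w = (-conj (c w) / 2) • ψ w + conj (κ w) • n w := by
  rw [h.dzbarVec_dzbarVec_eq, h.dzVec_dzVec_eq hw]
  funext i
  simp [h.real, h.real_normal, map_ofNat]

omit hU in
theorem mink_normal_dzbar {w : ℂ} (hw : w ∈ U) : mink (n w) (dzbarVec ψ w) = 0 :=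
  h.mink_conj_normal w (h.normal_dz w hw) (h.dzbarVec_eq w)

omit hU in
theorem mink_normal_dz_dz {w : ℂ} (hw : w ∈ U) : mink (n w) (dzVec (dzVec ψ) w) = κ w := by
  rw [h.dzVec_dzVec_eq hw, mink_add_right, mink_smul_right, mink_smul_right, h.normal_lift w hw,
    h.unit_normal w hw]
  ring

/-- Smoothness of the Hopf differential is not part of the data: it follows from `κ = ⟨n, ψ_zz⟩`. -/
theorem contDiffOn_hopf : ContDiffOn ℝ ∞ κ U :=
  (contDiffOn_mink h.smooth_normal (contDiffOn_dzVec hU (contDiffOn_dzVec hU h.smooth))).congr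
    fun _ hx => (h.mink_normal_dz_dz hx).symm

theorem dzbarVec_dzVec_dzVec {w : ℂ} (hw : w ∈ U) :
    dzbarVec (dzVec (dzVec ψ)) w = dzVec (dzVec (dzbarVec ψ)) w := by
  rw [← dzVec_dzbarVec_comm (((contDiffOn_dzVec hU h.smooth).contDiffAt
    (hU.mem_nhds hw)).of_le (by norm_cast))]
  exact dzVec_congr (eventually_of_mem (hU.mem_nhds hw) fun x hx => h.dzbarVec_dzVec hU hx)

/-- Differentiate `⟨ψ_zz, ψ_z̄⟩ = 0` by `z̄` and `⟨ψ_zz̄, ψ_z̄⟩ = 0` by `z`. Both relations contain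
`⟨ψ_zzz̄, ψ_z̄⟩`, so the required product equals `⟨ψ_zz, ψ_z̄z̄⟩`, which the Hill equation and its
conjugate evaluate. -/
theorem mink_dz_dzbar_self {w : ℂ} (hw : w ∈ U) :
    mink (dzVec (dzbarVec ψ) w) (dzVec (dzbarVec ψ) w) = κ w * conj (κ w) := by
  have hp := contDiffOn_dzVec hU h.smooth
  have hq := contDiffOn_dzbarVec hU h.smooth
  have e1 := mink_dzbarVec_of_const hU (contDiffOn_dzVec hU hp) hq
    (fun x hx => h.mink_dz_dz_dzbar hU hx) hw
  have e2 := mink_dzVec_of_const hU (contDiffOn_dzVec hU hq) hq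
    (fun x hx => h.mink_dz_dzbar_dzbar hU hx) hw
  rw [h.dzbarVec_dzVec_dzVec hU hw] at e1
  have e3 : mink (dzVec (dzVec ψ) w) (dzbarVec (dzbarVec ψ) w) = κ w * conj (κ w) := by
    rw [h.dzVec_dzVec_eq hw, h.dzbarVec_dzbarVec_eq' hw]
    simp only [mink_add_left, mink_add_right, mink_smul_left, mink_smul_right, h.null w hw,
      h.normal_lift w hw, h.unit_normal w hw, mink_comm (ψ w) (n w)]
    ring
  linear_combination e2 - e1 + e3

/-- The correction `2|κ|² ψ` in the fourth column makes it null: its square is `4|κ|² + 8|κ|² ·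
(-1/2)`. The other entries are the scalar products found above. -/
theorem liftFrame_gram {w : ℂ} (hw : w ∈ U) :
    (liftFrame κ ψ n w)ᵀ * minkMat * liftFrame κ ψ n w = gramMat := by
  ext i j
  rw [transpose_minkMat_mul]
  have c0 : (fun k => liftFrame κ ψ n w k 0) = ψ w := rfl
  have c1 : (fun k => liftFrame κ ψ n w k 1) = dzVec ψ w := rfl
  have c2 : (fun k => liftFrame κ ψ n w k 2) = dzbarVec ψ w := rfl
  have c3 : (fun k => liftFrame κ ψ n w k 3)
    = (2 : ℂ) • dzVec (dzbarVec ψ) w + (2 * (κ w * conj (κ w))) • ψ w := rfl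
  have c4 : (fun k => liftFrame κ ψ n w k 4) = n w := rfl
  have e := mink_comm (R := ℂ)
  fin_cases i <;> fin_cases j <;>
    simp only [Fin.zero_eta, Fin.mk_one, Fin.reduceFinMk, c0, c1, c2, c3, c4, gramMat,
      mink_add_left, mink_add_right, mink_smul_left, mink_smul_right, h.null w hw,
      h.conformal w hw, h.normalized w hw, h.unit_normal w hw, h.normal_lift w hw,
      h.normal_dz w hw, h.normal_dz_dzbar w hw, h.mink_dz_lift hU hw, h.mink_dzbar_lift hU hw,
      h.mink_dzbar_dzbar hw, h.mink_dz_dzbar_lift hU hw, h.mink_dz_dzbar_dz hU hw,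
      h.mink_dz_dzbar_dzbar hU hw, h.mink_normal_dzbar hw, h.mink_dz_dzbar_self hU hw,
      e (ψ w) (n w), e (dzVec ψ w) (n w), e (dzbarVec ψ w) (n w),
      e (dzVec (dzbarVec ψ) w) (n w), e (ψ w) (dzVec ψ w), e (ψ w) (dzbarVec ψ w),
      e (ψ w) (dzVec (dzbarVec ψ) w), e (dzbarVec ψ w) (dzVec ψ w),
      e (dzVec ψ w) (dzVec (dzbarVec ψ) w), e (dzbarVec ψ w) (dzVec (dzbarVec ψ) w)] <;>
    simp <;> ring

/-- Vectors are determined by their products with the frame. -/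
theorem eq_of_mink {w : ℂ} (hw : w ∈ U) {a b : Fin 5 → ℂ} (h0 : mink (ψ w) a = mink (ψ w) b)
    (h1 : mink (dzVec ψ w) a = mink (dzVec ψ w) b)
    (h2 : mink (dzbarVec ψ w) a = mink (dzbarVec ψ w) b)
    (h3 : mink (dzVec (dzbarVec ψ) w) a = mink (dzVec (dzbarVec ψ) w) b)
    (h4 : mink (n w) a = mink (n w) b) : a = b := by
  refine eq_of_mink_frame (h.liftFrame_gram hU hw) fun j => ?_
  fin_cases j
  · exact h0
  · exact h1
  · exact h2
  · change mink ((2 : ℂ) • dzVec (dzbarVec ψ) w + (2 * (κ w * conj (κ w))) • ψ w) a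
      = mink ((2 : ℂ) • dzVec (dzbarVec ψ) w + (2 * (κ w * conj (κ w))) • ψ w) b
    rw [mink_add_left, mink_add_left, mink_smul_left, mink_smul_left, mink_smul_left,
      mink_smul_left, h3, h0]
  · exact h4

end IsNormalizedLift

end NormalizedLifts

/-! ### Derivatives of the moving frame: the Weingarten equation and the full linear system. -/

section StructureEquations

open Filter Topology Matrix

variable {κ c : ℂ → ℂ} {ψ n : ℂ → Fin 5 → ℂ} {U : Set ℂ}

/-- The second null vector of the moving frame. -/
def dualLift (κ : ℂ → ℂ) (ψ : ℂ → Fin 5 → ℂ) (w : ℂ) : Fin 5 → ℂ :=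
  (2 : ℂ) • dzVec (dzbarVec ψ) w + (2 * (κ w * conj (κ w))) • ψ w

theorem mink_dualLift (κ : ℂ → ℂ) (ψ : ℂ → Fin 5 → ℂ) (w : ℂ) (v : Fin 5 → ℂ) :
    mink (dualLift κ ψ w) v
      = 2 * mink (dzVec (dzbarVec ψ) w) v + 2 * (κ w * conj (κ w)) * mink (ψ w) v := by
  rw [dualLift, mink_add_left, mink_smul_left, mink_smul_left]

theorem dzVec_dzbarVec_eq (κ : ℂ → ℂ) (ψ : ℂ → Fin 5 → ℂ) (w : ℂ) :
    dzVec (dzbarVec ψ) w = (-(κ w * conj (κ w))) • ψ w + (1 / 2 : ℂ) • dualLift κ ψ w := by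
  rw [dualLift]; module

namespace IsNormalizedLift

variable (hU : IsOpen U) (h : IsNormalizedLift κ c ψ n U)
include hU h

theorem contDiffOn_dualLift : ContDiffOn ℝ ∞ (dualLift κ ψ) U := by
  have h1 := contDiffOn_dzVec hU (contDiffOn_dzbarVec hU h.smooth)
  have h2 := h.contDiffOn_hopf hU
  have h3 := h.smooth
  have h4 := contDiffOn_conj h2
  unfold dualLift
  fun_prop

/-- Conjugation exchanges `∂_z` and `∂_z̄` on the real function `ψ`, and the two commute, so `ψ_zz̄`
is real; so is the coefficient `|κ|²`. -/
theorem dualLift_real {w : ℂ} (hw : w ∈ U) (i : Fin 5) :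
    conj (dualLift κ ψ w i) = dualLift κ ψ w i := by
  have e : conj (dzVec (dzbarVec ψ) w i) = dzVec (dzbarVec ψ) w i := by
    conv_rhs => rw [← h.dzbarVec_dzVec hU hw]
    have e : dzbarVec ψ = fun w i => conj (dzVec ψ w i) := funext h.dzbarVec_eq
    have := dz_conj (fun x => dzVec ψ x i) w
    rw [e]
    change conj (dz (fun x => conj (dzVec ψ x i)) w) = _
    rw [this, Complex.conj_conj]
    rfl
  simp only [dualLift, Pi.add_apply, Pi.smul_apply, smul_eq_mul, map_add, map_mul, e, h.real,
    Complex.conj_conj, map_ofNat]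
  ring

theorem dzbarVec_dualLift_eq {w : ℂ} (hw : w ∈ U) :
    dzbarVec (dualLift κ ψ) w = fun i => conj (dzVec (dualLift κ ψ) w i) := by
  funext i
  change dzbar _ w = conj (dz (fun x => dualLift κ ψ x i) w)
  rw [← dzbar_conj]
  exact dzbar_congr (eventually_of_mem (hU.mem_nhds hw) fun x hx => (h.dualLift_real hU hx i).symm)

omit h in
theorem differentiableAt {w : ℂ} (hw : w ∈ U) {v : ℂ → Fin 5 → ℂ} (hv : ContDiffOn ℝ ∞ v U) :
    DifferentiableAt ℝ v w := (hv.contDiffAt (hU.mem_nhds hw)).differentiableAt (by simp)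

theorem mink_dz_normal_lift {w : ℂ} (hw : w ∈ U) : mink (ψ w) (dzVec n w) = 0 := by
  have := mink_dzVec_of_const hU h.smooth_normal h.smooth h.normal_lift hw
  rw [h.normal_dz w hw, add_zero, mink_comm] at this
  exact this

theorem mink_dz_normal_dz {w : ℂ} (hw : w ∈ U) : mink (dzVec ψ w) (dzVec n w) = -κ w := by
  have := mink_dzVec_of_const hU h.smooth_normal (contDiffOn_dzVec hU h.smooth) h.normal_dz hw
  rw [h.mink_normal_dz_dz hw, mink_comm] at this
  linear_combination this

theorem mink_dz_normal_dzbar {w : ℂ} (hw : w ∈ U) : mink (dzbarVec ψ w) (dzVec n w) = 0 := by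
  have := mink_dzVec_of_const hU h.smooth_normal (contDiffOn_dzbarVec hU h.smooth)
    (fun x hx => h.mink_normal_dzbar hx) hw
  rw [h.normal_dz_dzbar w hw, add_zero, mink_comm] at this
  exact this

theorem mink_dz_normal_normal {w : ℂ} (hw : w ∈ U) : mink (n w) (dzVec n w) = 0 := by
  have := mink_dzVec_of_const hU h.smooth_normal h.smooth_normal h.unit_normal hw
  rw [mink_comm (dzVec n w)] at this
  linear_combination this / 2

omit hU in
theorem dzbarVec_normal_eq (w : ℂ) : dzbarVec n w = fun i => conj (dzVec n w i) :=
  dzbarVec_of_real h.real_normal w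

/-- Differentiate `κ = ⟨n, ψ_zz⟩` by `z̄`. The term `⟨n_z̄, ψ_zz⟩` drops out because `ψ_zz` is a
combination of `ψ` and `n`, both orthogonal to `n_z̄`. -/
theorem mink_normal_dz_dz_dzbar {w : ℂ} (hw : w ∈ U) :
    mink (n w) (dzVec (dzVec (dzbarVec ψ)) w) = dzbar κ w := by
  have hP := contDiffOn_dzVec hU (contDiffOn_dzVec hU h.smooth)
  have e1 : dzbar κ w = dzbar (fun x => mink (n x) (dzVec (dzVec ψ) x)) w :=
    dzbar_congr (eventually_of_mem (hU.mem_nhds hw) fun x hx => (h.mink_normal_dz_dz hx).symm)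
  have e2 : mink (ψ w) (dzbarVec n w) = 0 :=
    h.mink_conj_lift w (h.mink_dz_normal_lift hU hw) (h.dzbarVec_normal_eq w)
  have e3 : mink (n w) (dzbarVec n w) = 0 :=
    h.mink_conj_normal w (h.mink_dz_normal_normal hU hw) (h.dzbarVec_normal_eq w)
  rw [e1, dzbar_mink (differentiableAt hU hw h.smooth_normal) (differentiableAt hU hw hP),
    h.dzVec_dzVec_eq hw, h.dzbarVec_dzVec_dzVec hU hw, mink_comm (dzbarVec n w), mink_add_left,
    mink_smul_left, mink_smul_left, e2, e3]
  ring

theorem mink_dz_normal_dz_dzbar {w : ℂ} (hw : w ∈ U) :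
    mink (dzVec (dzbarVec ψ) w) (dzVec n w) = -dzbar κ w := by
  have := mink_dzVec_of_const hU h.smooth_normal
    (contDiffOn_dzVec hU (contDiffOn_dzbarVec hU h.smooth)) h.normal_dz_dzbar hw
  rw [h.mink_normal_dz_dz_dzbar hU hw, mink_comm] at this
  linear_combination this

/-- The Weingarten equation. -/
theorem dzVec_normal {w : ℂ} (hw : w ∈ U) :
    dzVec n w = (2 * dzbar κ w) • ψ w + (-2 * κ w) • dzbarVec ψ w := by
  refine h.eq_of_mink hU hw ?_ ?_ ?_ ?_ ?_ <;> rw [mink_add_right, mink_smul_right, mink_smul_right]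
  · rw [h.mink_dz_normal_lift hU hw, h.null w hw, mink_comm, h.mink_dzbar_lift hU hw]; ring
  · rw [h.mink_dz_normal_dz hU hw, h.mink_dz_lift hU hw, h.normalized w hw]; ring
  · rw [h.mink_dz_normal_dzbar hU hw, h.mink_dzbar_lift hU hw, h.mink_dzbar_dzbar hw]; ring
  · rw [h.mink_dz_normal_dz_dzbar hU hw, h.mink_dz_dzbar_lift hU hw,
      h.mink_dz_dzbar_dzbar hU hw]; ring
  · rw [h.mink_dz_normal_normal hU hw, h.normal_lift w hw, h.mink_normal_dzbar hw]; ring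

theorem dualLift_gram {w : ℂ} (hw : w ∈ U) :
    mink (dualLift κ ψ w) (ψ w) = -1 ∧ mink (dualLift κ ψ w) (dzVec ψ w) = 0 ∧
    mink (dualLift κ ψ w) (dzbarVec ψ w) = 0 ∧ mink (dualLift κ ψ w) (dualLift κ ψ w) = 0 ∧
    mink (dualLift κ ψ w) (n w) = 0 := by
  have e0 : mink (dualLift κ ψ w) (ψ w) = -1 := by
    rw [mink_dualLift, h.mink_dz_dzbar_lift hU hw, h.null w hw]; ring
  refine ⟨e0, ?_, ?_, ?_, ?_⟩
  · rw [mink_dualLift, h.mink_dz_dzbar_dz hU hw, mink_comm (ψ w), h.mink_dz_lift hU hw]; ring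
  · rw [mink_dualLift, h.mink_dz_dzbar_dzbar hU hw, mink_comm (ψ w), h.mink_dzbar_lift hU hw]; ring
  · rw [mink_dualLift, mink_comm, mink_dualLift, mink_comm (ψ w) (dualLift κ ψ w), e0, h.mink_dz_dzbar_self hU hw,
      mink_comm (ψ w), h.mink_dz_dzbar_lift hU hw]; ring
  · rw [mink_dualLift, mink_comm, h.normal_dz_dzbar w hw, mink_comm, h.normal_lift w hw]; ring

/-- Both sides have the same products with the frame: the products of `ψ̂_z` come from
differentiating the constant products of `ψ̂` with the frame vectors and inserting the derivatives
already known. -/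
theorem dzVec_dualLift {w : ℂ} (hw : w ∈ U) :
    dzVec (dualLift κ ψ) w = (-2 * (κ w * conj (κ w))) • dzVec ψ w + (-c w) • dzbarVec ψ w
      + (2 * dzbar κ w) • n w := by
  have hh := h.contDiffOn_dualLift hU
  obtain ⟨g0, g1, g2, g3, g4⟩ := h.dualLift_gram hU hw
  have f0 : mink (ψ w) (dzVec (dualLift κ ψ) w) = 0 := by
    have := mink_dzVec_of_const hU hh h.smooth (fun x hx => (h.dualLift_gram hU hx).1) hw
    rw [g1, add_zero, mink_comm] at this
    exact this
  have f3 : mink (dualLift κ ψ w) (dzVec (dualLift κ ψ) w) = 0 := by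
    have := mink_dzVec_of_const hU hh hh (fun x hx => (h.dualLift_gram hU hx).2.2.2.1) hw
    rw [mink_comm (dzVec (dualLift κ ψ) w)] at this
    linear_combination this / 2
  refine h.eq_of_mink hU hw ?_ ?_ ?_ ?_ ?_
  all_goals rw [mink_add_right, mink_add_right, mink_smul_right, mink_smul_right, mink_smul_right]
  · rw [f0, mink_comm, h.mink_dz_lift hU hw, mink_comm, h.mink_dzbar_lift hU hw, mink_comm,
      h.normal_lift w hw]
    ring
  · have := mink_dzVec_of_const hU hh (contDiffOn_dzVec hU h.smooth)
      (fun x hx => (h.dualLift_gram hU hx).2.1) hw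
    rw [h.dzVec_dzVec_eq hw, mink_add_right, mink_smul_right, mink_smul_right, g0, g4,
      mink_comm] at this
    rw [h.conformal w hw, h.normalized w hw, mink_comm _ (n w), h.normal_dz w hw]
    linear_combination this
  · have := mink_dzVec_of_const hU hh (contDiffOn_dzbarVec hU h.smooth)
      (fun x hx => (h.dualLift_gram hU hx).2.2.1) hw
    rw [dzVec_dzbarVec_eq κ ψ w, mink_add_right, mink_smul_right, mink_smul_right, g0, g3,
      mink_comm] at this
    rw [h.mink_dzbar_dzbar hw, mink_comm _ (dzVec ψ w), h.normalized w hw, mink_comm _ (n w),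
      h.mink_normal_dzbar hw]
    linear_combination this
  · rw [h.mink_dz_dzbar_dz hU hw, h.mink_dz_dzbar_dzbar hU hw, mink_comm _ (n w),
      h.normal_dz_dzbar w hw, dzVec_dzbarVec_eq κ ψ w, mink_add_left, mink_smul_left,
      mink_smul_left, f0, f3]
    ring
  · have := mink_dzVec_of_const hU hh h.smooth_normal
      (fun x hx => (h.dualLift_gram hU hx).2.2.2.2) hw
    rw [h.dzVec_normal hU hw, mink_add_right, mink_smul_right, mink_smul_right, g0, g2,
      mink_comm] at this
    rw [h.normal_dz w hw, h.mink_normal_dzbar hw, h.unit_normal w hw]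
    linear_combination this

/-- The moving frame of a normalized lift solves the structure equations. -/
theorem isParallelFrame : IsParallelFrame κ c (liftFrame κ ψ n) U where
  differentiableAt w hw i j := by
    have comp : ∀ {v : ℂ → Fin 5 → ℂ}, ContDiffOn ℝ ∞ v U →
        DifferentiableAt ℝ (fun x => v x i) w := fun hv =>
      (hasFDerivAt_pi'.1 (differentiableAt hU hw hv).hasFDerivAt i).differentiableAt
    fin_cases j
    · exact comp h.smooth
    · exact comp (contDiffOn_dzVec hU h.smooth)
    · exact comp (contDiffOn_dzbarVec hU h.smooth)
    · exact comp (h.contDiffOn_dualLift hU)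
    · exact comp h.smooth_normal
  dz_eq w hw := by
    ext i j
    have e1 := congrFun (h.dzVec_dzVec_eq hw) i
    have e2 := congrFun (dzVec_dzbarVec_eq κ ψ w) i
    have e3 := congrFun (h.dzVec_dualLift hU hw) i
    have e4 := congrFun (h.dzVec_normal hU hw) i
    simp only [Matrix.mul_apply, Fin.sum_univ_five]
    have r0 : liftFrame κ ψ n w i 0 = ψ w i := rfl
    have r1 : liftFrame κ ψ n w i 1 = dzVec ψ w i := rfl
    have r2 : liftFrame κ ψ n w i 2 = dzbarVec ψ w i := rfl
    have r3 : liftFrame κ ψ n w i 3 = dualLift κ ψ w i := rfl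
    have r4 : liftFrame κ ψ n w i 4 = n w i := rfl
    rw [r0, r1, r2, r3, r4]
    simp only [Pi.add_apply, Pi.smul_apply, smul_eq_mul] at e1 e2 e3 e4
    fin_cases j
    · change dzVec ψ w i = _
      simp [connMat]
    · change dzVec (dzVec ψ) w i = _
      rw [e1]; simp [connMat]; ring
    · change dzVec (dzbarVec ψ) w i = _
      rw [e2]; simp [connMat]; ring
    · change dzVec (dualLift κ ψ) w i = _
      rw [e3]; simp [connMat]; ring
    · change dzVec n w i = _
      rw [e4]; simp [connMat]; ring
  dzbar_eq w hw := by
    ext i j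
    have e1 := congrFun (h.dzbarVec_dzbarVec_eq' hw) i
    have e2 := congrFun (dzVec_dzbarVec_eq κ ψ w) i
    -- The `z̄`-equations of the real vectors `ψ̂` and `n` are the conjugates of their
    -- `z`-equations.
    have e3 : dzbarVec (dualLift κ ψ) w i = (-2 * (κ w * conj (κ w))) * dzbarVec ψ w i
        + (-conj (c w)) * dzVec ψ w i + (2 * conj (dzbar κ w)) * n w i := by
      rw [h.dzbarVec_dualLift_eq hU hw, h.dzVec_dualLift hU hw, h.dzbarVec_eq w]
      simp only [Pi.add_apply, Pi.smul_apply, smul_eq_mul, map_add, map_mul, map_neg,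
        Complex.conj_conj, h.real_normal, map_ofNat]
      ring
    have e4 : dzbarVec n w i = (2 * conj (dzbar κ w)) * ψ w i
        + (-2 * conj (κ w)) * dzVec ψ w i := by
      rw [h.dzbarVec_normal_eq w, h.dzVec_normal hU hw, h.dzbarVec_eq w]
      simp only [Pi.add_apply, Pi.smul_apply, smul_eq_mul, map_add, map_mul, map_neg,
        h.real, map_ofNat, Complex.conj_conj]
    simp only [Matrix.mul_apply, Fin.sum_univ_five]
    have r0 : liftFrame κ ψ n w i 0 = ψ w i := rfl
    have r1 : liftFrame κ ψ n w i 1 = dzVec ψ w i := rfl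
    have r2 : liftFrame κ ψ n w i 2 = dzbarVec ψ w i := rfl
    have r3 : liftFrame κ ψ n w i 3 = dualLift κ ψ w i := rfl
    have r4 : liftFrame κ ψ n w i 4 = n w i := rfl
    rw [r0, r1, r2, r3, r4]
    simp only [Pi.add_apply, Pi.smul_apply, smul_eq_mul] at e1 e2
    fin_cases j
    · change dzbarVec ψ w i = _
      simp [connMatBar]
    · change dzbarVec (dzVec ψ) w i = _
      rw [h.dzbarVec_dzVec hU hw, e2]; simp [connMatBar]; ring
    · change dzbarVec (dzbarVec ψ) w i = _
      rw [e1]; simp [connMatBar]; ring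
    · change dzbarVec (dualLift κ ψ) w i = _
      rw [e3]; simp [connMatBar]; ring
    · change dzbarVec n w i = _
      rw [e4]; simp [connMatBar]; ring

end IsNormalizedLift

end StructureEquations

/-! ### Lorentz transformations and moving frames -/

section Lorentz

open Filter Topology Matrix

/-- The complexification of a real vector. -/
def ofRealVec (v : Fin 5 → ℝ) : Fin 5 → ℂ := fun i => (v i : ℂ)

theorem ofRealVec_injective : Function.Injective ofRealVec := fun _ _ h =>
  funext fun i => Complex.ofReal_injective (congrFun h i)

theorem mink_ofRealVec (v w : Fin 5 → ℝ) :
    mink (ofRealVec v) (ofRealVec w) = ((mink v w : ℝ) : ℂ) := mink_ofReal v w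

/-- The complex matrix of a real linear endomorphism. -/
def complexMat (L : (Fin 5 → ℝ) →ₗ[ℝ] (Fin 5 → ℝ)) : Matrix (Fin 5) (Fin 5) ℂ :=
  (LinearMap.toMatrix' L).map Complex.ofRealHom

theorem complexMat_injective : Function.Injective complexMat := by
  intro L L' h
  refine LinearMap.toMatrix'.injective ?_
  ext i j
  exact Complex.ofReal_injective (congrFun (congrFun h i) j)

theorem complexMat_mulVec (L : (Fin 5 → ℝ) →ₗ[ℝ] (Fin 5 → ℝ)) (v : Fin 5 → ℝ) :
    complexMat L *ᵥ ofRealVec v = ofRealVec (L v) := by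
  funext i
  have h := RingHom.map_mulVec Complex.ofRealHom (LinearMap.toMatrix' L) v i
  rw [LinearMap.toMatrix'_mulVec] at h
  exact h.symm

theorem transpose_minkMat_mul_mulVec (M : Matrix (Fin 5) (Fin 5) ℂ) (v w : Fin 5 → ℂ) :
    mink (M *ᵥ v) (M *ᵥ w) = v ⬝ᵥ (Mᵀ * minkMat * M) *ᵥ w := by
  have e : ∀ a b : Fin 5 → ℂ, mink a b = a ⬝ᵥ minkMat *ᵥ b := fun a b => by
    rw [minkMat, mink_expand]
    simp [dotProduct, Matrix.mulVec_diagonal, Fin.sum_univ_five]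
    ring
  rw [e, ← mulVec_mulVec, ← mulVec_mulVec, dotProduct_mulVec v, vecMul_transpose]

theorem mink_mulVec {M : Matrix (Fin 5) (Fin 5) ℂ} (h : Mᵀ * minkMat * M = minkMat)
    (v w : Fin 5 → ℂ) : mink (M *ᵥ v) (M *ᵥ w) = mink v w := by
  have := transpose_minkMat_mul_mulVec 1 v w
  rw [one_mulVec, one_mulVec] at this
  rw [transpose_minkMat_mul_mulVec, h, this]
  simp

theorem IsLorentz.complexMat_gram {A : (Fin 5 → ℝ) ≃ₗ[ℝ] (Fin 5 → ℝ)} (hA : IsLorentz A) :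
    (complexMat A)ᵀ * minkMat * complexMat A = minkMat := by
  have e : ∀ i, (fun k => complexMat (A : (Fin 5 → ℝ) →ₗ[ℝ] (Fin 5 → ℝ)) k i)
      = ofRealVec (A (Pi.single i 1)) := fun i => by
    funext k
    simp [complexMat, ofRealVec, LinearMap.toMatrix'_apply]
  ext i j
  rw [transpose_minkMat_mul, e, e, mink_ofRealVec, hA, mink_expand]
  fin_cases i <;> fin_cases j <;> simp [minkMat]

theorem dzVec_mulVec (M : Matrix (Fin 5) (Fin 5) ℂ) {v : ℂ → Fin 5 → ℂ} {w : ℂ}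
    (hv : DifferentiableAt ℝ v w) : dzVec (fun x => M *ᵥ v x) w = M *ᵥ dzVec v w := by
  have h := dzMat_mul (F := fun _ => M) (G := fun x => Matrix.of fun k _ => v x k) (w := w)
    (fun _ _ => differentiableAt_const _)
    (fun i _ => (hasFDerivAt_pi'.1 hv.hasFDerivAt i).differentiableAt)
  rw [dzMat_const, Matrix.zero_mul, zero_add] at h
  funext i
  exact congrFun (congrFun h i) 0

theorem dzbarVec_mulVec (M : Matrix (Fin 5) (Fin 5) ℂ) {v : ℂ → Fin 5 → ℂ} {w : ℂ}
    (hv : DifferentiableAt ℝ v w) : dzbarVec (fun x => M *ᵥ v x) w = M *ᵥ dzbarVec v w := by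
  have h := dzbarMat_mul (F := fun _ => M) (G := fun x => Matrix.of fun k _ => v x k) (w := w)
    (fun _ _ => differentiableAt_const _)
    (fun i _ => (hasFDerivAt_pi'.1 hv.hasFDerivAt i).differentiableAt)
  rw [dzbarMat_const, Matrix.zero_mul, zero_add] at h
  funext i
  exact congrFun (congrFun h i) 0

theorem contDiffOn_mulVec (M : Matrix (Fin 5) (Fin 5) ℂ) {v : ℂ → Fin 5 → ℂ} {U : Set ℂ}
    (hv : ContDiffOn ℝ ∞ v U) : ContDiffOn ℝ ∞ (fun x => M *ᵥ v x) U :=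
  ((M.mulVecLin.restrictScalars ℝ).toContinuousLinearMap.contDiff).comp_contDiffOn hv

variable {κ c : ℂ → ℂ} {ψ n ψ' n' : ℂ → Fin 5 → ℂ} {U : Set ℂ}

theorem dzVec_dzVec_mulVec (hU : IsOpen U) (M : Matrix (Fin 5) (Fin 5) ℂ) {v : ℂ → Fin 5 → ℂ}
    (hv : ContDiffOn ℝ ∞ v U) {w : ℂ} (hw : w ∈ U) :
    dzVec (dzVec fun x => M *ᵥ v x) w = M *ᵥ dzVec (dzVec v) w := by
  rw [← dzVec_mulVec M (IsNormalizedLift.differentiableAt hU hw (contDiffOn_dzVec hU hv))]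
  exact dzVec_congr (eventually_of_mem (hU.mem_nhds hw) fun x hx =>
    dzVec_mulVec M (IsNormalizedLift.differentiableAt hU hx hv))

theorem dzVec_dzbarVec_mulVec (hU : IsOpen U) (M : Matrix (Fin 5) (Fin 5) ℂ)
    {v : ℂ → Fin 5 → ℂ} (hv : ContDiffOn ℝ ∞ v U) {w : ℂ} (hw : w ∈ U) :
    dzVec (dzbarVec fun x => M *ᵥ v x) w = M *ᵥ dzVec (dzbarVec v) w := by
  rw [← dzVec_mulVec M (IsNormalizedLift.differentiableAt hU hw (contDiffOn_dzbarVec hU hv))]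
  exact dzVec_congr (eventually_of_mem (hU.mem_nhds hw) fun x hx =>
    dzbarVec_mulVec M (IsNormalizedLift.differentiableAt hU hx hv))

theorem conj_complexMat_mulVec (L : (Fin 5 → ℝ) →ₗ[ℝ] (Fin 5 → ℝ)) {v : Fin 5 → ℂ}
    (hv : ∀ i, conj (v i) = v i) (i : Fin 5) :
    conj ((complexMat L *ᵥ v) i) = (complexMat L *ᵥ v) i := by
  have e : v = ofRealVec fun i => (v i).re := funext fun i => (Complex.conj_eq_iff_re.1 (hv i)).symm
  rw [e, complexMat_mulVec]
  exact Complex.conj_ofReal _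

/-- Lorentz transformations preserve normalized lifts. -/
theorem IsNormalizedLift.lorentz (hU : IsOpen U) (h : IsNormalizedLift κ c ψ n U)
    {A : (Fin 5 → ℝ) ≃ₗ[ℝ] (Fin 5 → ℝ)} (hA : IsLorentz A) :
    IsNormalizedLift κ c (fun x => complexMat A *ᵥ ψ x) (fun x => complexMat A *ᵥ n x) U where
  smooth := contDiffOn_mulVec _ h.smooth
  smooth_normal := contDiffOn_mulVec _ h.smooth_normal
  real w := conj_complexMat_mulVec _ (h.real w)
  real_normal w := conj_complexMat_mulVec _ (h.real_normal w)
  null w hw := by rw [mink_mulVec hA.complexMat_gram, h.null w hw]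
  conformal w hw := by
    rw [dzVec_mulVec _ (differentiableAt hU hw h.smooth), mink_mulVec hA.complexMat_gram,
      h.conformal w hw]
  normalized w hw := by
    rw [dzVec_mulVec _ (differentiableAt hU hw h.smooth),
      dzbarVec_mulVec _ (differentiableAt hU hw h.smooth), mink_mulVec hA.complexMat_gram,
      h.normalized w hw]
  unit_normal w hw := by rw [mink_mulVec hA.complexMat_gram, h.unit_normal w hw]
  normal_lift w hw := by rw [mink_mulVec hA.complexMat_gram, h.normal_lift w hw]
  normal_dz w hw := by
    rw [dzVec_mulVec _ (differentiableAt hU hw h.smooth), mink_mulVec hA.complexMat_gram,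
      h.normal_dz w hw]
  normal_dz_dzbar w hw := by
    rw [dzVec_dzbarVec_mulVec hU _ h.smooth hw, mink_mulVec hA.complexMat_gram,
      h.normal_dz_dzbar w hw]
  hill w hw := by
    rw [dzVec_dzVec_mulVec hU _ h.smooth hw, ← mulVec_smul, ← mulVec_add, h.hill w hw, mulVec_smul]

theorem mul_eq_of_cols {M F G : Matrix (Fin 5) (Fin 5) ℂ}
    (h : ∀ j, M *ᵥ (fun k => F k j) = fun k => G k j) : M * F = G := by
  ext i j
  exact congrFun (h j) i

/-- A linear map which takes one normalized lift to another one maps the moving frames to each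
other. -/
theorem IsNormalizedLift.mul_liftFrame (hU : IsOpen U) (h : IsNormalizedLift κ c ψ n U)
    {M : Matrix (Fin 5) (Fin 5) ℂ} (hψ : ∀ x ∈ U, M *ᵥ ψ x = ψ' x) (hn : ∀ x ∈ U, M *ᵥ n x = n' x)
    {w : ℂ} (hw : w ∈ U) : M * liftFrame κ ψ n w = liftFrame κ ψ' n' w := by
  have hd := differentiableAt hU hw h.smooth
  have e1 : ∀ x ∈ U, dzVec ψ' x = dzVec (fun x => M *ᵥ ψ x) x := fun x hx =>
    dzVec_congr (eventually_of_mem (hU.mem_nhds hx) fun y hy => (hψ y hy).symm)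
  have e2 : ∀ x ∈ U, dzbarVec ψ' x = dzbarVec (fun x => M *ᵥ ψ x) x := fun x hx =>
    dzbarVec_congr (eventually_of_mem (hU.mem_nhds hx) fun y hy => (hψ y hy).symm)
  have e3 : dzVec (dzbarVec ψ') w = dzVec (dzbarVec fun x => M *ᵥ ψ x) w :=
    dzVec_congr (eventually_of_mem (hU.mem_nhds hw) e2)
  refine mul_eq_of_cols fun j => ?_
  fin_cases j
  · exact hψ w hw
  · exact ((e1 w hw).trans (dzVec_mulVec M hd)).symm
  · exact ((e2 w hw).trans (dzbarVec_mulVec M hd)).symm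
  · change M *ᵥ ((2 : ℂ) • dzVec (dzbarVec ψ) w + (2 * (κ w * conj (κ w))) • ψ w)
      = (2 : ℂ) • dzVec (dzbarVec ψ') w + (2 * (κ w * conj (κ w))) • ψ' w
    rw [mulVec_add, mulVec_smul, mulVec_smul, hψ w hw, e3, dzVec_dzbarVec_mulVec hU M h.smooth hw]
  · exact hn w hw

/-- Agreement on `ψ` and `n` over an open set extends to the derivatives of `ψ`, hence to the whole
frame, which is a basis. -/
theorem IsNormalizedLift.matrix_unique (hU : IsOpen U) (h : IsNormalizedLift κ c ψ n U)
    {M M' : Matrix (Fin 5) (Fin 5) ℂ} (hψ : ∀ x ∈ U, M *ᵥ ψ x = M' *ᵥ ψ x)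
    (hn : ∀ x ∈ U, M *ᵥ n x = M' *ᵥ n x) (hne : U.Nonempty) : M = M' := by
  obtain ⟨w, hw⟩ := hne
  have e1 := h.mul_liftFrame hU hψ hn hw
  have e2 := h.mul_liftFrame hU (M := M') (fun _ _ => rfl) (fun _ _ => rfl) hw
  have e3 := mul_gramInv_of_gram (h.liftFrame_gram hU hw)
  rw [← e2] at e1
  have e4 := congrArg (fun X => X * (gramInv * (liftFrame κ ψ n w)ᵀ * minkMat)) e1
  simpa only [Matrix.mul_assoc M, Matrix.mul_assoc M', e3, Matrix.mul_one] using e4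

theorem swapMat_mul_gramInv : swapMat * gramInv * swapMat = gramInv := by
  ext i j
  fin_cases i <;> fin_cases j <;>
    simp only [Matrix.mul_apply, Fin.sum_univ_five] <;> simp [gramInv, swapMat]

/-- The reality condition on frames: conjugation fixes `ψ`, `ψ̂`, `n` and exchanges `ψ_z` with
`ψ_z̄`. -/
theorem IsNormalizedLift.conj_liftFrame (hU : IsOpen U) (h : IsNormalizedLift κ c ψ n U) {w : ℂ}
    (hw : w ∈ U) : (liftFrame κ ψ n w).map (starRingEnd ℂ) = liftFrame κ ψ n w * swapMat := by
  have r0 : ∀ i, liftFrame κ ψ n w i 0 = ψ w i := fun _ => rfl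
  have r1 : ∀ i, liftFrame κ ψ n w i 1 = dzVec ψ w i := fun _ => rfl
  have r2 : ∀ i, liftFrame κ ψ n w i 2 = dzbarVec ψ w i := fun _ => rfl
  have r3 : ∀ i, liftFrame κ ψ n w i 3 = dualLift κ ψ w i := fun _ => rfl
  have r4 : ∀ i, liftFrame κ ψ n w i 4 = n w i := fun _ => rfl
  ext i j
  rw [Matrix.map_apply, Matrix.mul_apply, Fin.sum_univ_five, r0, r1, r2, r3, r4]
  fin_cases j <;> simp [swapMat, r0, r1, r2, r3, r4, h.real, h.real_normal, h.dzbarVec_eq,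
    h.dualLift_real hU hw]

/-- A real matrix comes from a real endomorphism. It preserves a nondegenerate form, so it is
injective and therefore bijective in finite dimension. -/
theorem exists_lorentz_of_complexMat {M : Matrix (Fin 5) (Fin 5) ℂ}
    (hM : Mᵀ * minkMat * M = minkMat) (hr : M.map (starRingEnd ℂ) = M) :
    ∃ A : (Fin 5 → ℝ) ≃ₗ[ℝ] (Fin 5 → ℝ), IsLorentz A ∧
      complexMat (A : (Fin 5 → ℝ) →ₗ[ℝ] (Fin 5 → ℝ)) = M := by
  set L : (Fin 5 → ℝ) →ₗ[ℝ] (Fin 5 → ℝ) := Matrix.toLin' (M.map Complex.re) with hL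
  have e : complexMat L = M := by
    rw [complexMat, hL, LinearMap.toMatrix'_toLin']
    ext i j
    exact Complex.conj_eq_iff_re.1 (congrFun (congrFun hr i) j)
  have hm : ∀ v w, mink (L v) (L w) = mink v w := fun v w => by
    apply Complex.ofReal_injective
    rw [← mink_ofRealVec, ← mink_ofRealVec, ← complexMat_mulVec, ← complexMat_mulVec, e,
      mink_mulVec hM]
  have hinj : Function.Injective L := by
    rw [← LinearMap.ker_eq_bot, LinearMap.ker_eq_bot']
    intro v hv
    have hz : ∀ w, mink v w = 0 := fun w => by rw [← hm, hv]; simp [mink]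
    funext i
    have := hz (Pi.single i 1)
    rw [mink_expand] at this
    fin_cases i <;> simpa using this
  exact ⟨LinearEquiv.ofInjectiveEndo L hinj, hm, e⟩

/-- Two normalized lifts with the same invariants differ locally by a Lorentz transformation. -/
theorem IsNormalizedLift.exists_lorentz (hU : IsOpen U) (h : IsNormalizedLift κ c ψ n U)
    (h' : IsNormalizedLift κ c ψ' n' U) {w : ℂ} (hw : w ∈ U) :
    ∃ A : (Fin 5 → ℝ) ≃ₗ[ℝ] (Fin 5 → ℝ), IsLorentz A ∧ ∀ᶠ x in 𝓝 w,
      complexMat A *ᵥ ψ x = ψ' x ∧ complexMat A *ᵥ n x = n' x := by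
  set F := liftFrame κ ψ n with hF
  set G := liftFrame κ ψ' n' with hG
  have hFG : ∀ x ∈ U, (G x * (gramInv * (F x)ᵀ) * minkMat) * F x = G x := fun x hx => by
    have := mul_eq_one_comm.1 (mul_gramInv_of_gram (h.liftFrame_gram hU hx))
    rw [Matrix.mul_assoc (G x), Matrix.mul_assoc (G x), this, Matrix.mul_one]
  have hFi := mul_gramInv_of_gram (h.liftFrame_gram hU hw)
  -- This is `G F⁻¹` at `w`. It is a Lorentz matrix because the two frames have the same Gram
  -- matrix.
  set M := G w * (gramInv * (F w)ᵀ) * minkMat with hM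
  have gram : Mᵀ * minkMat * M = minkMat := by
    have e1 : (F w)ᵀ * (Mᵀ * minkMat * M) * F w = (F w)ᵀ * minkMat * F w := by
      calc _ = (M * F w)ᵀ * minkMat * (M * F w) := by
            simp only [transpose_mul, Matrix.mul_assoc]
        _ = _ := by rw [hFG w hw, h'.liftFrame_gram hU hw, h.liftFrame_gram hU hw]
    set Fi := gramInv * (F w)ᵀ * minkMat with hFi'
    have hFiT : Fiᵀ * (F w)ᵀ = 1 := by rw [← transpose_mul, hFi, transpose_one]
    have e2 := congrArg (fun X => Fiᵀ * X * Fi) e1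
    have e3 : ∀ X, Fiᵀ * ((F w)ᵀ * X * F w) * Fi = X := fun X => by
      rw [Matrix.mul_assoc (F w)ᵀ, ← Matrix.mul_assoc Fiᵀ, hFiT, Matrix.one_mul, Matrix.mul_assoc,
        hFi, Matrix.mul_one]
    simpa only [e3] using e2
  -- Conjugating multiplies each frame on the right by the swap; the two swaps enclose `gramInv` and
  -- are absorbed by it.
  have real : M.map (starRingEnd ℂ) = M := by
    have hηr : minkMat.map (starRingEnd ℂ) = minkMat := by
      ext i j
      fin_cases i <;> fin_cases j <;> simp [minkMat]
    have hgr : gramInv.map (starRingEnd ℂ) = gramInv := by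
      ext i j
      fin_cases i <;> fin_cases j <;> simp [gramInv, map_ofNat]
    have hs : swapMatᵀ = swapMat := by
      ext i j
      fin_cases i <;> fin_cases j <;> simp [swapMat]
    have h1 := h.conj_liftFrame hU hw
    have h2 := h'.conj_liftFrame hU hw
    rw [hM, Matrix.map_mul, Matrix.map_mul, Matrix.map_mul, hηr, hgr, transpose_map, h1, h2,
      transpose_mul, hs]
    congr 1
    rw [Matrix.mul_assoc, ← Matrix.mul_assoc gramInv, ← Matrix.mul_assoc swapMat,
      ← Matrix.mul_assoc swapMat, swapMat_mul_gramInv]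
  obtain ⟨A, hA, hAM⟩ := exists_lorentz_of_complexMat gram real
  refine ⟨A, hA, ?_⟩
  filter_upwards [(h.isParallelFrame hU).mul_eq_of_eventually hU (h'.isParallelFrame hU) hw,
    hU.mem_nhds hw] with x hx hxU
  have e := hFG x hxU
  rw [hx] at e
  rw [hAM]
  constructor <;> funext i
  · exact congrFun (congrFun e i) 0
  · exact congrFun (congrFun e i) 4

end Lorentz

/-! ### Local surfaces and their normalized lifts -/

section LocalSurfaces

open Filter Topology Matrix

variable {κ c : ℂ → ℂ} {ψ n : ℂ → Fin 5 → ℂ} {U : Set ℂ}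

/-- The span of a vector valued function and its derivatives `∂_z`, `∂_z̄`, `∂_z ∂_z̄`. -/
def jetSpan (v : ℂ → Fin 5 → ℂ) (w : ℂ) : Submodule ℂ (Fin 5 → ℂ) :=
  Submodule.span ℂ {v w, dzVec v w, dzbarVec v w, dzVec (dzbarVec v) w}

theorem mem_jetSpan (v : ℂ → Fin 5 → ℂ) (w : ℂ) :
    v w ∈ jetSpan v w ∧ dzVec v w ∈ jetSpan v w ∧ dzbarVec v w ∈ jetSpan v w ∧
      dzVec (dzbarVec v) w ∈ jetSpan v w := by
  refine ⟨?_, ?_, ?_, ?_⟩ <;> exact Submodule.subset_span (by simp)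

theorem jetSpan_congr (hU : IsOpen U) {v u : ℂ → Fin 5 → ℂ} (h : ∀ x ∈ U, v x = u x) {w : ℂ}
    (hw : w ∈ U) : jetSpan v w = jetSpan u w := by
  have e : ∀ x ∈ U, v =ᶠ[𝓝 x] u := fun x hx => eventually_of_mem (hU.mem_nhds hx) h
  rw [jetSpan, jetSpan, h w hw, dzVec_congr (e w hw), dzbarVec_congr (e w hw),
    dzVec_congr (eventually_of_mem (hU.mem_nhds hw) fun x hx => dzbarVec_congr (e x hx))]

theorem jetSpan_le {v : ℂ → Fin 5 → ℂ} {w : ℂ} {S : Submodule ℂ (Fin 5 → ℂ)} (h0 : v w ∈ S)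
    (h1 : dzVec v w ∈ S) (h2 : dzbarVec v w ∈ S) (h3 : dzVec (dzbarVec v) w ∈ S) :
    jetSpan v w ≤ S := by
  rw [jetSpan, Submodule.span_le]
  rintro x (rfl | rfl | rfl | rfl) <;> assumption

/-- By the product rule each new derivative is a combination of the old ones up to the same order.
This allows the normal conditions to be moved between the Euclidean and the normalized lift. -/
theorem jetSpan_smul_le (hU : IsOpen U) {l : ℂ → ℂ} {v : ℂ → Fin 5 → ℂ} (hl : ContDiffOn ℝ ∞ l U)
    (hv : ContDiffOn ℝ ∞ v U) {w : ℂ} (hw : w ∈ U) :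
    jetSpan (fun x => l x • v x) w ≤ jetSpan v w := by
  obtain ⟨m0, m1, m2, m3⟩ := mem_jetSpan v w
  have dl : ∀ {l : ℂ → ℂ}, ContDiffOn ℝ ∞ l U → ∀ x ∈ U, DifferentiableAt ℝ l x := fun hl x hx =>
    (hl.contDiffAt (hU.mem_nhds hx)).differentiableAt (by simp)
  have dv : ∀ {v : ℂ → Fin 5 → ℂ}, ContDiffOn ℝ ∞ v U → ∀ x ∈ U, DifferentiableAt ℝ v x :=
    fun hv x hx => IsNormalizedLift.differentiableAt hU hx hv
  have hlb := contDiffOn_dzbar hU hl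
  have hvb := contDiffOn_dzbarVec hU hv
  refine jetSpan_le (Submodule.smul_mem _ _ m0) ?_ ?_ ?_
  · rw [dzVec_smul (dl hl w hw) (dv hv w hw)]
    exact add_mem (Submodule.smul_mem _ _ m0) (Submodule.smul_mem _ _ m1)
  · rw [dzbarVec_smul (dl hl w hw) (dv hv w hw)]
    exact add_mem (Submodule.smul_mem _ _ m0) (Submodule.smul_mem _ _ m2)
  · rw [dzVec_congr (eventually_of_mem (hU.mem_nhds hw) fun x hx =>
      dzbarVec_smul (dl hl x hx) (dv hv x hx)),
      dzVec_add ((dl hlb w hw).fun_smul (dv hv w hw)) ((dl hl w hw).fun_smul (dv hvb w hw)),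
      dzVec_smul (dl hlb w hw) (dv hv w hw), dzVec_smul (dl hl w hw) (dv hvb w hw)]
    exact add_mem (add_mem (Submodule.smul_mem _ _ m0) (Submodule.smul_mem _ _ m1))
      (add_mem (Submodule.smul_mem _ _ m2) (Submodule.smul_mem _ _ m3))

theorem mink_eq_zero_of_mem_jetSpan {v : ℂ → Fin 5 → ℂ} {w : ℂ} {a : Fin 5 → ℂ}
    (h0 : mink a (v w) = 0) (h1 : mink a (dzVec v w) = 0) (h2 : mink a (dzbarVec v w) = 0)
    (h3 : mink a (dzVec (dzbarVec v) w) = 0) : ∀ b ∈ jetSpan v w, mink a b = 0 := by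
  intro b hb
  induction hb using Submodule.span_induction with
  | mem x hx => rcases hx with rfl | rfl | rfl | rfl <;> assumption
  | zero => simp [mink]
  | add x y _ _ hx hy => rw [mink_add_right, hx, hy, add_zero]
  | smul r x _ hx => rw [mink_smul_right, hx, mul_zero]

theorem mink_coneLift (x y : S3) : mink (coneLift x) (coneLift y) = -1 + inner ℝ (x : E4) y := by
  simp [mink, coneLift, PiLp.inner_apply, mul_comm]

theorem mink_coneLift_self (x : S3) : mink (coneLift x) (coneLift x) = 0 := by
  rw [mink_coneLift, real_inner_self_eq_norm_sq, norm_eq_of_mem_sphere]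
  norm_num

/-- The light cone lift of a map into the sphere. -/
def surfLift (g : ℂ → S3) (w : ℂ) : Fin 5 → ℂ := ofRealVec (coneLift (g w))

/-- The normalized lift of a map into the sphere. -/
def surfNormLift (g : ℂ → S3) (w : ℂ) : Fin 5 → ℂ :=
  fun i => ((‖fderiv ℝ (fun x => (g x : E4)) w 1‖⁻¹ * coneLift (g w) i : ℝ) : ℂ)

/-- A conformal immersion of the open set `U` with unit normal `N` and invariants `κ`, `c`. -/
structure IsLocalSurface (κ c : ℂ → ℂ) (g : ℂ → S3) (N : ℂ → Fin 5 → ℝ) (U : Set ℂ) : Prop where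
  smooth : ContDiffOn ℝ ∞ (fun x => (g x : E4)) U
  conformalAt : ∀ w ∈ U, ConformalAt (fun x => (g x : E4)) w
  smooth_normal : ContDiffOn ℝ ∞ N U
  unit_normal : ∀ w ∈ U, mink (N w) (N w) = 1
  normal : ∀ w ∈ U, ∀ v ∈ jetSpan (surfLift g) w, mink (ofRealVec (N w)) v = 0
  hill : ∀ w ∈ U, dzVec (dzVec (surfNormLift g)) w + (c w / 2) • surfNormLift g w
      = κ w • ofRealVec (N w)

variable {g : ℂ → S3} {N : ℂ → Fin 5 → ℝ} {w : ℂ}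

theorem contDiffOn_ofRealVec {v : ℂ → Fin 5 → ℝ} (hv : ContDiffOn ℝ ∞ v U) :
    ContDiffOn ℝ ∞ (fun x => ofRealVec (v x)) U :=
  contDiffOn_pi.2 fun i => Complex.ofRealCLM.contDiff.comp_contDiffOn (contDiffOn_pi.1 hv i)

theorem contDiffOn_coneLift (hg : ContDiffOn ℝ ∞ (fun x => (g x : E4)) U) :
    ContDiffOn ℝ ∞ (fun x => coneLift (g x)) U := by
  refine contDiffOn_pi.2 fun i => ?_
  refine Fin.cases ?_ (fun i => ?_) i
  · exact contDiffOn_const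
  · exact (EuclideanSpace.proj (𝕜 := ℝ) i).contDiff.comp_contDiffOn hg

theorem contDiffOn_surfLift (hg : ContDiffOn ℝ ∞ (fun x => (g x : E4)) U) :
    ContDiffOn ℝ ∞ (surfLift g) U := contDiffOn_ofRealVec (contDiffOn_coneLift hg)

theorem surfNormLift_eq (g : ℂ → S3) (w : ℂ) :
    surfNormLift g w = ((‖fderiv ℝ (fun x => (g x : E4)) w 1‖⁻¹ : ℝ) : ℂ) • surfLift g w := by
  funext i
  simp [surfNormLift, surfLift, ofRealVec]

theorem fderiv_surfLift (hg : DifferentiableAt ℝ (fun x => (g x : E4)) w) (v : ℂ) (i : Fin 5) :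
    fderiv ℝ (fun x => surfLift g x i) w v
      = ((Matrix.vecCons 0 (fun i => fderiv ℝ (fun x => (g x : E4)) w v i) : Fin 5 → ℝ) i : ℂ) := by
  refine Fin.cases ?_ (fun i => ?_) i
  · simp [surfLift, ofRealVec, coneLift]
  · have h := (Complex.ofRealCLM.hasFDerivAt.comp w
      ((EuclideanSpace.proj (𝕜 := ℝ) i).hasFDerivAt.comp w hg.hasFDerivAt)).fderiv
    have e : (fun x => surfLift g x i.succ) = Complex.ofRealCLM ∘ ((EuclideanSpace.proj (𝕜 := ℝ) i)
      ∘ fun x => (g x : E4)) := rfl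
    rw [e, h]
    simp

/-- Conformality in null form: the real and imaginary parts compare the lengths of `g_x`, `g_y` and
measure their angle. -/
theorem mink_dzVec_surfLift (hg : DifferentiableAt ℝ (fun x => (g x : E4)) w) :
    mink (dzVec (surfLift g) w) (dzVec (surfLift g) w)
      = (1 / 4 : ℂ) * (((‖fderiv ℝ (fun x => (g x : E4)) w 1‖ ^ 2
          - ‖fderiv ℝ (fun x => (g x : E4)) w Complex.I‖ ^ 2 : ℝ) : ℂ)
        - 2 * Complex.I * ((inner ℝ (fderiv ℝ (fun x => (g x : E4)) w 1)
          (fderiv ℝ (fun x => (g x : E4)) w Complex.I) : ℝ) : ℂ)) := by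
  rw [EuclideanSpace.real_norm_sq_eq, EuclideanSpace.real_norm_sq_eq, PiLp.inner_apply, mink]
  simp only [dzVec, dz, fderiv_surfLift hg, Matrix.cons_val_succ, Fin.sum_univ_four]
  simp
  linear_combination (1 / 4 : ℂ) * ((fderiv ℝ (fun x => (g x : E4)) w Complex.I 0 : ℂ) ^ 2
    + (fderiv ℝ (fun x => (g x : E4)) w Complex.I 1 : ℂ) ^ 2
    + (fderiv ℝ (fun x => (g x : E4)) w Complex.I 2 : ℂ) ^ 2
    + (fderiv ℝ (fun x => (g x : E4)) w Complex.I 3 : ℂ) ^ 2) * Complex.I_mul_I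

theorem mink_dzVec_dzbarVec_surfLift (hg : DifferentiableAt ℝ (fun x => (g x : E4)) w) :
    mink (dzVec (surfLift g) w) (dzbarVec (surfLift g) w)
      = (1 / 4 : ℂ) * ((‖fderiv ℝ (fun x => (g x : E4)) w 1‖ ^ 2
          + ‖fderiv ℝ (fun x => (g x : E4)) w Complex.I‖ ^ 2 : ℝ) : ℂ) := by
  rw [EuclideanSpace.real_norm_sq_eq, EuclideanSpace.real_norm_sq_eq, mink]
  simp only [dzVec, dz, dzbarVec, dzbar, fderiv_surfLift hg, Matrix.cons_val_succ,
    Fin.sum_univ_four]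
  simp
  linear_combination (-1 / 4 : ℂ) * ((fderiv ℝ (fun x => (g x : E4)) w Complex.I 0 : ℂ) ^ 2
    + (fderiv ℝ (fun x => (g x : E4)) w Complex.I 1 : ℂ) ^ 2
    + (fderiv ℝ (fun x => (g x : E4)) w Complex.I 2 : ℂ) ^ 2
    + (fderiv ℝ (fun x => (g x : E4)) w Complex.I 3 : ℂ) ^ 2) * Complex.I_mul_I

theorem conformalAt_iff {G : ℂ → E4} : ConformalAt G w ↔
    0 < ‖fderiv ℝ G w 1‖ ∧ ‖fderiv ℝ G w 1‖ = ‖fderiv ℝ G w Complex.I‖ ∧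
      inner ℝ (fderiv ℝ G w 1) (fderiv ℝ G w Complex.I) = 0 := by
  rw [conformalAt_iff_isConformalMap_fderiv, isConformalMap_iff]
  set L := fderiv ℝ G w
  constructor
  · rintro ⟨a, ha, h⟩
    have h1 := h 1 1
    have h2 := h Complex.I Complex.I
    have h3 := h 1 Complex.I
    rw [real_inner_self_eq_norm_sq] at h1 h2
    simp at h1 h2 h3
    refine ⟨?_, ?_, h3⟩
    · rcases (norm_nonneg (L 1)).lt_or_eq with h | h
      · exact h
      · rw [← h] at h1; norm_num at h1; linarith
    · exact (sq_eq_sq₀ (norm_nonneg _) (norm_nonneg _)).1 (h1.trans h2.symm)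
  · rintro ⟨h1, h2, h3⟩
    refine ⟨‖L 1‖ ^ 2, by positivity, fun u v => ?_⟩
    have e : ∀ u : ℂ, L u = u.re • L 1 + u.im • L Complex.I := fun u => by
      rw [← map_smul, ← map_smul, ← map_add]
      congr 1
      simp [Complex.re_add_im]
    have h4 : inner ℝ (L Complex.I) (L 1) = 0 := by rw [real_inner_comm]; exact h3
    rw [e u, e v]
    simp only [inner_add_left, inner_add_right, real_inner_smul_left, real_inner_smul_right,
      real_inner_self_eq_norm_sq, h3, h4, ← h2, Complex.inner, Complex.mul_re, Complex.conj_re,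
      Complex.conj_im]
    ring

theorem IsLocalSurface.smooth_scale (hU : IsOpen U) (h : IsLocalSurface κ c g N U) :
    ContDiffOn ℝ ∞
      (fun w => ((‖fderiv ℝ (fun x => (g x : E4)) w 1‖⁻¹ : ℝ) : ℂ)) U := by
  have h1 := h.smooth.fderiv_of_isOpen hU (m := ∞) (by simp)
  have hne : ∀ w ∈ U, ‖fderiv ℝ (fun x => (g x : E4)) w 1‖ ≠ 0 := fun w hw =>
    (conformalAt_iff.1 (h.conformalAt w hw)).1.ne'
  have h2 : ContDiffOn ℝ ∞ (fun w => fderiv ℝ (fun x => (g x : E4)) w 1) U :=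
    h1.clm_apply contDiffOn_const
  exact Complex.ofRealCLM.contDiff.comp_contDiffOn
    ((h2.norm ℝ fun w hw => norm_ne_zero_iff.1 (hne w hw)).inv hne)

/-- The lift `φ = (1, g)` is null and orthogonal to its derivatives, so rescaling by `l` multiplies
the products of first derivatives by `l²`. With `l = 1/|g_x|` the products `⟨φ_z, φ_z⟩ = 0` and
`⟨φ_z, φ_z̄⟩ = |g_x|²/2` become the normalized ones. -/
theorem IsLocalSurface.toNormalizedLift (hU : IsOpen U) (h : IsLocalSurface κ c g N U) :
    IsNormalizedLift κ c (surfNormLift g) (fun x => ofRealVec (N x)) U := by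
  have hl := h.smooth_scale hU
  have hφ := contDiffOn_surfLift h.smooth
  have e : surfNormLift g = fun w => ((‖fderiv ℝ (fun x => (g x : E4)) w 1‖⁻¹ : ℝ) : ℂ)
      • surfLift g w := funext (surfNormLift_eq g)
  have dl : ∀ x ∈ U, DifferentiableAt ℝ
      (fun w => ((‖fderiv ℝ (fun x => (g x : E4)) w 1‖⁻¹ : ℝ) : ℂ)) x := fun x hx =>
    (hl.contDiffAt (hU.mem_nhds hx)).differentiableAt (by simp)
  have dφ : ∀ x ∈ U, DifferentiableAt ℝ (surfLift g) x := fun x hx =>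
    IsNormalizedLift.differentiableAt hU hx hφ
  have hnull : ∀ x ∈ U, mink (surfLift g x) (surfLift g x) = 0 := fun x _ => by
    rw [surfLift, mink_ofRealVec, mink_coneLift_self]; simp
  have hz : ∀ x ∈ U, mink (dzVec (surfLift g) x) (surfLift g x) = 0 := fun x hx => by
    have := mink_dzVec_of_const hU hφ hφ hnull hx
    rw [mink_comm (surfLift g x)] at this
    linear_combination this / 2
  have hzb : ∀ x ∈ U, mink (dzbarVec (surfLift g) x) (surfLift g x) = 0 := fun x hx => by
    have := mink_dzbarVec_of_const hU hφ hφ hnull hx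
    rw [mink_comm (surfLift g x)] at this
    linear_combination this / 2
  have hspan : ∀ x ∈ U, ∀ v ∈ jetSpan (surfNormLift g) x, mink (ofRealVec (N x)) v = 0 :=
    fun x hx v hv => h.normal x hx v (jetSpan_smul_le hU hl hφ hx (e ▸ hv))
  refine ⟨?_, contDiffOn_ofRealVec h.smooth_normal, fun _ _ => Complex.conj_ofReal _,
    fun _ _ => Complex.conj_ofReal _, ?_, ?_, ?_, ?_,
    fun x hx => hspan x hx _ (mem_jetSpan _ x).1, fun x hx => hspan x hx _ (mem_jetSpan _ x).2.1,
    fun x hx => hspan x hx _ (mem_jetSpan _ x).2.2.2, h.hill⟩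
  · rw [e]; exact hl.smul hφ
  · intro x hx
    rw [e]
    simp only [mink_smul_left, mink_smul_right, hnull x hx, mul_zero]
  · intro x hx
    obtain ⟨_, h2, h3⟩ := conformalAt_iff.1
      (h.conformalAt x hx)
    rw [e, dzVec_smul (dl x hx) (dφ x hx)]
    simp only [mink_add_left, mink_add_right, mink_smul_left, mink_smul_right, hnull x hx,
      hz x hx, mink_comm (surfLift g x) (dzVec (surfLift g) x),
      mink_dzVec_surfLift (h.conformalAt x hx).differentiableAt, ← h2, h3]
    simp
  · intro x hx
    obtain ⟨h1, h2, h3⟩ := conformalAt_iff.1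
      (h.conformalAt x hx)
    have h1' : (‖fderiv ℝ (fun x => (g x : E4)) x 1‖ : ℂ) ≠ 0 := by exact_mod_cast h1.ne'
    rw [e, dzVec_smul (dl x hx) (dφ x hx), dzbarVec_smul (dl x hx) (dφ x hx)]
    simp only [mink_add_left, mink_add_right, mink_smul_left, mink_smul_right, hnull x hx,
      hz x hx, hzb x hx, mink_comm (surfLift g x) (dzbarVec (surfLift g) x),
      mink_dzVec_dzbarVec_surfLift (h.conformalAt x hx).differentiableAt, ← h2]
    push_cast
    field_simp
    ring
  · intro x hx
    rw [mink_ofRealVec, h.unit_normal x hx]; simp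

/-- The converse passage. The scale `r` need not be known in advance: it is the time component of
`ψ`, hence smooth, and the normalization of `ψ` forces `|g_x| = |g_y| = 1/r`, so `ψ` is the
normalized lift of `g`. -/
theorem isLocalSurface_of_normalizedLift (hU : IsOpen U)
    (h : IsNormalizedLift κ c ψ (fun x => ofRealVec (N x)) U) {r : ℂ → ℝ} (hr : ∀ x ∈ U, 0 < r x)
    (hψ : ∀ x ∈ U, ψ x = (r x : ℂ) • surfLift g x) :
    IsLocalSurface κ c g N U ∧ ∀ x ∈ U, surfNormLift g x = ψ x := by
  have hr0 : ∀ x ∈ U, (r x : ℂ) ≠ 0 := fun x hx => by exact_mod_cast (hr x hx).ne'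
  have e0 : ∀ x ∈ U, (r x : ℂ) = ψ x 0 := fun x hx => by
    rw [hψ x hx]; simp [surfLift, ofRealVec, coneLift]
  have hrs : ContDiffOn ℝ ∞ (fun x => (r x : ℂ)) U := (contDiffOn_pi.1 h.smooth 0).congr e0
  have hrr : ContDiffOn ℝ ∞ r U := by
    have := Complex.reCLM.contDiff.comp_contDiffOn hrs
    exact this
  have hl : ContDiffOn ℝ ∞ (fun x => ((r x : ℂ))⁻¹) U := hrs.inv hr0
  have hφ : ∀ x ∈ U, surfLift g x = ((r x : ℂ))⁻¹ • ψ x := fun x hx => by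
    rw [hψ x hx, smul_smul, inv_mul_cancel₀ (hr0 x hx), one_smul]
  have hg : ContDiffOn ℝ ∞ (fun x => (g x : E4)) U := by
    rw [contDiffOn_euclidean]
    intro i
    refine ContDiffOn.congr (f := fun x => (r x)⁻¹ * (ψ x i.succ).re) ?_ fun x hx => ?_
    · refine (hrr.inv fun x hx => (hr x hx).ne').mul ?_
      exact Complex.reCLM.contDiff.comp_contDiffOn (contDiffOn_pi.1 h.smooth i.succ)
    · rw [hψ x hx]
      have := (hr x hx).ne'
      simp [surfLift, ofRealVec, coneLift]
      field_simp
  have dg : ∀ x ∈ U, DifferentiableAt ℝ (fun x => (g x : E4)) x := fun x hx =>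
    (hg.contDiffAt (hU.mem_nhds hx)).differentiableAt (by simp)
  have dl : ∀ x ∈ U, DifferentiableAt ℝ (fun x => ((r x : ℂ))⁻¹) x := fun x hx =>
    (hl.contDiffAt (hU.mem_nhds hx)).differentiableAt (by simp)
  have dψ : ∀ x ∈ U, DifferentiableAt ℝ ψ x := fun x hx =>
    IsNormalizedLift.differentiableAt hU hx h.smooth
  have key : ∀ x ∈ U, ‖fderiv ℝ (fun x => (g x : E4)) x 1‖ = (r x)⁻¹ ∧
      ‖fderiv ℝ (fun x => (g x : E4)) x 1‖ = ‖fderiv ℝ (fun x => (g x : E4)) x Complex.I‖ ∧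
      inner ℝ (fderiv ℝ (fun x => (g x : E4)) x 1)
        (fderiv ℝ (fun x => (g x : E4)) x Complex.I) = 0 := by
    intro x hx
    have ev : surfLift g =ᶠ[𝓝 x] fun x => ((r x : ℂ))⁻¹ • ψ x :=
      eventually_of_mem (hU.mem_nhds hx) hφ
    have h1 := mink_dzVec_surfLift (dg x hx)
    have h2 := mink_dzVec_dzbarVec_surfLift (dg x hx)
    rw [dzVec_congr ev, dzVec_smul (dl x hx) (dψ x hx)] at h1 h2
    rw [dzbarVec_congr ev, dzbarVec_smul (dl x hx) (dψ x hx)] at h2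
    simp only [mink_add_left, mink_add_right, mink_smul_left, mink_smul_right, h.null x hx,
      h.conformal x hx, h.normalized x hx, h.mink_dz_lift hU hx, h.mink_dzbar_lift hU hx,
      mink_comm (ψ x) (dzVec ψ x), mink_comm (ψ x) (dzbarVec ψ x)] at h1 h2
    have h3 := congrArg Complex.re h1
    have h4 := congrArg Complex.im h1
    have h5 : (r x)⁻¹ ^ 2 * (1 / 2) = (1 / 4) * (‖fderiv ℝ (fun x => (g x : E4)) x 1‖ ^ 2
          + ‖fderiv ℝ (fun x => (g x : E4)) x Complex.I‖ ^ 2) := by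
      apply Complex.ofReal_injective
      push_cast
      push_cast at h2
      rw [← h2]
      ring
    simp only [mul_zero, add_zero, Complex.zero_re, Complex.zero_im] at h3 h4
    rw [show (1 / 4 : ℂ) = ((1 / 4 : ℝ) : ℂ) by norm_num, Complex.re_ofReal_mul] at h3
    rw [show (1 / 4 : ℂ) = ((1 / 4 : ℝ) : ℂ) by norm_num, Complex.im_ofReal_mul] at h4
    rw [Complex.sub_re, Complex.ofReal_re] at h3
    rw [Complex.sub_im, Complex.ofReal_im] at h4
    simp at h3 h4
    have h6 := sub_eq_zero.1 h3
    refine ⟨?_, (sq_eq_sq₀ (norm_nonneg _) (norm_nonneg _)).1 h6, h4⟩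
    refine (sq_eq_sq₀ (norm_nonneg _) (inv_nonneg.2 (hr x hx).le)).1 ?_
    linarith
  have hsc : ∀ x ∈ U, surfNormLift g x = ψ x := fun x hx => by
    rw [surfNormLift_eq, (key x hx).1, inv_inv, hψ x hx]
  refine ⟨⟨hg, fun x hx => ?_, ?_, fun x hx => ?_, fun x hx v hv => ?_, fun x hx => ?_⟩, hsc⟩
  · rw [conformalAt_iff, (key x hx).1]
    exact ⟨inv_pos.2 (hr x hx), (key x hx).1 ▸ (key x hx).2⟩
  · refine contDiffOn_pi.2 fun i => ?_
    exact Complex.reCLM.contDiff.comp_contDiffOn (contDiffOn_pi.1 h.smooth_normal i)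
  · apply Complex.ofReal_injective
    rw [← mink_ofRealVec]
    simpa using h.unit_normal x hx
  · rw [jetSpan_congr hU hφ hx] at hv
    exact mink_eq_zero_of_mem_jetSpan (h.normal_lift x hx) (h.normal_dz x hx)
      (h.mink_normal_dzbar hx) (h.normal_dz_dzbar x hx) v (jetSpan_smul_le hU hl h.smooth hx hv)
  · have ev : ∀ y ∈ U, surfNormLift g =ᶠ[𝓝 y] ψ := fun y hy =>
      eventually_of_mem (hU.mem_nhds hy) hsc
    rw [dzVec_congr (eventually_of_mem (hU.mem_nhds hx) fun y hy => dzVec_congr (ev y hy)),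
      hsc x hx]
    exact h.hill x hx

end LocalSurfaces

/-! ### Change of coordinates -/

section Transport

open Filter Topology Matrix

variable {κ c κ' c' : ℂ → ℂ} {ψ n : ℂ → Fin 5 → ℂ} {U V : Set ℂ} {t : ℂ → ℂ}

/-- The factor `|t'|⁻¹` by which normalized lifts change under the coordinate change `t`. -/
def stretch (t : ℂ → ℂ) (w : ℂ) : ℂ := ((‖deriv t w‖⁻¹ : ℝ) : ℂ)

theorem stretch_sq_mul (t : ℂ → ℂ) {w : ℂ} (h : deriv t w ≠ 0) :
    stretch t w * stretch t w * (deriv t w * conj (deriv t w)) = 1 := by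
  have : (‖deriv t w‖ : ℂ) ≠ 0 := by exact_mod_cast norm_ne_zero_iff.2 h
  rw [Complex.mul_conj, Complex.normSq_eq_norm_sq, stretch]
  push_cast
  field_simp

theorem contDiffOn_of_holomorphic (hV : IsOpen V) {g : ℂ → ℂ} (hg : DifferentiableOn ℂ g V) :
    ContDiffOn ℝ ∞ g V := fun _ hx =>
  ((hg.analyticAt (hV.mem_nhds hx)).contDiffAt.restrict_scalars ℝ).contDiffWithinAt

theorem contDiffOn_stretch (hV : IsOpen V) (ht : DifferentiableOn ℂ t V)
    (ht' : ∀ x ∈ V, deriv t x ≠ 0) : ContDiffOn ℝ ∞ (stretch t) V := by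
  have h1 := contDiffOn_of_holomorphic hV (ht.deriv hV)
  exact Complex.ofRealCLM.contDiff.comp_contDiffOn
    ((h1.norm ℝ ht').inv fun _ hx => norm_ne_zero_iff.2 (ht' _ hx))

/-- Apply `∂_z` to the identity `s² t' conj t' = 1` for the stretch `s`; `conj t'` is
antiholomorphic and does not contribute. Cancelling common factors gives `s_z = -s t''/(2 t')`. -/
theorem dz_stretch (hV : IsOpen V) (ht : DifferentiableOn ℂ t V) (ht' : ∀ x ∈ V, deriv t x ≠ 0)
    {w : ℂ} (hw : w ∈ V) :
    dz (stretch t) w = stretch t w * (-(1 / 2 : ℂ) * (deriv (deriv t) w / deriv t w)) := by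
  have hn := hV.mem_nhds hw
  have hd := ((ht.deriv hV).differentiableAt hn)
  have hdr : DifferentiableAt ℝ (deriv t) w := hd.restrictScalars ℝ
  have hc : DifferentiableAt ℝ (fun x => conj (deriv t x)) w :=
    Complex.conjCLE.differentiableAt.comp w hdr
  have hs := ((contDiffOn_stretch hV ht ht').contDiffAt hn).differentiableAt (by simp)
  have e1 : dz (fun x => stretch t x * stretch t x * (deriv t x * conj (deriv t x))) w = 0 := by
    rw [← dz_const 1 w]
    exact dz_congr (eventually_of_mem hn fun x hx => stretch_sq_mul t (ht' x hx))
  rw [dz_mul (hs.fun_mul hs) (hdr.fun_mul hc), dz_mul hs hs, dz_mul hdr hc, dz_conj,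
    dzbar_of_holomorphic hd, dz_of_holomorphic hd, map_zero, mul_zero, add_zero] at e1
  have h1 := ht' w hw
  have h2 : conj (deriv t w) ≠ 0 := (map_ne_zero _).2 h1
  have h3 : stretch t w ≠ 0 := by
    rw [stretch]; exact_mod_cast inv_ne_zero (norm_ne_zero_iff.2 h1)
  have e2 : (2 * stretch t w * conj (deriv t w)) * (dz (stretch t) w * deriv t w)
      = (2 * stretch t w * conj (deriv t w))
        * (-(1 / 2 : ℂ) * stretch t w * deriv (deriv t) w) := by
    linear_combination e1
  have e3 := mul_left_cancel₀ (mul_ne_zero (mul_ne_zero two_ne_zero h3) h2) e2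
  field_simp
  linear_combination 2 * e3

theorem conj_stretch (t : ℂ → ℂ) (w : ℂ) : conj (stretch t w) = stretch t w := Complex.conj_ofReal _

theorem jetSpan_comp_le (hU : IsOpen U) (hV : IsOpen V) (hψ : ContDiffOn ℝ ∞ ψ U)
    (ht : DifferentiableOn ℂ t V) (hm : Set.MapsTo t V U) {w : ℂ} (hw : w ∈ V) :
    jetSpan (fun x => ψ (t x)) w ≤ jetSpan ψ (t w) := by
  have hd : ∀ x ∈ V, DifferentiableAt ℂ t x := fun x hx => ht.differentiableAt (hV.mem_nhds hx)
  have dψ : ∀ {v : ℂ → Fin 5 → ℂ}, ContDiffOn ℝ ∞ v U → ∀ x ∈ V, DifferentiableAt ℝ v (t x) :=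
    fun hv x hx => IsNormalizedLift.differentiableAt hU (hm hx) hv
  obtain ⟨m0, m1, m2, m3⟩ := mem_jetSpan ψ (t w)
  refine jetSpan_le m0 ?_ ?_ ?_
  · rw [dzVec_comp_holomorphic (dψ hψ w hw) (hd w hw)]
    exact Submodule.smul_mem _ _ m1
  · rw [dzbarVec_comp_holomorphic (dψ hψ w hw) (hd w hw)]
    exact Submodule.smul_mem _ _ m2
  · have hdd := (ht.deriv hV).differentiableAt (hV.mem_nhds hw)
    have hc : DifferentiableAt ℝ (fun x => conj (deriv t x)) w :=
      Complex.conjCLE.differentiableAt.comp w (hdd.restrictScalars ℝ)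
    have hq := dψ (contDiffOn_dzbarVec hU hψ) w hw
    have hqt : DifferentiableAt ℝ (fun x => dzbarVec ψ (t x)) w :=
      hq.comp w ((hd w hw).restrictScalars ℝ)
    rw [dzVec_congr (eventually_of_mem (hV.mem_nhds hw) fun x hx =>
      dzbarVec_comp_holomorphic (dψ hψ x hx) (hd x hx)),
      dzVec_smul hc hqt,
      dzVec_comp_holomorphic hq (hd w hw)]
    exact add_mem (Submodule.smul_mem _ _ m2)
      (Submodule.smul_mem _ _ (Submodule.smul_mem _ _ m3))

/-- The transformation of normalized lifts under holomorphic changes of coordinates. -/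
theorem IsNormalizedLift.comp_holomorphic (hU : IsOpen U) (hV : IsOpen V)
    (h : IsNormalizedLift κ c ψ n U) (ht : DifferentiableOn ℂ t V)
    (ht' : ∀ x ∈ V, deriv t x ≠ 0) (hm : Set.MapsTo t V U)
    (hκ : ∀ x ∈ V, κ' x = κ (t x) * (deriv t x ^ 2 / (‖deriv t x‖ : ℂ)))
    (hc : ∀ x ∈ V, c' x = c (t x) * deriv t x ^ 2 + classicalSchwarzian t x) :
    IsNormalizedLift κ' c' (fun x => stretch t x • ψ (t x)) (fun x => n (t x)) V := by
  have hd : ∀ x ∈ V, DifferentiableAt ℂ t x := fun x hx => ht.differentiableAt (hV.mem_nhds hx)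
  have hdr : ∀ x ∈ V, DifferentiableAt ℝ t x := fun x hx => (hd x hx).restrictScalars ℝ
  have hts := contDiffOn_of_holomorphic hV ht
  have hs := contDiffOn_stretch hV ht ht'
  have hψt : ContDiffOn ℝ ∞ (fun x => ψ (t x)) V := h.smooth.comp hts hm
  have ds : ∀ x ∈ V, DifferentiableAt ℝ (stretch t) x := fun x hx =>
    (hs.contDiffAt (hV.mem_nhds hx)).differentiableAt (by simp)
  have dψt : ∀ x ∈ V, DifferentiableAt ℝ (fun x => ψ (t x)) x := fun x hx =>
    IsNormalizedLift.differentiableAt hV hx hψt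
  have dψ : ∀ {v : ℂ → Fin 5 → ℂ}, ContDiffOn ℝ ∞ v U → ∀ x ∈ V, DifferentiableAt ℝ v (t x) :=
    fun hv x hx => IsNormalizedLift.differentiableAt hU (hm hx) hv
  have e1 : ∀ x ∈ V, dzVec (fun x => stretch t x • ψ (t x)) x
      = dz (stretch t) x • ψ (t x) + stretch t x • deriv t x • dzVec ψ (t x) := fun x hx => by
    rw [dzVec_smul (ds x hx) (dψt x hx), dzVec_comp_holomorphic (dψ h.smooth x hx) (hd x hx)]
  have e2 : ∀ x ∈ V, dzbarVec (fun x => stretch t x • ψ (t x)) x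
      = dzbar (stretch t) x • ψ (t x) + stretch t x • conj (deriv t x) • dzbarVec ψ (t x) :=
    fun x hx => by
    rw [dzbarVec_smul (ds x hx) (dψt x hx),
      dzbarVec_comp_holomorphic (dψ h.smooth x hx) (hd x hx)]
  have hspan : ∀ x ∈ V, ∀ v ∈ jetSpan (fun x => stretch t x • ψ (t x)) x,
      mink (n (t x)) v = 0 := fun x hx v hv =>
    mink_eq_zero_of_mem_jetSpan (h.normal_lift _ (hm hx)) (h.normal_dz _ (hm hx))
      (h.mink_normal_dzbar (hm hx)) (h.normal_dz_dzbar _ (hm hx)) v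
      (jetSpan_comp_le hU hV h.smooth ht hm hx (jetSpan_smul_le hV hs hψt hx hv))
  refine ⟨hs.smul hψt, h.smooth_normal.comp hts hm, fun x i => ?_, fun x i => h.real_normal _ i,
    fun x hx => ?_, fun x hx => ?_, fun x hx => ?_, fun x hx => h.unit_normal _ (hm hx),
    fun x hx => hspan x hx _ (mem_jetSpan _ x).1, fun x hx => hspan x hx _ (mem_jetSpan _ x).2.1,
    fun x hx => hspan x hx _ (mem_jetSpan _ x).2.2.2, fun x hx => ?_⟩
  · rw [Pi.smul_apply, smul_eq_mul, map_mul, conj_stretch, h.real]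
  · rw [mink_smul_left, mink_smul_right, h.null _ (hm hx)]; ring
  · rw [e1 x hx]
    simp only [mink_add_left, mink_add_right, mink_smul_left, mink_smul_right,
      h.null _ (hm hx), h.conformal _ (hm hx), h.mink_dz_lift hU (hm hx),
      mink_comm (ψ (t x)) (dzVec ψ (t x))]
    ring
  · rw [e1 x hx, e2 x hx]
    simp only [mink_add_left, mink_add_right, mink_smul_left, mink_smul_right,
      h.null _ (hm hx), h.normalized _ (hm hx), h.mink_dz_lift hU (hm hx),
      h.mink_dzbar_lift hU (hm hx), mink_comm (ψ (t x)) (dzbarVec ψ (t x))]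
    linear_combination (1 / 2 : ℂ) * stretch_sq_mul t (ht' x hx)
  · have hdd : DifferentiableOn ℂ (deriv t) V := ht.deriv hV
    have hq : DifferentiableOn ℂ (fun x => deriv (deriv t) x / deriv t x) V :=
      (hdd.deriv hV).div hdd ht'
    have hqx := hq.differentiableAt (hV.mem_nhds hx)
    have htx := hdd.differentiableAt (hV.mem_nhds hx)
    -- With `q = t''/t'` and stretch `s`, the first derivative is `s (-q/2 ψ + t' ψ_z)`. On
    -- differentiating again the `ψ_z` terms cancel, and the new coefficient of `ψ` is `s (q²/4 -
    -- q'/2)`, which is `-s/2` times the classical Schwarzian of `t`.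
    have e3 : ∀ y ∈ V, dzVec (fun x => stretch t x • ψ (t x)) y
        = stretch t y • ((-(1 / 2 : ℂ) * (deriv (deriv t) y / deriv t y)) • ψ (t y)
          + deriv t y • dzVec ψ (t y)) := fun y hy => by
      rw [e1 y hy, dz_stretch hV ht ht' hy, smul_add, mul_smul]
    have hp := dψ (contDiffOn_dzVec hU h.smooth) x hx
    have hpt : DifferentiableAt ℝ (fun x => dzVec ψ (t x)) x := hp.comp x (hdr x hx)
    have hqr : DifferentiableAt ℝ
        (fun y => -(1 / 2 : ℂ) * (deriv (deriv t) y / deriv t y)) x :=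
      (hqx.restrictScalars ℝ).const_mul _
    have e4 : dz (fun y => -(1 / 2 : ℂ) * (deriv (deriv t) y / deriv t y)) x
        = -(1 / 2 : ℂ) * deriv (fun y => deriv (deriv t) y / deriv t y) x := by
      rw [dz_of_holomorphic (hqx.const_mul _), deriv_const_mul _ hqx]
    have hhill : dzVec (dzVec ψ) (t x) = (-c (t x) / 2) • ψ (t x) + κ (t x) • n (t x) :=
      h.dzVec_dzVec_eq (hm hx)
    have hinner : dzVec (fun y => (-(1 / 2 : ℂ) * (deriv (deriv t) y / deriv t y)) • ψ (t y)
          + deriv t y • dzVec ψ (t y)) x = _ := dzVec_add (hqr.fun_smul (dψt x hx))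
        ((htx.restrictScalars ℝ).fun_smul hpt)
    rw [dzVec_congr (eventually_of_mem (hV.mem_nhds hx) e3),
      dzVec_smul (ds x hx) ((hqr.fun_smul (dψt x hx)).fun_add
        ((htx.restrictScalars ℝ).fun_smul hpt)), hinner,
      dzVec_smul hqr (dψt x hx), dzVec_smul (htx.restrictScalars ℝ) hpt,
      dzVec_comp_holomorphic (dψ h.smooth x hx) (hd x hx), dzVec_comp_holomorphic hp (hd x hx),
      dz_stretch hV ht ht' hx, e4, dz_of_holomorphic htx, hhill, hκ x hx, hc x hx,
      classicalSchwarzian]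
    funext i
    simp only [Pi.add_apply, Pi.smul_apply, smul_eq_mul]
    have h1 := ht' x hx
    have h2 : stretch t x = (‖deriv t x‖ : ℂ)⁻¹ := by rw [stretch]; push_cast; rfl
    rw [h2]
    have h3 : (‖deriv t x‖ : ℂ) ≠ 0 := by exact_mod_cast norm_ne_zero_iff.2 h1
    field_simp
    ring

variable {g : ℂ → S3} {N : ℂ → Fin 5 → ℝ}

/-- The transformation of local surfaces under holomorphic changes of coordinates. -/
theorem IsLocalSurface.comp_holomorphic (hU : IsOpen U) (hV : IsOpen V)
    (h : IsLocalSurface κ c g N U) (ht : DifferentiableOn ℂ t V)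
    (ht' : ∀ x ∈ V, deriv t x ≠ 0) (hm : Set.MapsTo t V U)
    (hκ : ∀ x ∈ V, κ' x = κ (t x) * (deriv t x ^ 2 / (‖deriv t x‖ : ℂ)))
    (hc : ∀ x ∈ V, c' x = c (t x) * deriv t x ^ 2 + classicalSchwarzian t x) :
    IsLocalSurface κ' c' (fun x => g (t x)) (fun x => N (t x)) V ∧
      ∀ x ∈ V, surfNormLift (fun x => g (t x)) x = stretch t x • surfNormLift g (t x) := by
  refine isLocalSurface_of_normalizedLift hV
    ((h.toNormalizedLift hU).comp_holomorphic hU hV ht ht' hm hκ hc)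
    (r := fun x => ‖deriv t x‖⁻¹ * ‖fderiv ℝ (fun x => (g x : E4)) (t x) 1‖⁻¹)
    (fun x hx => ?_) fun x hx => ?_
  · have h1 := norm_pos_iff.2 (ht' x hx)
    have h2 := (conformalAt_iff.1 (h.conformalAt _ (hm hx))).1
    positivity
  · rw [surfNormLift_eq, smul_smul, stretch]
    push_cast
    rfl

theorem IsLocalSurface.mono (hVU : V ⊆ U) (h : IsLocalSurface κ c g N U) :
    IsLocalSurface κ c g N V :=
  ⟨h.smooth.mono hVU, fun w hw => h.conformalAt w (hVU hw), h.smooth_normal.mono hVU,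
    fun w hw => h.unit_normal w (hVU hw), fun w hw => h.normal w (hVU hw),
    fun w hw => h.hill w (hVU hw)⟩

theorem surfNormLift_congr (hU : IsOpen U) {g' : ℂ → S3} (hg : ∀ x ∈ U, g' x = g x) {w : ℂ}
    (hw : w ∈ U) : surfNormLift g' w = surfNormLift g w := by
  have : (fun x => (g' x : E4)) =ᶠ[𝓝 w] fun x => (g x : E4) :=
    eventually_of_mem (hU.mem_nhds hw) fun x hx => by simp only [hg x hx]
  funext i
  rw [surfNormLift, surfNormLift, this.fderiv_eq, hg w hw]

theorem IsLocalSurface.congr (hU : IsOpen U) (h : IsLocalSurface κ c g N U) {g' : ℂ → S3}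
    {N' : ℂ → Fin 5 → ℝ} (hg : ∀ x ∈ U, g' x = g x) (hN : ∀ x ∈ U, N' x = N x)
    (hκ : ∀ x ∈ U, κ' x = κ x) (hc : ∀ x ∈ U, c' x = c x) :
    IsLocalSurface κ' c' g' N' U := by
  have hge : ∀ x ∈ U, (g' x : E4) = g x := fun x hx => by rw [hg x hx]
  have hs : ∀ x ∈ U, surfNormLift g' x = surfNormLift g x := fun x hx =>
    surfNormLift_congr hU hg hx
  refine ⟨h.smooth.congr hge, fun w hw => ?_, h.smooth_normal.congr hN, fun w hw => ?_,
    fun w hw => ?_, fun w hw => ?_⟩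
  · exact (h.conformalAt w hw).congr hw hU hge
  · rw [hN w hw]; exact h.unit_normal w hw
  · rw [hN w hw, jetSpan_congr hU (u := surfLift g) (fun x hx => by
      rw [surfLift, surfLift, hg x hx]) hw]
    exact h.normal w hw
  · have ev : ∀ y ∈ U, surfNormLift g' =ᶠ[𝓝 y] surfNormLift g := fun y hy =>
      eventually_of_mem (hU.mem_nhds hy) hs
    rw [dzVec_congr (eventually_of_mem (hU.mem_nhds hw) fun y hy => dzVec_congr (ev y hy)),
      hs w hw, hN w hw, hκ w hw, hc w hw]
    exact h.hill w hw

end Transport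

/-! ### The group of orthochronous Lorentz transformations -/

section LorentzGroup

open Filter Topology Matrix

theorem coneLift_zero (x : S3) : coneLift x 0 = 1 := rfl

theorem coneLift_injective : Function.Injective coneLift := fun x y h => by
  ext i
  exact congrFun h i.succ

theorem exists_smul_coneLift {v : Fin 5 → ℝ} (hv : mink v v = 0) (h0 : v 0 ≠ 0) :
    ∃ y : S3, v = v 0 • coneLift y := by
  refine ⟨⟨WithLp.toLp 2 fun i => (v 0)⁻¹ * v i.succ, ?_⟩, ?_⟩
  · rw [mem_sphere_zero_iff_norm, EuclideanSpace.norm_eq, Real.sqrt_eq_one]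
    simp only [Real.norm_eq_abs, sq_abs]
    rw [mink] at hv
    simp only [mul_pow, ← Finset.mul_sum]
    have : ∑ i : Fin 4, v i.succ ^ 2 = v 0 ^ 2 := by
      simp only [pow_two]; linarith
    rw [this]
    field_simp
  · funext i
    refine Fin.cases ?_ (fun i => ?_) i
    · simp [coneLift_zero]
    · simp [coneLift, h0]

/-- Cauchy–Schwarz for unit vectors; the equality case, treated next, distinguishes the points of
the sphere. -/
theorem mink_coneLift_nonpos (x y : S3) : mink (coneLift x) (coneLift y) ≤ 0 := by
  rw [mink_coneLift]
  have := real_inner_le_norm (x : E4) (y : E4)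
  rw [norm_eq_of_mem_sphere, norm_eq_of_mem_sphere] at this
  linarith

theorem eq_of_mink_coneLift {x y : S3} (h : mink (coneLift x) (coneLift y) = 0) : x = y := by
  rw [mink_coneLift] at h
  have := (inner_eq_one_iff_of_norm_eq_one (𝕜 := ℝ) (norm_eq_of_mem_sphere x)
    (norm_eq_of_mem_sphere y)).1 (by linarith)
  exact Subtype.ext this

theorem IsLorentz.exists_smul_coneLift {A : (Fin 5 → ℝ) ≃ₗ[ℝ] (Fin 5 → ℝ)} (hA : IsLorentz A)
    (x : S3) : A (coneLift x) 0 ≠ 0 ∧ ∃ y : S3, A (coneLift x) = A (coneLift x) 0 • coneLift y := by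
  have hn : mink (A (coneLift x)) (A (coneLift x)) = 0 := by rw [hA, mink_coneLift_self]
  -- A null vector with vanishing time component is zero, but an automorphism does not annihilate
  -- `(1, x)`.
  have h0 : A (coneLift x) 0 ≠ 0 := by
    intro h0
    have h1 : A (coneLift x) = 0 := by
      rw [mink, h0] at hn
      have hs : ∑ i : Fin 4, A (coneLift x) i.succ * A (coneLift x) i.succ = 0 := by linarith
      rw [Finset.sum_eq_zero_iff_of_nonneg fun i _ => mul_self_nonneg _] at hs
      funext i
      refine Fin.cases h0 (fun i => ?_) i
      exact mul_self_eq_zero.1 (hs i (Finset.mem_univ i))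
    have h2 := congrFun ((LinearEquiv.map_eq_zero_iff A).1 h1) 0
    rw [coneLift_zero] at h2
    exact one_ne_zero h2
  exact ⟨h0, ConformalSurface.exists_smul_coneLift hn h0⟩

/-- A Lorentz transformation which maps one forward null vector to a forward null vector preserves
the forward light cone. -/
theorem IsLorentz.pos_of_pos {A : (Fin 5 → ℝ) ≃ₗ[ℝ] (Fin 5 → ℝ)} (hA : IsLorentz A) {x₀ : S3}
    (h0 : 0 < A (coneLift x₀) 0) (x : S3) : 0 < A (coneLift x) 0 := by
  obtain ⟨hx, y, hy⟩ := hA.exists_smul_coneLift x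
  obtain ⟨_, y₀, hy₀⟩ := hA.exists_smul_coneLift x₀
  by_contra hneg
  have hlt : A (coneLift x) 0 < 0 := lt_of_le_of_ne (not_lt.1 hneg) hx
  have e := hA (coneLift x) (coneLift x₀)
  rw [hy, hy₀, mink_smul_left, mink_smul_right] at e
  have h1 := mink_coneLift_nonpos x x₀
  have h2 := mink_coneLift_nonpos y y₀
  -- If the time components had opposite signs, the product of the images would be nonnegative and
  -- that of the preimages nonpositive. Both then vanish, so `x = x₀`, contradicting the signs.
  have h3 : 0 ≤ A (coneLift x) 0 * (A (coneLift x₀) 0 * mink (coneLift y) (coneLift y₀)) :=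
    mul_nonneg_of_nonpos_of_nonpos hlt.le (mul_nonpos_of_nonneg_of_nonpos h0.le h2)
  have h4 := eq_of_mink_coneLift (le_antisymm h1 (e ▸ h3))
  rw [h4] at hlt
  linarith

/-- The group of Lorentz transformations which preserve the forward light cone. -/
def orthochronousGroup : Subgroup ((Fin 5 → ℝ) ≃ₗ[ℝ] (Fin 5 → ℝ)) where
  carrier := {A | IsLorentz A ∧ ∀ x : S3, 0 < A (coneLift x) 0}
  one_mem' := ⟨fun _ _ => rfl, fun _ => by simp [coneLift_zero]⟩
  mul_mem' := by
    rintro A B ⟨hA, hA'⟩ ⟨hB, hB'⟩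
    refine ⟨fun v w => ?_, fun x => ?_⟩
    · rw [LinearEquiv.mul_apply, LinearEquiv.mul_apply, hA, hB]
    · obtain ⟨_, y, hy⟩ := hB.exists_smul_coneLift x
      rw [LinearEquiv.mul_apply, hy, map_smul]
      exact mul_pos (hB' x) (hA' y)
  inv_mem' := by
    rintro A ⟨hA, hA'⟩
    have hi : ∀ v, A (A⁻¹ v) = v := fun v => A.apply_symm_apply v
    have hA2 : IsLorentz A⁻¹ := fun v w => by rw [← hA, hi, hi]
    refine ⟨hA2, fun x => ?_⟩
    obtain ⟨_, y, hy⟩ := hA2.exists_smul_coneLift x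
    have h1 := congrFun (congrArg A hy) 0
    rw [hi, map_smul, Pi.smul_apply, smul_eq_mul, coneLift_zero] at h1
    exact pos_of_mul_pos_left (h1 ▸ one_pos) (hA' y).le

instance : CoeFun orthochronousGroup fun _ => (Fin 5 → ℝ) → Fin 5 → ℝ :=
  ⟨fun A => (A : (Fin 5 → ℝ) ≃ₗ[ℝ] (Fin 5 → ℝ))⟩

/-- The action of orthochronous Lorentz transformations on the sphere. -/
def lorentzAct (A : orthochronousGroup) (x : S3) : S3 :=
  (A.2.1.exists_smul_coneLift x).2.choose

theorem lorentz_coneLift (A : orthochronousGroup) (x : S3) :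
    A (coneLift x) = A (coneLift x) 0 • coneLift (lorentzAct A x) :=
  (A.2.1.exists_smul_coneLift x).2.choose_spec

theorem lorentzAct_eq {A : orthochronousGroup} {x y : S3} {r : ℝ}
    (h : A (coneLift x) = r • coneLift y) : lorentzAct A x = y := by
  have h0 : A (coneLift x) 0 = r := by rw [h]; simp [coneLift_zero]
  have h1 := (lorentz_coneLift A x).symm.trans h
  rw [h0] at h1
  refine coneLift_injective (smul_right_injective _ ?_ h1)
  rw [← h0]
  exact (A.2.2 x).ne'

theorem lorentzAct_mul (A B : orthochronousGroup) (x : S3) :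
    lorentzAct (A * B) x = lorentzAct A (lorentzAct B x) := by
  refine lorentzAct_eq (r := B (coneLift x) 0 * A (coneLift (lorentzAct B x)) 0) ?_
  rw [mul_smul, ← lorentz_coneLift, Subgroup.coe_mul, LinearEquiv.mul_apply, ← map_smul,
    ← lorentz_coneLift]

theorem lorentzAct_one (x : S3) : lorentzAct 1 x = x := lorentzAct_eq (r := 1) (by simp)

/-- The homomorphism from orthochronous Lorentz transformations to Möbius transformations. -/
def moebiusHom : orthochronousGroup →* moebiusGroup where
  toFun A := ⟨⟨lorentzAct A, lorentzAct A⁻¹,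
      fun x => by rw [← lorentzAct_mul, inv_mul_cancel, lorentzAct_one],
      fun x => by rw [← lorentzAct_mul, mul_inv_cancel, lorentzAct_one]⟩,
    A, A.2.1, fun x => ⟨_, (A.2.2 x).ne', lorentz_coneLift A x⟩⟩
  map_one' := by ext1; ext1 x; exact lorentzAct_one x
  map_mul' A B := by ext1; ext1 x; exact lorentzAct_mul A B x

end LorentzGroup

/-! ### Local existence -/

section LocalExistence

open Filter Topology Matrix

theorem swapMat_mul_self : swapMat * swapMat = 1 := by
  ext i j
  fin_cases i <;> fin_cases j <;>
    simp only [Matrix.mul_apply, Fin.sum_univ_five] <;> simp [swapMat]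

/-- The system is compatible with the reality condition: conjugation combined with the swap
exchanges the `z`- and the `z̄`-equation. -/
theorem connMat_map_conj (k c d : ℂ) :
    (connMat k (conj k) c d).map (starRingEnd ℂ) * swapMat
      = swapMat * connMatBar k (conj k) (conj c) (conj d) := by
  ext i j
  fin_cases i <;> fin_cases j <;>
    simp only [Matrix.mul_apply, Fin.sum_univ_five, Matrix.map_apply] <;>
    simp [swapMat, connMat, connMatBar, map_ofNat] <;> ring

theorem connMatBar_map_conj (k c d : ℂ) :
    (connMatBar k (conj k) (conj c) (conj d)).map (starRingEnd ℂ) * swapMat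
      = swapMat * connMat k (conj k) c d := by
  ext i j
  fin_cases i <;> fin_cases j <;>
    simp only [Matrix.mul_apply, Fin.sum_univ_five, Matrix.map_apply] <;>
    simp [swapMat, connMat, connMatBar, map_ofNat] <;> ring

theorem dzbarMat_connMat {k k' c d : ℂ → ℂ} {w : ℂ} (hk : DifferentiableAt ℝ k w)
    (hk' : DifferentiableAt ℝ k' w) (hc : DifferentiableAt ℝ c w) (hd : DifferentiableAt ℝ d w) :
    dzbarMat (fun x => connMat (k x) (k' x) (c x) (d x)) w =
      !![0, -dzbar c w / 2, -(dzbar k w * k' w + k w * dzbar k' w), 0, 2 * dzbar d w;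
        0, 0, 0, -2 * (dzbar k w * k' w + k w * dzbar k' w), 0;
        0, 0, 0, -dzbar c w, -2 * dzbar k w;
        0, 0, 0, 0, 0;
        0, dzbar k w, 0, 2 * dzbar d w, 0] := by
  have hm : ∀ (a : ℂ) {g : ℂ → ℂ}, DifferentiableAt ℝ g w →
      dzbar (fun x => a * g x) w = a * dzbar g w := fun a g hg => by
    rw [dzbar_mul (differentiableAt_const a) hg]; simp
  have hc2 : dzbar (fun x => -c x / 2) w = -dzbar c w / 2 := by
    have : (fun x => -c x / 2) = fun x => (-(1 / 2) : ℂ) * c x := by funext x; ring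
    rw [this, hm _ hc]; ring
  ext i j
  fin_cases i <;> fin_cases j <;>
    simp [dzbarMat, connMat, dzbar_neg, dzbar_mul hk hk', hm _ hd, hc2, hm _ hk,
      hm _ (hk.fun_mul hk')]

theorem dzMat_connMatBar {k k' c d : ℂ → ℂ} {w : ℂ} (hk : DifferentiableAt ℝ k w)
    (hk' : DifferentiableAt ℝ k' w) (hc : DifferentiableAt ℝ c w) (hd : DifferentiableAt ℝ d w) :
    dzMat (fun x => connMatBar (k x) (k' x) (c x) (d x)) w =
      !![0, -(dz k w * k' w + k w * dz k' w), -dz c w / 2, 0, 2 * dz d w;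
        0, 0, 0, -dz c w, -2 * dz k' w;
        0, 0, 0, -2 * (dz k w * k' w + k w * dz k' w), 0;
        0, 0, 0, 0, 0;
        0, 0, dz k' w, 2 * dz d w, 0] := by
  have hm : ∀ (a : ℂ) {g : ℂ → ℂ}, DifferentiableAt ℝ g w →
      dz (fun x => a * g x) w = a * dz g w := fun a g hg => by
    rw [dz_mul (differentiableAt_const a) hg]; simp
  have hc2 : dz (fun x => -c x / 2) w = -dz c w / 2 := by
    have : (fun x => -c x / 2) = fun x => (-(1 / 2) : ℂ) * c x := by funext x; ring
    rw [this, hm _ hc]; ring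
  ext i j
  fin_cases i <;> fin_cases j <;>
    simp [dzMat, connMatBar, dz_neg, dz_mul hk hk', hm _ hd, hc2, hm _ hk',
      hm _ (hk.fun_mul hk')]

/-- The algebraic core of the flatness. The left side is the difference of derivatives after
eliminating `c_z̄` by the Gauss equation and `κ_z̄z̄` by the Codazzi equation; `e`, `e'`, `D'` stand
for `κ_z` and the conjugates of `κ_z` and `κ_z̄z̄`. -/
theorem connMat_commutator (k k' c c' d d' e e' D' : ℂ) :
    !![0, -(2 * (3 * d' * k + k' * e)) / 2, -(d * k' + k * e'), 0,
          2 * (D' + c * k' / 2 - c' * k / 2);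
        0, 0, 0, -2 * (d * k' + k * e'), 0;
        0, 0, 0, -(2 * (3 * d' * k + k' * e)), -2 * d;
        0, 0, 0, 0, 0;
        0, d, 0, 2 * (D' + c * k' / 2 - c' * k / 2), 0]
      - !![0, -(e * k' + k * d'), -(2 * (3 * d * k' + k * e')) / 2, 0, 2 * D';
        0, 0, 0, -(2 * (3 * d * k' + k * e')), -2 * d';
        0, 0, 0, -2 * (e * k' + k * d'), 0;
        0, 0, 0, 0, 0;
        0, 0, d', 2 * D', 0]
      = connMat k k' c d * connMatBar k k' c' d' - connMatBar k k' c' d' * connMat k k' c d := by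
  ext i j
  fin_cases i <;> fin_cases j <;>
    simp only [Matrix.sub_apply, Matrix.mul_apply, Fin.sum_univ_five] <;>
    simp [connMat, connMatBar] <;> ring

/-- The conformal Gauss and Codazzi equations express the flatness of the connection. -/
theorem zero_curvature {κ c : ℂ → ℂ} {U : Set ℂ} (hU : IsOpen U) (hκ : ContDiffOn ℝ ∞ κ U)
    (hc : ContDiffOn ℝ ∞ c U) {w : ℂ} (hw : w ∈ U)
    (gauss : (1 / 2 : ℂ) * dzbar c w
      = 3 * dz (fun x => conj (κ x)) w * κ w + conj (κ w) * dz κ w)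
    (codazzi : (dzbar (dzbar κ) w + (1 / 2 : ℂ) * conj (c w) * κ w).im = 0) :
    dzbarMat (fun x => connMat (κ x) (conj (κ x)) (c x) (dzbar κ x)) w
      - dzMat (fun x => connMatBar (κ x) (conj (κ x)) (conj (c x)) (conj (dzbar κ x))) w
      = connMat (κ w) (conj (κ w)) (c w) (dzbar κ w)
          * connMatBar (κ w) (conj (κ w)) (conj (c w)) (conj (dzbar κ w))
        - connMatBar (κ w) (conj (κ w)) (conj (c w)) (conj (dzbar κ w))
          * connMat (κ w) (conj (κ w)) (c w) (dzbar κ w) := by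
  have hd : ∀ {g : ℂ → ℂ}, ContDiffOn ℝ ∞ g U → DifferentiableAt ℝ g w := fun hg =>
    (hg.contDiffAt (hU.mem_nhds hw)).differentiableAt (by simp)
  have hκb := contDiffOn_dzbar hU hκ
  rw [dzbarMat_connMat (hd hκ) (hd (contDiffOn_conj hκ)) (hd hc) (hd hκb),
    dzMat_connMatBar (hd hκ) (hd (contDiffOn_conj hκ)) (hd (contDiffOn_conj hc))
      (hd (contDiffOn_conj hκb))]
  rw [dz_conj] at gauss
  rw [dzbar_conj, dz_conj, dz_conj, dz_conj]
  have g1 : dzbar c w = 2 * (3 * conj (dzbar κ w) * κ w + conj (κ w) * dz κ w) := by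
    linear_combination 2 * gauss
  -- A number with vanishing imaginary part equals its conjugate; solved for `κ_z̄z̄`.
  have g2 : dzbar (dzbar κ) w = conj (dzbar (dzbar κ) w) + c w * conj (κ w) / 2
      - conj (c w) * κ w / 2 := by
    have := Complex.conj_eq_iff_im.2 codazzi
    simp only [map_add, map_mul, Complex.conj_conj, map_div₀, map_one, map_ofNat] at this
    linear_combination -this
  rw [← connMat_commutator (e := dz κ w) (e' := conj (dz κ w)) (D' := conj (dzbar (dzbar κ) w)),
    ← g1, ← g2]
  have g3 : 2 * (3 * dzbar κ w * conj (κ w) + κ w * conj (dz κ w)) = conj (dzbar c w) := by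
    rw [g1]
    simp [map_ofNat]
  rw [g3]

/-! ### From the matrix system to a flat one-form with values in a normed algebra. -/

section Transfer

variable {𝔸 : Type*} [NormedRing 𝔸] [NormedAlgebra ℝ 𝔸]
  (Φ : Matrix (Fin 5) (Fin 5) ℂ ≃ₐ[ℝ] 𝔸)

theorem contDiffOn_of_entries {F : ℂ → Matrix (Fin 5) (Fin 5) ℂ} {s : Set ℂ} {m : ℕ∞}
    (h : ∀ i j, ContDiffOn ℝ m (fun x => F x i j) s) :
    ContDiffOn ℝ m (fun x => Φ (F x)) s :=
  (LinearMap.toContinuousLinearMap (E := Fin 5 → Fin 5 → ℂ)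
    (Φ.toLinearMap.comp (Matrix.ofLinearEquiv ℝ).toLinearMap)).contDiff.comp_contDiffOn
      (contDiffOn_pi.2 fun i => contDiffOn_pi.2 fun j => h i j)

/-- The one-form `P dz + Q dz̄`. -/
def oneForm (P Q : Matrix (Fin 5) (Fin 5) ℂ) : ℂ →L[ℝ] 𝔸 :=
  LinearMap.toContinuousLinearMap
    { toFun := fun v => Φ (v • P + conj v • Q)
      map_add' := fun v w => by
        rw [← map_add]
        congr 1
        simp only [map_add]
        module
      map_smul' := fun r v => by
        rw [RingHom.id_apply, ← map_smul]
        congr 1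
        ext i j
        simp
        ring }

theorem oneForm_apply (P Q : Matrix (Fin 5) (Fin 5) ℂ) (v : ℂ) :
    oneForm Φ P Q v = Φ (v • P + conj v • Q) := rfl

theorem contDiffOn_oneForm {P Q : ℂ → Matrix (Fin 5) (Fin 5) ℂ} {s : Set ℂ} {m : ℕ∞}
    (hP : ∀ i j, ContDiffOn ℝ m (fun x => P x i j) s)
    (hQ : ∀ i j, ContDiffOn ℝ m (fun x => Q x i j) s) :
    ContDiffOn ℝ m (fun x => oneForm Φ (P x) (Q x)) s := by
  refine contDiffOn_clm_apply.2 fun v => contDiffOn_of_entries Φ fun i j => ?_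
  exact (contDiffOn_const.mul (hP i j)).add (contDiffOn_const.mul (hQ i j))

variable [FiniteDimensional ℝ 𝔸]

/-- An entry of a matrix as a continuous linear map. -/
def entryCLM (i j : Fin 5) : 𝔸 →L[ℝ] ℂ :=
  LinearMap.toContinuousLinearMap ((Matrix.entryLinearMap ℝ ℂ i j).comp Φ.symm.toLinearMap)

theorem entryCLM_apply (i j : Fin 5) (A : 𝔸) : entryCLM Φ i j A = Φ.symm A i j := rfl

theorem entryCLM_mul (i j : Fin 5) (A B : 𝔸) :
    entryCLM Φ i j (A * B) = ∑ k, entryCLM Φ i k A * entryCLM Φ k j B := by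
  simp only [entryCLM_apply, map_mul, Matrix.mul_apply]

theorem entryCLM_ext {A B : 𝔸} (h : ∀ i j, entryCLM Φ i j A = entryCLM Φ i j B) : A = B :=
  Φ.symm.injective (Matrix.ext h)

theorem entryCLM_oneForm (P Q : Matrix (Fin 5) (Fin 5) ℂ) (v : ℂ) (i j : Fin 5) :
    entryCLM Φ i j (oneForm Φ P Q v) = v * P i j + conj v * Q i j := by
  simp [entryCLM_apply, oneForm_apply]

theorem entryCLM_fderiv_oneForm {P Q : ℂ → Matrix (Fin 5) (Fin 5) ℂ} {w : ℂ}
    (hP : ∀ i j, DifferentiableAt ℝ (fun x => P x i j) w)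
    (hQ : ∀ i j, DifferentiableAt ℝ (fun x => Q x i j) w)
    (h : DifferentiableAt ℝ (fun x => oneForm Φ (P x) (Q x)) w) (u v : ℂ) (i j : Fin 5) :
    entryCLM Φ i j (fderiv ℝ (fun x => oneForm Φ (P x) (Q x)) w u v)
      = (u * v) * dz (fun x => P x i j) w
        + (u * conj v) * dz (fun x => Q x i j) w
        + (conj u * v) * dzbar (fun x => P x i j) w
        + (conj u * conj v) * dzbar (fun x => Q x i j) w := by
  have hm : ∀ (a : ℂ) {g : ℂ → ℂ}, DifferentiableAt ℝ g w →
      dz (fun x => a * g x) w = a * dz g w := fun a g hg => by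
    rw [dz_mul (differentiableAt_const a) hg]; simp
  have hmb : ∀ (a : ℂ) {g : ℂ → ℂ}, DifferentiableAt ℝ g w →
      dzbar (fun x => a * g x) w = a * dzbar g w := fun a g hg => by
    rw [dzbar_mul (differentiableAt_const a) hg]; simp
  have h1 := (entryCLM Φ i j).hasFDerivAt.comp w (h.hasFDerivAt.clm_apply (hasFDerivAt_const v w))
  have h2 : (entryCLM Φ i j ∘ fun x => oneForm Φ (P x) (Q x) v)
      = fun x => v * P x i j + conj v * Q x i j := funext fun x => entryCLM_oneForm ..
  have h3 := congrArg (fun L : ℂ →L[ℝ] ℂ => L u) h1.fderiv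
  rw [h2, fderiv_eq_dz_dzbar, dz_add ((hP i j).const_mul _) ((hQ i j).const_mul _),
    dzbar_add ((hP i j).const_mul _) ((hQ i j).const_mul _), hm _ (hP i j), hm _ (hQ i j),
    hmb _ (hP i j), hmb _ (hQ i j)] at h3
  simp only [ContinuousLinearMap.comp_apply, _root_.add_apply,
    _root_.zero_apply, map_zero, zero_add, ContinuousLinearMap.flip_apply] at h3
  have h4 : entryCLM Φ i j (fderiv ℝ (fun x => oneForm Φ (P x) (Q x)) w u v) = _ :=
    Eq.trans (by simp) h3.symm
  rw [h4]
  ring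

/-- In two real dimensions the curvature has only a `dz ∧ dz̄` component; evaluated on `u`, `v` it
is a multiple of the given identity, with factor `conj u * v - u * conj v`. -/
theorem oneForm_flat {P Q : ℂ → Matrix (Fin 5) (Fin 5) ℂ} {w : ℂ}
    (hP : ∀ i j, DifferentiableAt ℝ (fun x => P x i j) w)
    (hQ : ∀ i j, DifferentiableAt ℝ (fun x => Q x i j) w)
    (h : DifferentiableAt ℝ (fun x => oneForm Φ (P x) (Q x)) w)
    (hz : ∀ i j, dzbar (fun x => P x i j) w - dz (fun x => Q x i j) w
      = (P w * Q w) i j - (Q w * P w) i j) (u v : ℂ) :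
    fderiv ℝ (fun x => oneForm Φ (P x) (Q x)) w u v + oneForm Φ (P w) (Q w) u * oneForm Φ (P w) (Q w) v
      = fderiv ℝ (fun x => oneForm Φ (P x) (Q x)) w v u
        + oneForm Φ (P w) (Q w) v * oneForm Φ (P w) (Q w) u := by
  refine entryCLM_ext Φ fun i j => ?_
  have e := hz i j
  simp only [Matrix.mul_apply, Fin.sum_univ_five] at e
  simp only [map_add, entryCLM_fderiv_oneForm Φ hP hQ h, entryCLM_mul, entryCLM_oneForm,
    Fin.sum_univ_five]
  linear_combination (conj u * v - u * conj v) * e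

theorem dz_entryCLM_of_hasFDerivAt {F : ℂ → 𝔸} {w : ℂ} {P Q : Matrix (Fin 5) (Fin 5) ℂ}
    (h : HasFDerivAt F ((ContinuousLinearMap.mul ℝ 𝔸 (F w)).comp (oneForm Φ P Q)) w)
    (i j : Fin 5) :
    DifferentiableAt ℝ (fun x => entryCLM Φ i j (F x)) w ∧
      dz (fun x => entryCLM Φ i j (F x)) w = (Φ.symm (F w) * P) i j ∧
      dzbar (fun x => entryCLM Φ i j (F x)) w = (Φ.symm (F w) * Q) i j := by
  have h1 : HasFDerivAt (fun x => entryCLM Φ i j (F x)) _ w := (entryCLM Φ i j).hasFDerivAt.comp w h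
  refine ⟨h1.differentiableAt, ?_, ?_⟩
  · rw [h1.dz_eq]
    simp only [ContinuousLinearMap.comp_apply, ContinuousLinearMap.mul_apply', entryCLM_oneForm,
      entryCLM_mul, Matrix.mul_apply, Fin.sum_univ_five, map_one, Complex.conj_I]
    simp only [entryCLM_apply]
    ring_nf
    simp only [Complex.I_sq]
    ring
  · rw [h1.dzbar_eq]
    simp only [ContinuousLinearMap.comp_apply, ContinuousLinearMap.mul_apply', entryCLM_oneForm,
      entryCLM_mul, Matrix.mul_apply, Fin.sum_univ_five, map_one, Complex.conj_I]
    simp only [entryCLM_apply]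
    ring_nf
    simp only [Complex.I_sq]
    ring

variable {κ c : ℂ → ℂ} {U : Set ℂ} {w₀ : ℂ}

/-- Local solutions of the structure equations. -/
theorem exists_isParallelFrame_of_algEquiv (Φ : Matrix (Fin 5) (Fin 5) ℂ ≃ₐ[ℝ] 𝔸)
    (hU : IsOpen U) (hκ : ContDiffOn ℝ ∞ κ U)
    (hc : ContDiffOn ℝ ∞ c U)
    (gauss : ∀ w ∈ U, (1 / 2 : ℂ) * dzbar c w
      = 3 * dz (fun x => conj (κ x)) w * κ w + conj (κ w) * dz κ w)
    (codazzi : ∀ w ∈ U, (dzbar (dzbar κ) w + (1 / 2 : ℂ) * conj (c w) * κ w).im = 0)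
    (hw₀ : w₀ ∈ U) (F₀ : Matrix (Fin 5) (Fin 5) ℂ) :
    ∃ V ⊆ U, IsOpen V ∧ w₀ ∈ V ∧ ∃ F, F w₀ = F₀ ∧ IsParallelFrame κ c F V ∧
      ∀ i j, ContDiffOn ℝ ∞ (fun x => F x i j) V := by
  set P := fun x => connMat (κ x) (conj (κ x)) (c x) (dzbar κ x) with hP
  set Q := fun x => connMatBar (κ x) (conj (κ x)) (conj (c x)) (conj (dzbar κ x)) with hQ
  have h1 := contDiffOn_conj hκ
  have h2 := contDiffOn_dzbar hU hκ
  have h3 := contDiffOn_conj hc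
  have h4 := contDiffOn_conj h2
  have hPs : ∀ i j, ContDiffOn ℝ ∞ (fun x => P x i j) U := fun i j => by
    fin_cases i <;> fin_cases j <;> simp [hP, connMat] <;> fun_prop
  have hQs : ∀ i j, ContDiffOn ℝ ∞ (fun x => Q x i j) U := fun i j => by
    fin_cases i <;> fin_cases j <;> simp [hQ, connMatBar] <;> fun_prop
  have hα := contDiffOn_oneForm Φ (m := ⊤) hPs hQs
  have hd : ∀ {g : ℂ → ℂ}, ContDiffOn ℝ ∞ g U → ∀ w ∈ U, DifferentiableAt ℝ g w :=
    fun hg w hw => (hg.contDiffAt (hU.mem_nhds hw)).differentiableAt (by simp)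
  have : CompleteSpace 𝔸 := FiniteDimensional.complete ℝ _
  obtain ⟨F, hF0, hF⟩ := exists_parallel_frame (x₀ := w₀) (F₀ := Φ F₀)
    ((hα.contDiffAt (hU.mem_nhds hw₀)).of_le (by norm_cast))
    (eventually_of_mem (hU.mem_nhds hw₀) fun w hw => oneForm_flat Φ
      (fun i j => hd (hPs i j) w hw) (fun i j => hd (hQs i j) w hw)
      ((hα.contDiffAt (hU.mem_nhds hw)).differentiableAt (by simp)) fun i j =>
        congrFun (congrFun (zero_curvature hU hκ hc hw (gauss w hw) (codazzi w hw)) i) j)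
  obtain ⟨V, hV, hVo, hwV⟩ := eventually_nhds_iff.1 (hF.and (hU.mem_nhds hw₀))
  refine ⟨V, fun x hx => (hV x hx).2, hVo, hwV, fun x => Φ.symm (F x),
    by simp [hF0], ⟨fun w hw i j => ?_, fun w hw => ?_, fun w hw => ?_⟩, fun i j => ?_⟩
  · exact (dz_entryCLM_of_hasFDerivAt Φ (hV w hw).1 i j).1
  · exact Matrix.ext fun i j => (dz_entryCLM_of_hasFDerivAt Φ (hV w hw).1 i j).2.1
  · exact Matrix.ext fun i j => (dz_entryCLM_of_hasFDerivAt Φ (hV w hw).1 i j).2.2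
  · exact (entryCLM Φ i j).contDiff.comp_contDiffOn
      (contDiffOn_of_hasFDerivAt_mul hVo (hα.mono fun x hx => (hV x hx).2) fun w hw => (hV w hw).1)

end Transfer

variable {κ c : ℂ → ℂ} {U : Set ℂ} {w₀ : ℂ}

theorem exists_isParallelFrame (hU : IsOpen U) (hκ : ContDiffOn ℝ ∞ κ U)
    (hc : ContDiffOn ℝ ∞ c U)
    (gauss : ∀ w ∈ U, (1 / 2 : ℂ) * dzbar c w
      = 3 * dz (fun x => conj (κ x)) w * κ w + conj (κ w) * dz κ w)
    (codazzi : ∀ w ∈ U, (dzbar (dzbar κ) w + (1 / 2 : ℂ) * conj (c w) * κ w).im = 0)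
    (hw₀ : w₀ ∈ U) (F₀ : Matrix (Fin 5) (Fin 5) ℂ) :
    ∃ V ⊆ U, IsOpen V ∧ w₀ ∈ V ∧ ∃ F, F w₀ = F₀ ∧ IsParallelFrame κ c F V ∧
      ∀ i j, ContDiffOn ℝ ∞ (fun x => F x i j) V := by
  have hfin : FiniteDimensional ℝ (Matrix (Fin 5) (Fin 5) ℂ) := inferInstance
  let e : Matrix (Fin 5) (Fin 5) ℂ ≃ₐ[ℝ] Matrix (Fin 5) (Fin 5) ℂ := AlgEquiv.refl
  -- The operator norm for the maximum norm serves as the submultiplicative norm; the conclusion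
  -- does not involve the norm.
  exact @exists_isParallelFrame_of_algEquiv (Matrix (Fin 5) (Fin 5) ℂ)
    Matrix.linftyOpNormedRing (Matrix.linftyOpNormedAlgebra (R := ℝ)) hfin κ c U w₀ e hU hκ hc
    gauss codazzi hw₀ F₀

end LocalExistence

/-! ### Real frames with the right Gram matrix, and local surfaces. -/

section SurfaceExistence

open Filter Topology Matrix

variable {κ c : ℂ → ℂ} {U : Set ℂ} {F : ℂ → Matrix (Fin 5) (Fin 5) ℂ}

/-- Symmetrization of a frame with respect to complex conjugation. -/
def symmFrame (F : ℂ → Matrix (Fin 5) (Fin 5) ℂ) (x : ℂ) : Matrix (Fin 5) (Fin 5) ℂ :=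
  (1 / 2 : ℂ) • (F x + (F x).map (starRingEnd ℂ) * swapMat)

theorem map_conj_mul (A B : Matrix (Fin 5) (Fin 5) ℂ) :
    (A * B).map (starRingEnd ℂ) = A.map (starRingEnd ℂ) * B.map (starRingEnd ℂ) :=
  Matrix.map_mul

theorem swapMat_map_conj : swapMat.map (starRingEnd ℂ) = swapMat := by
  ext i j
  fin_cases i <;> fin_cases j <;> simp [swapMat]

theorem map_conj_map_conj (A : Matrix (Fin 5) (Fin 5) ℂ) :
    (A.map (starRingEnd ℂ)).map (starRingEnd ℂ) = A := by
  ext i j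
  simp

theorem symmFrame_conj (F : ℂ → Matrix (Fin 5) (Fin 5) ℂ) (x : ℂ) :
    (symmFrame F x).map (starRingEnd ℂ) * swapMat = symmFrame F x := by
  have h : (symmFrame F x).map (starRingEnd ℂ)
      = (1 / 2 : ℂ) • ((F x).map (starRingEnd ℂ) + F x * swapMat) := by
    rw [symmFrame, Matrix.map_smulₛₗ _ (starRingEnd ℂ) _ (fun a => by simp),
      Matrix.map_add _ (map_add _), map_conj_mul, map_conj_map_conj, swapMat_map_conj]
    simp [map_ofNat]
  rw [h, symmFrame, Matrix.smul_mul, Matrix.add_mul, Matrix.mul_assoc, swapMat_mul_self,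
    Matrix.mul_one, add_comm]

theorem symmFrame_apply (F : ℂ → Matrix (Fin 5) (Fin 5) ℂ) (x : ℂ) (i j : Fin 5) :
    symmFrame F x i j = (1 / 2 : ℂ) * (F x i j
      + ((F x).map (starRingEnd ℂ) * swapMat) i j) := rfl

theorem contDiffOn_symmFrame (h : ∀ i j, ContDiffOn ℝ ∞ (fun x => F x i j) U) (i j : Fin 5) :
    ContDiffOn ℝ ∞ (fun x => symmFrame F x i j) U := by
  simp only [symmFrame_apply, Matrix.mul_apply, Fin.sum_univ_five, Matrix.map_apply]
  have := fun i j => contDiffOn_conj (h i j)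
  have h' := h i j
  have h0 := this i 0
  have h1 := this i 1
  have h2 := this i 2
  have h3 := this i 3
  have h4 := this i 4
  fun_prop

/-- Conjugating and swapping columns maps solutions to solutions, and the system is linear, so the
average is again a solution. This makes the frame real everywhere. -/
theorem IsParallelFrame.symmFrame (h : IsParallelFrame κ c F U) :
    IsParallelFrame κ c (symmFrame F) U := by
  have hc : ∀ w ∈ U, ∀ i j, DifferentiableAt ℝ (fun x => (F x).map (starRingEnd ℂ) i j) w :=
    fun w hw i j => (Complex.conjCLE : ℂ →L[ℝ] ℂ).differentiableAt.comp w (h.differentiableAt w hw i j)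
  have hs : ∀ w : ℂ, ∀ i j, DifferentiableAt ℝ (fun _ : ℂ => swapMat i j) w :=
    fun w i j => differentiableAt_const _
  have hm := fun w hw => differentiableAt_matrix_mul (hc w hw) (hs w)
  have hd : ∀ w ∈ U, ∀ i j, DifferentiableAt ℝ (fun x => F x i j
      + ((F x).map (starRingEnd ℂ) * swapMat) i j) w := fun w hw i j =>
    (h.differentiableAt w hw i j).add (hm w hw i j)
  refine ⟨fun w hw i j => (hd w hw i j).const_mul (1 / 2), fun w hw => ?_, fun w hw => ?_⟩
  · have e1 : dzMat (ConformalSurface.symmFrame F) w = (1 / 2 : ℂ) • (dzMat F w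
        + dzMat (fun x => (F x).map (starRingEnd ℂ) * swapMat) w) := by
      ext i j
      simp only [dzMat, symmFrame_apply, Matrix.smul_apply, Matrix.add_apply, smul_eq_mul]
      rw [dz_mul (differentiableAt_const _) (hd w hw i j), dz_const,
        dz_add (h.differentiableAt w hw i j) (hm w hw i j)]
      ring
    have e2 : dzMat (fun x => (F x).map (starRingEnd ℂ)) w
        = (dzbarMat F w).map (starRingEnd ℂ) := by
      ext i j
      exact dz_conj _ _
    rw [e1, dzMat_mul (hc w hw) (hs w), dzMat_const, Matrix.mul_zero, add_zero, e2,
      h.dz_eq w hw, h.dzbar_eq w hw, map_conj_mul, Matrix.mul_assoc, connMatBar_map_conj,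
      ConformalSurface.symmFrame, Matrix.smul_mul, Matrix.add_mul, Matrix.mul_assoc]
  · have e1 : dzbarMat (ConformalSurface.symmFrame F) w = (1 / 2 : ℂ) • (dzbarMat F w
        + dzbarMat (fun x => (F x).map (starRingEnd ℂ) * swapMat) w) := by
      ext i j
      simp only [dzbarMat, symmFrame_apply, Matrix.smul_apply, Matrix.add_apply, smul_eq_mul]
      rw [dzbar_mul (differentiableAt_const _) (hd w hw i j), dzbar_const,
        dzbar_add (h.differentiableAt w hw i j) (hm w hw i j)]
      ring
    have e2 : dzbarMat (fun x => (F x).map (starRingEnd ℂ)) w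
        = (dzMat F w).map (starRingEnd ℂ) := by
      ext i j
      exact dzbar_conj _ _
    rw [e1, dzbarMat_mul (hc w hw) (hs w), dzbarMat_const, Matrix.mul_zero, add_zero, e2,
      h.dz_eq w hw, h.dzbar_eq w hw, map_conj_mul, Matrix.mul_assoc, connMat_map_conj,
      ConformalSurface.symmFrame, Matrix.smul_mul, Matrix.add_mul, Matrix.mul_assoc]

/-- The columns of a real parallel frame with the right Gram matrix are a normalized lift and its
unit normal. -/
theorem IsParallelFrame.isNormalizedLift (hU : IsOpen U) (h : IsParallelFrame κ c F U)
    (hs : ∀ i j, ContDiffOn ℝ ∞ (fun x => F x i j) U)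
    (hreal : ∀ x, (F x).map (starRingEnd ℂ) * swapMat = F x)
    (hgram : ∀ x ∈ U, (F x)ᵀ * minkMat * F x = gramMat) :
    IsNormalizedLift κ c (fun x i => F x i 0) (fun x i => F x i 4) U := by
  have hr : ∀ x i, conj (F x i 0) = F x i 0 ∧ conj (F x i 4) = F x i 4 := fun x i => by
    have h0 := congrFun (congrFun (hreal x) i) 0
    have h4 := congrFun (congrFun (hreal x) i) 4
    simp only [Matrix.mul_apply, Fin.sum_univ_five, Matrix.map_apply] at h0 h4
    simp [swapMat] at h0 h4
    exact ⟨h0, h4⟩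
  have dψ : ∀ x ∈ U, dzVec (fun x i => F x i 0) x = fun i => F x i 1 := fun x hx => by
    funext i
    have := congrFun (congrFun (h.dz_eq x hx) i) 0
    simp only [Matrix.mul_apply, Fin.sum_univ_five] at this
    simp [connMat] at this
    exact this
  have dbψ : ∀ x ∈ U, dzbarVec (fun x i => F x i 0) x = fun i => F x i 2 := fun x hx => by
    funext i
    have := congrFun (congrFun (h.dzbar_eq x hx) i) 0
    simp only [Matrix.mul_apply, Fin.sum_univ_five] at this
    simp [connMatBar] at this
    exact this
  have hg : ∀ x ∈ U, ∀ i j, mink (fun k => F x k i) (fun k => F x k j) = gramMat i j :=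
    fun x hx i j => by rw [← hgram x hx, transpose_minkMat_mul]
  refine ⟨contDiffOn_pi.2 fun i => hs i 0, contDiffOn_pi.2 fun i => hs i 4,
    fun x i => (hr x i).1, fun x i => (hr x i).2, fun x hx => ?_, fun x hx => ?_, fun x hx => ?_,
    fun x hx => ?_, fun x hx => ?_, fun x hx => ?_, fun x hx => ?_, fun x hx => ?_⟩
  · rw [hg x hx]; simp [gramMat]
  · rw [dψ x hx, hg x hx]; simp [gramMat]
  · rw [dψ x hx, dbψ x hx, hg x hx]; simp [gramMat]
  · rw [hg x hx]; simp [gramMat]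
  · rw [hg x hx]; simp [gramMat]
  · rw [dψ x hx, hg x hx]; simp [gramMat]
  · have e : dzVec (dzbarVec fun x i => F x i 0) x
        = (-(κ x * conj (κ x))) • (fun i => F x i 0) + (1 / 2 : ℂ) • fun i => F x i 3 := by
      rw [dzVec_congr (eventually_of_mem (hU.mem_nhds hx) dbψ)]
      funext i
      have := congrFun (congrFun (h.dz_eq x hx) i) 2
      simp only [Matrix.mul_apply, Fin.sum_univ_five] at this
      simp [connMat] at this
      refine Eq.trans this ?_
      simp
      ring
    rw [e, mink_add_right, mink_smul_right, mink_smul_right, hg x hx, hg x hx]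
    simp [gramMat]
  · have e : dzVec (dzVec fun x i => F x i 0) x
        = (-c x / 2) • (fun i => F x i 0) + κ x • fun i => F x i 4 := by
      rw [dzVec_congr (eventually_of_mem (hU.mem_nhds hx) dψ)]
      funext i
      have := congrFun (congrFun (h.dz_eq x hx) i) 1
      simp only [Matrix.mul_apply, Fin.sum_univ_five] at this
      simp [connMat] at this
      refine Eq.trans this ?_
      simp
      ring
    rw [e]
    module

/-- A frame of the complexified Minkowski space with the right Gram matrix. -/
def baseFrame : Matrix (Fin 5) (Fin 5) ℂ :=
  !![1, 0, 0, 1 / 2, 0; 1, 0, 0, -(1 / 2), 0; 0, 1 / 2, 1 / 2, 0, 0;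
    0, -(Complex.I / 2), Complex.I / 2, 0, 0; 0, 0, 0, 0, 1]

theorem baseFrame_gram : baseFrame * (gramInv * baseFrameᵀ) = minkMat := by
  ext i j
  fin_cases i <;> fin_cases j <;>
    simp only [Matrix.mul_apply, Fin.sum_univ_five, transpose_apply] <;>
    (simp [baseFrame, gramInv, minkMat, Matrix.diagonal]; try ring_nf) <;> simp [Complex.I_sq]

theorem baseFrame_conj : baseFrame.map (starRingEnd ℂ) * swapMat = baseFrame := by
  ext i j
  fin_cases i <;> fin_cases j <;>
    simp only [Matrix.mul_apply, Fin.sum_univ_five, Matrix.map_apply] <;>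
    simp [baseFrame, swapMat, map_ofNat, neg_div]

/-- The quantity conserved by the system is `F * gramInv * Fᵀ`; this converts it into the Gram
matrix, using that one-sided inverses of square matrices are two-sided. -/
theorem gram_of_mul_gramInv {F : Matrix (Fin 5) (Fin 5) ℂ} (h : F * (gramInv * Fᵀ) = minkMat) :
    Fᵀ * minkMat * F = gramMat := by
  have h1 : F * (gramInv * Fᵀ * minkMat) = 1 := by
    rw [← Matrix.mul_assoc, h, minkMat_mul_self]
  have h2 : gramInv * Fᵀ * minkMat * F = 1 := mul_eq_one_comm.1 h1
  have h3 : gramMat * gramInv = 1 := mul_eq_one_comm.1 gramInv_mul_gramMat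
  calc Fᵀ * minkMat * F = gramMat * gramInv * (Fᵀ * minkMat * F) := by rw [h3, Matrix.one_mul]
    _ = gramMat * (gramInv * Fᵀ * minkMat * F) := by simp only [Matrix.mul_assoc]
    _ = gramMat := by rw [h2, Matrix.mul_one]

/-- Solutions of the conformal Gauss and Codazzi equations are locally realized by surfaces. -/
theorem exists_isLocalSurface (hU : IsOpen U) (hκ : ContDiffOn ℝ ∞ κ U) (hc : ContDiffOn ℝ ∞ c U)
    (gauss : ∀ w ∈ U, (1 / 2 : ℂ) * dzbar c w
      = 3 * dz (fun x => conj (κ x)) w * κ w + conj (κ w) * dz κ w)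
    (codazzi : ∀ w ∈ U, (dzbar (dzbar κ) w + (1 / 2 : ℂ) * conj (c w) * κ w).im = 0)
    {w₀ : ℂ} (hw₀ : w₀ ∈ U) :
    ∃ V ⊆ U, IsOpen V ∧ w₀ ∈ V ∧ ∃ g N, IsLocalSurface κ c g N V := by
  obtain ⟨V, hVU, hV, hw, F, hF0, hF, hFs⟩ :=
    exists_isParallelFrame hU hκ hc gauss codazzi hw₀ baseFrame
  set G := symmFrame F with hG
  have hGp : IsParallelFrame κ c G V := hF.symmFrame
  have hGs := contDiffOn_symmFrame hFs
  -- The initial frame already satisfies the reality condition, so averaging leaves it unchanged.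
  have hG0 : G w₀ = baseFrame := by
    rw [hG, symmFrame, hF0, baseFrame_conj, ← two_smul ℂ, smul_smul]
    norm_num
  have hgram : ∀ᶠ x in 𝓝 w₀, (G x)ᵀ * minkMat * G x = gramMat := by
    -- Comparing the solution with itself shows that `G * gramInv * Gᵀ` keeps its initial value.
    filter_upwards [hGp.mul_eq_of_eventually hV hGp hw] with x hx
    rw [hG0, baseFrame_gram] at hx
    exact gram_of_mul_gramInv hx
  -- The initial null vector lies on the forward cone, so nearby ones do too and are positive
  -- multiples of vectors `(1, y)` with `y` in the sphere.
  have hpos : ∀ᶠ x in 𝓝 w₀, 0 < (G x 0 0).re := by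
    have h1 : ContinuousAt (fun x => (G x 0 0).re) w₀ := by
      have := (hGs 0 0).continuousOn.continuousAt (hV.mem_nhds hw)
      exact Complex.continuous_re.continuousAt.comp this
    refine h1.eventually_const_lt ?_
    simp [hG0, baseFrame]
  obtain ⟨W, hW, hWo, hwW⟩ := eventually_nhds_iff.1 ((hgram.and hpos).and (hV.mem_nhds hw))
  have hWV : W ⊆ V := fun x hx => (hW x hx).2
  have hl : IsNormalizedLift κ c (fun x i => G x i 0) (fun x i => G x i 4) W :=
    IsParallelFrame.isNormalizedLift hWo
      ⟨fun w hw => hGp.differentiableAt w (hWV hw), fun w hw => hGp.dz_eq w (hWV hw),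
        fun w hw => hGp.dzbar_eq w (hWV hw)⟩ (fun i j => (hGs i j).mono hWV) (symmFrame_conj F)
      fun x hx => (hW x hx).1.1
  have hn : (fun x i => G x i 4) = fun x => ofRealVec fun i => (G x i 4).re := by
    funext x i
    exact (Complex.conj_eq_iff_re.1 (hl.real_normal x i)).symm
  have hψ : ∀ x, (fun i => G x i 0) = ofRealVec fun i => (G x i 0).re := fun x => by
    funext i
    exact (Complex.conj_eq_iff_re.1 (hl.real x i)).symm
  have hy : ∀ x ∈ W, ∃ y : S3, (fun i => (G x i 0).re) = (G x 0 0).re • coneLift y :=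
    fun x hx => by
      refine exists_smul_coneLift ?_ (hW x hx).1.2.ne'
      apply Complex.ofReal_injective
      rw [← mink_ofRealVec, ← hψ]
      simpa using hl.null x hx
  have : Nonempty S3 := ⟨⟨EuclideanSpace.single 0 1, by simp⟩⟩
  choose! g hg using hy
  rw [hn] at hl
  refine ⟨W, hWV.trans hVU, hWo, hwW, g, _, (isLocalSurface_of_normalizedLift hWo hl
    (fun x hx => (hW x hx).1.2) fun x hx => ?_).1⟩
  rw [hψ, hg x hx]
  funext i
  simp [surfLift, ofRealVec]

end SurfaceExistence

/-! ### Locally constant cocycles on simply connected spaces -/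

section Cocycle

open Filter Topology

/-- On a simply connected space every locally constant cocycle is a coboundary. -/
theorem exists_trivialization_of_cocycle {X ι G : Type*} [TopologicalSpace X]
    [SimplyConnectedSpace X] [LocallyPathConnectedSpace X] [Group G] (W : ι → Set X)
    (hW : ∀ i, IsOpen (W i)) (hcov : ∀ x, ∃ i, x ∈ W i) (a : ι → ι → X → G)
    (hloc : ∀ i j, ∀ x ∈ W i ∩ W j, ∀ᶠ y in 𝓝 x, a i j y = a i j x)
    (hcoc : ∀ i j k, ∀ x ∈ W i ∩ W j ∩ W k, a i j x * a j k x = a i k x) :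
    ∃ b : ι → X → G, (∀ i, ∀ x ∈ W i, ∀ᶠ y in 𝓝 x, b i y = b i x) ∧
      ∀ i j, ∀ x ∈ W i ∩ W j, b j x = b i x * a i j x := by
  choose idx hidx using hcov
  let : TopologicalSpace G := ⊥
  have : DiscreteTopology G := ⟨rfl⟩
  have hself : ∀ i, ∀ x ∈ W i, a i i x = 1 := fun i x hx =>
    mul_eq_left.1 (hcoc i i i x ⟨⟨hx, hx⟩, hx⟩)
  -- With the discrete topology on the group, the cocycle glues the products `W i × G` by right
  -- multiplication to a bundle with discrete fibres. Its total space is a covering of `X`.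
  let Z : FiberBundleCore ι X G :=
    { baseSet := W
      isOpen_baseSet := hW
      indexAt := idx
      mem_baseSet_at := hidx
      coordChange := fun i j x g => g * a i j x
      coordChange_self := fun i x hx v => by rw [hself i x hx, mul_one]
      continuousOn_coordChange := fun i j => by
        rintro ⟨x, g⟩ ⟨hx, _⟩
        refine ContinuousAt.continuousWithinAt ?_
        refine (continuousAt_const (y := g * a i j x)).congr ?_
        have h1 : ∀ᶠ p : X × G in 𝓝 (x, g), a i j p.1 = a i j x :=
          (continuousAt_fst (p := (x, g))).eventually (hloc i j x hx)
        have h2 : ∀ᶠ p : X × G in 𝓝 (x, g), p.2 = g :=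
          (continuousAt_snd (p := (x, g))).eventually (p := fun z => z = g)
            (by rw [nhds_discrete]; exact eventually_pure.2 rfl)
        filter_upwards [h1, h2] with p hp1 hp2
        rw [hp1, hp2]
      coordChange_comp := fun i j k x hx v => by rw [mul_assoc, hcoc i j k x hx] }
  have hdisc : ∀ x, DiscreteTopology (Z.Fiber x) := fun _ => inferInstanceAs (DiscreteTopology G)
  have hcovmap : IsCoveringMap (Bundle.TotalSpace.proj : Bundle.TotalSpace G Z.Fiber → X) :=
    FiberBundle.isCoveringMap
  obtain ⟨x₀⟩ : Nonempty X := inferInstance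
  -- Simple connectedness is used here: the identity lifts to a global section, whose expressions in
  -- the local trivializations are the functions `b i`. Continuity into a discrete fibre makes them
  -- locally constant.
  obtain ⟨s, ⟨_, hs⟩, _⟩ := hcovmap.existsUnique_continuousMap_lifts (ContinuousMap.id X) x₀
    ⟨x₀, (1 : G)⟩ rfl
  have hs' : ∀ x, (s x).proj = x := fun x => congrFun hs x
  let v : X → G := fun x => (s x).2
  have hb : ∀ i x, (Z.localTriv i (s x)).2 = v x * a (idx x) i x := fun i x => by
    rw [Z.localTriv_apply]
    change v x * a (idx (s x).proj) i (s x).proj = _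
    rw [hs']
  refine ⟨fun i x => (Z.localTriv i (s x)).2, fun i x hx => ?_, fun i j x hx => ?_⟩
  · have h1 : s x ∈ (Z.localTriv i).source := by
      rw [Z.mem_localTriv_source, hs']
      exact hx
    have h2 : ContinuousAt (fun y => (Z.localTriv i (s y)).2) x :=
      continuousAt_snd.comp (((Z.localTriv i).continuousAt h1).comp s.continuous.continuousAt)
    have h3 := h2.tendsto
    rw [nhds_discrete G] at h3
    exact tendsto_pure.1 h3
  · simp only [hb]
    rw [mul_assoc, hcoc _ _ _ x ⟨⟨hidx x, hx.1⟩, hx.2⟩]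

end Cocycle

/-! ### Lorentz transformations of local surfaces -/

section LorentzSurface

open Filter Topology Matrix

variable {κ c : ℂ → ℂ} {g g' : ℂ → S3} {N N' : ℂ → Fin 5 → ℝ} {U : Set ℂ}

/-- Lorentz transformations of local surfaces. -/
theorem IsLocalSurface.lorentz (hU : IsOpen U) (h : IsLocalSurface κ c g N U)
    (A : orthochronousGroup) :
    IsLocalSurface κ c (fun x => lorentzAct A (g x)) (fun x => A (N x)) U ∧
      ∀ x ∈ U, surfNormLift (fun x => lorentzAct A (g x)) x
        = complexMat (A : (Fin 5 → ℝ) ≃ₗ[ℝ] (Fin 5 → ℝ)) *ᵥ surfNormLift g x := by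
  have h1 := (h.toNormalizedLift hU).lorentz hU A.2.1
  have e : (fun x => complexMat (A : (Fin 5 → ℝ) ≃ₗ[ℝ] (Fin 5 → ℝ)) *ᵥ ofRealVec (N x))
      = fun x => ofRealVec (A (N x)) := funext fun x => complexMat_mulVec _ _
  rw [e] at h1
  refine isLocalSurface_of_normalizedLift hU h1
    (r := fun x => ‖fderiv ℝ (fun x => (g x : E4)) x 1‖⁻¹ * A (coneLift (g x)) 0)
    (fun x hx => mul_pos (inv_pos.2 (conformalAt_iff.1 (h.conformalAt x hx)).1) (A.2.2 _))
    fun x hx => ?_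
  rw [surfNormLift_eq, mulVec_smul, surfLift]
  erw [complexMat_mulVec]
  change _ • ofRealVec (A (coneLift (g x))) = _
  rw [lorentz_coneLift]
  funext i
  simp only [surfLift, ofRealVec, Pi.smul_apply, smul_eq_mul, Complex.ofReal_mul, mul_assoc,
    coneLift_zero, Complex.ofReal_one, one_mul]

/-- Two local surfaces with the same invariants differ by an orthochronous Lorentz
transformation. -/
theorem IsLocalSurface.exists_lorentz (hU : IsOpen U) (h : IsLocalSurface κ c g N U)
    (h' : IsLocalSurface κ c g' N' U) {w : ℂ} (hw : w ∈ U) :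
    ∃ A : orthochronousGroup, ∀ᶠ x in 𝓝 w, lorentzAct A (g x) = g' x ∧ A (N x) = N' x := by
  obtain ⟨A, hA, hev⟩ :=
    (h.toNormalizedLift hU).exists_lorentz hU (h'.toNormalizedLift hU) hw
  have hpos : ∀ {g : ℂ → S3} {N : ℂ → Fin 5 → ℝ}, IsLocalSurface κ c g N U → ∀ x ∈ U,
      0 < ‖fderiv ℝ (fun x => (g x : E4)) x 1‖ := fun h x hx =>
    (conformalAt_iff.1 (h.conformalAt x hx)).1
  have key : ∀ x ∈ U, complexMat (A : (Fin 5 → ℝ) →ₗ[ℝ] (Fin 5 → ℝ)) *ᵥ surfNormLift g x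
      = surfNormLift g' x → A (coneLift (g x)) = (‖fderiv ℝ (fun x => (g x : E4)) x 1‖
        * ‖fderiv ℝ (fun x => (g' x : E4)) x 1‖⁻¹) • coneLift (g' x) := by
    intro x hx hxe
    rw [surfNormLift_eq, surfNormLift_eq, mulVec_smul, surfLift, surfLift, complexMat_mulVec] at hxe
    have hne := (hpos h x hx).ne'
    have hxe' : ‖fderiv ℝ (fun x => (g x : E4)) x 1‖⁻¹ • A (coneLift (g x))
        = ‖fderiv ℝ (fun x => (g' x : E4)) x 1‖⁻¹ • coneLift (g' x) := by
      apply ofRealVec_injective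
      funext i
      have := congrFun hxe i
      simpa [ofRealVec] using this
    rw [mul_smul, ← hxe', smul_smul, mul_inv_cancel₀ hne, one_smul]
  -- At `w` the transformation takes one positive multiple of a forward null vector to another,
  -- which is enough for it to be orthochronous.
  have h0 : 0 < A (coneLift (g w)) 0 := by
    rw [key w hw hev.self_of_nhds.1]
    simpa [coneLift_zero] using mul_pos (hpos h w hw) (inv_pos.2 (hpos h' w hw))
  refine ⟨⟨A, hA, hA.pos_of_pos h0⟩, ?_⟩
  filter_upwards [hev, hU.mem_nhds hw] with x hx hxU
  exact ⟨lorentzAct_eq (key x hxU hx.1), ofRealVec_injective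
    ((complexMat_mulVec _ _).symm.trans hx.2)⟩

/-- Equality on the surface gives equality on normalized lifts, on which the transformations act
linearly, and these with the normal determine the matrix. The normal is needed: inversion in a round
2-sphere fixes every surface inside it. -/
theorem IsLocalSurface.lorentz_unique (hU : IsOpen U) (h : IsLocalSurface κ c g N U)
    {A B : orthochronousGroup} {w : ℂ} (hw : w ∈ U)
    (hAB : ∀ᶠ x in 𝓝 w, lorentzAct A (g x) = lorentzAct B (g x) ∧ A (N x) = B (N x)) :
    A = B := by
  obtain ⟨V, hV, hVo, hwV⟩ := eventually_nhds_iff.1 (hAB.and (hU.mem_nhds hw))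
  have h' := h.mono (fun x hx => (hV x hx).2 : V ⊆ U)
  have e := (h'.toNormalizedLift hVo).matrix_unique hVo
    (M := complexMat (A : (Fin 5 → ℝ) ≃ₗ[ℝ] (Fin 5 → ℝ)))
    (M' := complexMat (B : (Fin 5 → ℝ) ≃ₗ[ℝ] (Fin 5 → ℝ))) (fun x hx => ?_) (fun x hx => ?_)
    ⟨w, hwV⟩
  · exact Subtype.ext (LinearEquiv.toLinearMap_injective (complexMat_injective e))
  · rw [← (h'.lorentz hVo A).2 x hx, ← (h'.lorentz hVo B).2 x hx]
    exact surfNormLift_congr hVo (fun y hy => (hV y hy).1.1) hx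
  · erw [complexMat_mulVec, complexMat_mulVec]
    exact congrArg ofRealVec (hV x hx).1.2

end LorentzSurface

/-! ### Surfaces near a point of a topological space -/

section Germs

open Filter Topology

variable {X : Type*} [TopologicalSpace X] {κ c κ' c' : ℂ → ℂ} {f f₁ f₂ f₃ : X → S3}
  {n n₁ n₂ n₃ : X → Fin 5 → ℝ} {e e' : OpenPartialHomeomorph X ℂ} {x : X} {A B : orthochronousGroup}

/-- Near `x` the map `f₂` and the normal `n₂` are the images of `f₁` and `n₁` under `A`. -/
def Intertwines (A : orthochronousGroup) (f₁ : X → S3) (n₁ : X → Fin 5 → ℝ) (f₂ : X → S3)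
    (n₂ : X → Fin 5 → ℝ) (x : X) : Prop :=
  ∀ᶠ y in 𝓝 x, lorentzAct A (f₁ y) = f₂ y ∧ A (n₁ y) = n₂ y

theorem Intertwines.eventually (h : Intertwines A f₁ n₁ f₂ n₂ x) :
    ∀ᶠ y in 𝓝 x, Intertwines A f₁ n₁ f₂ n₂ y := eventually_eventually_nhds.2 h

theorem Intertwines.trans (h : Intertwines A f₁ n₁ f₂ n₂ x) (h' : Intertwines B f₂ n₂ f₃ n₃ x) :
    Intertwines (B * A) f₁ n₁ f₃ n₃ x := by
  filter_upwards [h, h'] with y hy hy'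
  refine ⟨by rw [lorentzAct_mul, hy.1, hy'.1], ?_⟩
  rw [Subgroup.coe_mul, LinearEquiv.mul_apply, hy.2, hy'.2]

/-- In the coordinate `e` the map `f` with the normal `n` is near `x` a surface with invariants
`κ` and `c`. -/
def IsSurfaceAt (e : OpenPartialHomeomorph X ℂ) (κ c : ℂ → ℂ) (f : X → S3) (n : X → Fin 5 → ℝ)
    (x : X) : Prop :=
  x ∈ e.source ∧ ∃ V ⊆ e.target, IsOpen V ∧ e x ∈ V ∧
    IsLocalSurface κ c (fun w => f (e.symm w)) (fun w => n (e.symm w)) V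

theorem eventually_symm (hx : x ∈ e.source) {p : X → Prop} (h : ∀ᶠ y in 𝓝 x, p y) :
    ∀ᶠ w in 𝓝 (e x), p (e.symm w) := by
  have := e.continuousAt_symm (e.map_source hx)
  rw [ContinuousAt, e.left_inv hx] at this
  exact this.eventually h

theorem eventually_of_symm (hx : x ∈ e.source) {p : X → Prop}
    (h : ∀ᶠ w in 𝓝 (e x), p (e.symm w)) : ∀ᶠ y in 𝓝 x, p y := by
  filter_upwards [(e.continuousAt hx).eventually h, e.open_source.mem_nhds hx] with y hy hys
  rwa [e.left_inv hys] at hy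

theorem IsSurfaceAt.exists_intertwines (h₁ : IsSurfaceAt e κ c f₁ n₁ x)
    (h₂ : IsSurfaceAt e κ c f₂ n₂ x) : ∃ A, Intertwines A f₁ n₁ f₂ n₂ x := by
  obtain ⟨hx, V₁, _, hV₁, hxV₁, hs₁⟩ := h₁
  obtain ⟨_, V₂, _, hV₂, hxV₂, hs₂⟩ := h₂
  obtain ⟨A, hA⟩ := (hs₁.mono Set.inter_subset_left).exists_lorentz (hV₁.inter hV₂)
    (hs₂.mono Set.inter_subset_right) ⟨hxV₁, hxV₂⟩
  exact ⟨A, eventually_of_symm (p := fun y => lorentzAct A (f₁ y) = f₂ y ∧ A (n₁ y) = n₂ y) hx hA⟩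

theorem IsSurfaceAt.intertwines_unique (h : IsSurfaceAt e κ c f₁ n₁ x)
    (hA : Intertwines A f₁ n₁ f₂ n₂ x) (hB : Intertwines B f₁ n₁ f₂ n₂ x) : A = B := by
  obtain ⟨hx, V, _, hV, hxV, hs⟩ := h
  refine hs.lorentz_unique hV hxV ?_
  filter_upwards [eventually_symm hx hA, eventually_symm hx hB] with w h1 h2
  exact ⟨h1.1.trans h2.1.symm, h1.2.trans h2.2.symm⟩

/-- The invariants do not change under Lorentz transformations; this lets pieces be moved before
gluing. -/
theorem IsSurfaceAt.of_intertwines (h : IsSurfaceAt e κ c f₁ n₁ x)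
    (hA : Intertwines A f₁ n₁ f₂ n₂ x) : IsSurfaceAt e κ c f₂ n₂ x := by
  obtain ⟨hx, V, hVe, hV, hxV, hs⟩ := h
  obtain ⟨W, hW, hWo, hxW⟩ := eventually_nhds_iff.1 ((eventually_symm hx hA).and (hV.mem_nhds hxV))
  refine ⟨hx, W, fun w hw => hVe (hW w hw).2, hWo, hxW, ?_⟩
  exact ((hs.mono fun w hw => (hW w hw).2).lorentz hWo A).1.congr hWo
    (fun w hw => (hW w hw).1.1.symm) (fun w hw => (hW w hw).1.2.symm) (fun _ _ => rfl)
    fun _ _ => rfl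

/-- Change of coordinates for surfaces. -/
theorem IsSurfaceAt.change_coord (h : IsSurfaceAt e κ c f n x) (hx' : x ∈ e'.source) {V : Set ℂ}
    (hV : IsOpen V) (hxV : e' x ∈ V) {t : ℂ → ℂ} (hte : ∀ w ∈ V, e (e'.symm w) = t w)
    (ht : DifferentiableOn ℂ t V) (ht' : ∀ w ∈ V, deriv t w ≠ 0)
    (hκ : ∀ w ∈ V, κ' w = κ (t w) * (deriv t w ^ 2 / (‖deriv t w‖ : ℂ)))
    (hc : ∀ w ∈ V, c' w = c (t w) * deriv t w ^ 2 + classicalSchwarzian t w) :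
    IsSurfaceAt e' κ' c' f n x := by
  obtain ⟨hx, U, hUe, hU, hxU, hs⟩ := h
  have h1 : ∀ᶠ y in 𝓝 x, y ∈ e.source ∧ e y ∈ U :=
    (e.open_source.eventually_mem hx).and ((e.continuousAt hx).eventually (hU.mem_nhds hxU))
  obtain ⟨W, hW, hWo, hxW⟩ := eventually_nhds_iff.1 ((eventually_symm hx' h1).and
    ((hV.eventually_mem hxV).and
      (e'.open_target.eventually_mem (e'.map_source hx'))))
  have hWV : W ⊆ V := fun w hw => (hW w hw).2.1
  refine ⟨hx', W, fun w hw => (hW w hw).2.2, hWo, hxW, ?_⟩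
  have h2 := (hs.comp_holomorphic (t := t) hU hWo (ht.mono hWV) (fun w hw => ht' w (hWV hw))
    (fun w hw => by rw [← hte w (hWV hw)]; exact (hW w hw).1.2)
    (fun w hw => hκ w (hWV hw)) fun w hw => hc w (hWV hw)).1
  have h3 : ∀ w ∈ W, e'.symm w = e.symm (t w) := fun w hw => by
    rw [← hte w (hWV hw), e.left_inv (hW w hw).1.1]
  exact h2.congr hWo (fun w hw => by rw [h3 w hw]) (fun w hw => by rw [h3 w hw])
    (fun _ _ => rfl) fun _ _ => rfl

/-- Maps of a connected space which are near each point surfaces with the same invariants differ by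
a unique Lorentz transformation. -/
theorem exists_lorentz_of_isSurfaceAt [ConnectedSpace X]
    (h : ∀ x, ∃ e κ c, IsSurfaceAt e κ c f₁ n₁ x ∧ IsSurfaceAt e κ c f₂ n₂ x) :
    ∃! A : orthochronousGroup, ∀ x, lorentzAct A (f₁ x) = f₂ x ∧ A (n₁ x) = n₂ x := by
  choose e κ c h₁ h₂ using h
  choose A hA using fun x => (h₁ x).exists_intertwines (h₂ x)
  -- The transformation found at `x` still matches the surfaces at nearby points, where uniqueness
  -- identifies it with the one chosen there.
  have hl : IsLocallyConstant A := (IsLocallyConstant.iff_eventually_eq A).2 fun x => by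
    filter_upwards [(hA x).eventually] with y hy
    exact (h₁ y).intertwines_unique (hA y) hy
  obtain ⟨x₀⟩ : Nonempty X := inferInstance
  refine ⟨A x₀, fun x => ?_, fun B hB => ?_⟩
  · rw [hl.apply_eq_of_preconnectedSpace x₀ x]
    exact (hA x).self_of_nhds
  · exact (h₁ x₀).intertwines_unique (Eventually.of_forall hB) (hA x₀)

end Germs

/-! ### Holomorphic coordinates -/

section Coordinates

open Filter Topology

/-- An injective holomorphic function has no critical points. -/
theorem deriv_ne_zero_of_openPartialHomeomorph (φ : OpenPartialHomeomorph ℂ ℂ)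
    (h : DifferentiableOn ℂ φ φ.source) {w : ℂ} (hw : w ∈ φ.source) : deriv φ w ≠ 0 := by
  have han : AnalyticAt ℂ (deriv φ) w :=
    ((h.deriv φ.open_source).analyticAt (φ.open_source.mem_nhds hw))
  -- Otherwise the derivative would vanish near `w`, making the map locally constant and hence not
  -- injective.
  have hne : ∀ᶠ x in 𝓝[≠] w, deriv φ x ≠ 0 := by
    refine han.eventually_eq_zero_or_eventually_ne_zero.resolve_left fun h0 => ?_
    obtain ⟨r, hr, hrs⟩ := Metric.eventually_nhds_iff_ball.1
      (h0.and (φ.open_source.mem_nhds hw))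
    have hconst : ∀ x ∈ Metric.ball w r, φ x = φ w := fun x hx =>
      Metric.isOpen_ball.is_const_of_deriv_eq_zero (convex_ball w r).isPreconnected
        (h.mono fun y hy => (hrs y hy).2) (fun y hy => (hrs y hy).1) hx (Metric.mem_ball_self hr)
    have h1 : ∀ᶠ x in 𝓝[≠] w, False := by
      filter_upwards [nhdsWithin_le_nhds (Metric.ball_mem_nhds w hr), self_mem_nhdsWithin]
        with x hx hxw
      exact hxw (φ.injOn (hrs x hx).2 hw (hconst x hx))
    exact h1.exists.elim fun _ => id
  -- The inverse is holomorphic on a punctured neighbourhood and continuous at the centre, so the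
  -- singularity is removable. The chain rule for `φ.symm ∘ φ` then excludes a zero of the
  -- derivative.
  have hs : AnalyticAt ℂ φ.symm (φ w) := by
    refine Complex.analyticAt_of_differentiable_on_punctured_nhds_of_continuousAt ?_
      (φ.continuousAt_symm (φ.map_source hw))
    have h1 : Tendsto φ.symm (𝓝[≠] (φ w)) (𝓝[≠] w) := by
      refine tendsto_nhdsWithin_iff.2 ⟨?_, ?_⟩
      · have := (φ.continuousAt_symm (φ.map_source hw)).tendsto
        rw [φ.left_inv hw] at this
        exact this.mono_left nhdsWithin_le_nhds
      · filter_upwards [nhdsWithin_le_nhds (φ.open_target.mem_nhds (φ.map_source hw)),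
          self_mem_nhdsWithin] with y hy hyw hyw'
        refine hyw ?_
        rw [Set.mem_singleton_iff] at hyw' ⊢
        rw [← φ.right_inv hy, hyw']
    filter_upwards [h1.eventually hne,
      nhdsWithin_le_nhds (φ.open_target.mem_nhds (φ.map_source hw))] with y hy hyt
    exact (φ.hasDerivAt_symm hyt hy
      (h.differentiableAt (φ.open_source.mem_nhds (φ.map_target hyt))).hasDerivAt).differentiableAt
  have hcomp := hs.differentiableAt.hasDerivAt.comp w
    (h.differentiableAt (φ.open_source.mem_nhds hw)).hasDerivAt
  have hid : HasDerivAt (φ.symm ∘ φ) 1 w :=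
    (hasDerivAt_id w).congr_of_eventuallyEq
      (eventually_of_mem (φ.open_source.mem_nhds hw) fun x hx => φ.left_inv hx)
  exact right_ne_zero_of_mul_eq_one (hcomp.unique hid)

variable {M M' : Type*} [TopologicalSpace M] [ChartedSpace ℂ M] [TopologicalSpace M']
  [ChartedSpace ℂ M']

theorem differentiableAt_inCoordinates {z : OpenPartialHomeomorph M ℂ}
    {z' : OpenPartialHomeomorph M' ℂ} (hz : z ∈ holomorphicCoordinates M)
    (hz' : z' ∈ holomorphicCoordinates M') {π : M' → M} (hπ : MDifferentiable 𝓘(ℂ) 𝓘(ℂ) π) {w : ℂ}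
    (hw : w ∈ z'.target) (hwz : π (z'.symm w) ∈ z.source) :
    DifferentiableAt ℂ (fun w => z (π (z'.symm w))) w := by
  have h1 := (contMDiffOn_symm_of_mem_maximalAtlas hz').mdifferentiableOn (by simp) w hw
  have h2 := (contMDiffOn_of_mem_maximalAtlas hz).mdifferentiableOn (by simp) _ hwz
  have h1' := h1.mdifferentiableAt (z'.open_target.mem_nhds hw)
  have h2' := h2.mdifferentiableAt (z.open_source.mem_nhds hwz)
  have h3 : MDifferentiableAt 𝓘(ℂ) 𝓘(ℂ) (z ∘ π ∘ z'.symm) w :=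
    h2'.comp w ((hπ _).comp w h1')
  exact mdifferentiableAt_iff_differentiableAt.1 h3

theorem differentiableOn_transition {z z' : OpenPartialHomeomorph M ℂ}
    (hz : z ∈ holomorphicCoordinates M) (hz' : z' ∈ holomorphicCoordinates M) :
    DifferentiableOn ℂ (z'.symm.trans z) (z'.symm.trans z).source := fun _ hw =>
  (differentiableAt_inCoordinates hz hz' (π := id) mdifferentiable_id hw.1
    hw.2).differentiableWithinAt

end Coordinates

/-! ### Surfaces and conformal immersions -/

section Immersions

open Filter Topology

variable {M : Type*} [TopologicalSpace M] {f : M → S3} {n : M → Fin 5 → ℝ}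

theorem hasHopfSchwarzian_of_isSurfaceAt {z : OpenPartialHomeomorph M ℂ} {κ c : ℂ → ℂ}
    (h : ∀ x ∈ z.source, IsSurfaceAt z κ c f n x) : HasHopfSchwarzian f n z κ c := fun w hw => by
  obtain ⟨_, V, _, hV, hwV, hs⟩ := h _ (z.map_target hw)
  rw [z.right_inv hw] at hwV
  exact hs.hill w hwV

variable [ChartedSpace ℂ M]

theorem isSurfaceAt_of_isConformalImmersion (hf : IsConformalImmersion f) (hn : IsUnitNormal f n)
    {z : OpenPartialHomeomorph M ℂ} (hz : z ∈ holomorphicCoordinates M) {κ c : ℂ → ℂ}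
    (h : HasHopfSchwarzian f n z κ c) {x : M} (hx : x ∈ z.source) : IsSurfaceAt z κ c f n x :=
  ⟨hx, z.target, subset_rfl, z.open_target, z.map_source hx, (hf z hz).1, (hf z hz).2,
    (hn.2 z hz).1, fun _ _ => hn.1 _, (hn.2 z hz).2, h⟩

theorem isConformalImmersion_of_isSurfaceAt (h : ∀ z ∈ holomorphicCoordinates M, ∀ x ∈ z.source,
    ∃ κ c, IsSurfaceAt z κ c f n x) : IsConformalImmersion f := by
  have key : ∀ z ∈ holomorphicCoordinates M, ∀ w ∈ z.target,
      ContDiffAt ℝ ∞ (inCoord f z) w ∧ ConformalAt (inCoord f z) w := fun z hz w hw => by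
    obtain ⟨κ, c, _, V, _, hV, hwV, hs⟩ := h z hz _ (z.map_target hw)
    rw [z.right_inv hw] at hwV
    exact ⟨hs.smooth.contDiffAt (hV.mem_nhds hwV), hs.conformalAt w hwV⟩
  exact fun z hz => ⟨fun w hw => (key z hz w hw).1.contDiffWithinAt, fun w hw => (key z hz w hw).2⟩

theorem isUnitNormal_of_isSurfaceAt [IsManifold 𝓘(ℂ) ω M]
    (h : ∀ z ∈ holomorphicCoordinates M, ∀ x ∈ z.source, ∃ κ c, IsSurfaceAt z κ c f n x) :
    IsUnitNormal f n := by
  have key : ∀ z ∈ holomorphicCoordinates M, ∀ w ∈ z.target,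
      ContDiffAt ℝ ∞ (fun w => n (z.symm w)) w ∧ mink (n (z.symm w)) (n (z.symm w)) = 1 ∧
        ∀ v ∈ centralSphere f z w, mink (fun i => (n (z.symm w) i : ℂ)) v = 0 :=
    fun z hz w hw => by
      obtain ⟨κ, c, _, V, _, hV, hwV, hs⟩ := h z hz _ (z.map_target hw)
      rw [z.right_inv hw] at hwV
      exact ⟨hs.smooth_normal.contDiffAt (hV.mem_nhds hwV), hs.unit_normal w hwV,
        hs.normal w hwV⟩
  refine ⟨fun p => ?_, fun z hz => ⟨fun w hw => (key z hz w hw).1.contDiffWithinAt,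
    fun w hw => (key z hz w hw).2.2⟩⟩
  have hp := mem_chart_source ℂ p
  have := (key _ (IsManifold.chart_mem_maximalAtlas p) _ ((chartAt ℂ p).map_source hp)).2.1
  rwa [(chartAt ℂ p).left_inv hp] at this

/-- Conformal immersions with the same invariants differ by a Möbius transformation. -/
theorem exists_moebius_of_hasHopfSchwarzian [ConnectedSpace M] [IsManifold 𝓘(ℂ) ω M]
    {f₁ f₂ : M → S3} {n₁ n₂ : M → Fin 5 → ℝ} {κ c : OpenPartialHomeomorph M ℂ → ℂ → ℂ}
    (hf₁ : IsConformalImmersion f₁) (hf₂ : IsConformalImmersion f₂) (hn₁ : IsUnitNormal f₁ n₁)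
    (hn₂ : IsUnitNormal f₂ n₂)
    (h₁ : ∀ z ∈ holomorphicCoordinates M, HasHopfSchwarzian f₁ n₁ z (κ z) (c z))
    (h₂ : ∀ z ∈ holomorphicCoordinates M, HasHopfSchwarzian f₂ n₂ z (κ z) (c z)) :
    ∃ T ∈ moebiusGroup, ∀ p, T (f₁ p) = f₂ p := by
  obtain ⟨A, hA, _⟩ := exists_lorentz_of_isSurfaceAt (f₁ := f₁) (f₂ := f₂) (n₁ := n₁) (n₂ := n₂)
    fun p => by
      have hz : chartAt ℂ p ∈ holomorphicCoordinates M := IsManifold.chart_mem_maximalAtlas p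
      exact ⟨_, _, _,
        isSurfaceAt_of_isConformalImmersion hf₁ hn₁ hz (h₁ _ hz) (mem_chart_source ℂ p),
        isSurfaceAt_of_isConformalImmersion hf₂ hn₂ hz (h₂ _ hz) (mem_chart_source ℂ p)⟩
  exact ⟨moebiusHom A, (moebiusHom A).2, fun p => (hA p).1⟩

end Immersions

/-! ### Existence on simply connected coverings -/

section Existence

open Filter Topology

variable {M M' : Type*} [TopologicalSpace M] [TopologicalSpace M'] {π : M' → M}
  {κ c : OpenPartialHomeomorph M ℂ → ℂ → ℂ} {f : M' → S3} {n : M' → Fin 5 → ℝ}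

/-- The coordinates `e` on `M'` which are restrictions of `z ∘ π`. -/
def IsAdapted (π : M' → M) (z : OpenPartialHomeomorph M ℂ) (e : OpenPartialHomeomorph M' ℂ) :
    Prop :=
  ∀ x ∈ e.source, π x ∈ z.source ∧ e x = z (π x)

theorem exists_isAdapted (hπ : IsLocalHomeomorph π) (z : OpenPartialHomeomorph M ℂ) {p : M'}
    (hp : π p ∈ z.source) : ∃ e, IsAdapted π z e ∧ p ∈ e.source := by
  obtain ⟨φ, hpφ, rfl⟩ := hπ p
  exact ⟨φ.trans z, fun x hx => ⟨hx.2, rfl⟩, hpφ, hp⟩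

theorem IsAdapted.mem_transition {z z' : OpenPartialHomeomorph M ℂ}
    {e e' : OpenPartialHomeomorph M' ℂ} (he : IsAdapted π z e) (he' : IsAdapted π z' e') {w : ℂ}
    (hw : w ∈ (e'.symm.trans e).source) :
    w ∈ (z'.symm.trans z).source ∧ e (e'.symm w) = z (z'.symm w) := by
  have h1 := he' _ (e'.map_target hw.1)
  have h2 := he _ hw.2
  have h3 : w = z' (π (e'.symm w)) := by rw [← h1.2, e'.right_inv hw.1]
  have h4 : z'.symm w = π (e'.symm w) := (congrArg z'.symm h3).trans (z'.left_inv h1.1)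
  refine ⟨⟨h3 ▸ z'.map_source h1.1, ?_⟩, by rw [h4]; exact h2.2⟩
  change z'.symm w ∈ z.source
  rw [h4]
  exact h2.1

variable [ChartedSpace ℂ M]

/-- The invariants of a surface in different adapted coordinates. -/
theorem IsSurfaceAt.of_isAdapted (hκ : IsDensityQuadraticDifferential κ) (hc : IsSchwarzianType c)
    {z z' : OpenPartialHomeomorph M ℂ} (hz : z ∈ holomorphicCoordinates M)
    (hz' : z' ∈ holomorphicCoordinates M) {e e' : OpenPartialHomeomorph M' ℂ}
    (he : IsAdapted π z e) (he' : IsAdapted π z' e') {x : M'} (hx : x ∈ e'.source)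
    (h : IsSurfaceAt e (κ z) (c z) f n x) : IsSurfaceAt e' (κ z') (c z') f n x := by
  have hm := fun w hw => he.mem_transition he' (w := w) hw
  have hd := differentiableOn_transition hz hz'
  refine h.change_coord hx (V := (e'.symm.trans e).source) (t := z'.symm.trans z)
    (e'.symm.trans e).open_source ⟨e'.map_source hx, ?_⟩ (fun w hw => (hm w hw).2)
    (hd.mono fun w hw => (hm w hw).1)
    (fun w hw => deriv_ne_zero_of_openPartialHomeomorph _ hd (hm w hw).1)
    (fun w hw => (hκ.2 z' hz' z hz w (hm w hw).1).symm) fun w hw => ?_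
  · change e'.symm (e' x) ∈ e.source
    rw [e'.left_inv hx]
    exact h.1
  · have := hc.2 z' hz' z hz w (hm w hw).1
    exact (eq_add_of_sub_eq this.symm)

/-- Solutions of the conformal Gauss and Codazzi equations are locally realized by surfaces. -/
theorem exists_isSurfaceAt (hκ : IsDensityQuadraticDifferential κ) (hc : IsSchwarzianType c)
    (gauss : ConformalGauss κ c) (codazzi : ConformalCodazzi κ c)
    {z : OpenPartialHomeomorph M ℂ} (hz : z ∈ holomorphicCoordinates M)
    {e : OpenPartialHomeomorph M' ℂ} (he : IsAdapted π z e) {p : M'} (hp : p ∈ e.source) :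
    ∃ (W : Set M') (f : M' → S3) (n : M' → Fin 5 → ℝ), IsOpen W ∧ p ∈ W ∧
      ∀ x ∈ W, IsSurfaceAt e (κ z) (c z) f n x := by
  have ht : e.target ⊆ z.target := fun w hw => by
    have := he _ (e.map_target hw)
    rw [e.right_inv hw] at this
    rw [this.2]
    exact z.map_source this.1
  obtain ⟨V, hVe, hV, hpV, g, N, hs⟩ := exists_isLocalSurface e.open_target
    ((hκ.1 z hz).mono ht) ((hc.1 z hz).mono ht) (fun w hw => gauss z hz w (ht hw))
    (fun w hw => codazzi z hz w (ht hw)) (e.map_source hp)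
  refine ⟨e.source ∩ e ⁻¹' V, fun x => g (e x), fun x => N (e x), e.isOpen_inter_preimage hV,
    ⟨hp, hpV⟩, fun x hx => ⟨hx.1, V, hVe, hV, hx.2, ?_⟩⟩
  exact hs.congr hV (fun w hw => congrArg g (e.right_inv (hVe hw)))
    (fun w hw => congrArg N (e.right_inv (hVe hw))) (fun _ _ => rfl) fun _ _ => rfl

/-- On a simply connected surface over `M` the local surfaces with the given invariants can be glued
to a global one. -/
theorem exists_forall_isSurfaceAt [IsManifold 𝓘(ℂ) ω M] [SimplyConnectedSpace M']
    [LocallyPathConnectedSpace M'] (hπ : IsLocalHomeomorph π)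
    (hκ : IsDensityQuadraticDifferential κ) (hc : IsSchwarzianType c)
    (gauss : ConformalGauss κ c) (codazzi : ConformalCodazzi κ c) :
    ∃ (f : M' → S3) (n : M' → Fin 5 → ℝ), ∀ z ∈ holomorphicCoordinates M,
      ∀ e, IsAdapted π z e → ∀ x ∈ e.source, IsSurfaceAt e (κ z) (c z) f n x := by
  have hz : ∀ p : M', chartAt ℂ (π p) ∈ holomorphicCoordinates M := fun p =>
    IsManifold.chart_mem_maximalAtlas (π p)
  choose e he hpe using fun p : M' => exists_isAdapted hπ _ (mem_chart_source ℂ (π p))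
  choose W f n hW hpW hs using fun p =>
    exists_isSurfaceAt hκ hc gauss codazzi (hz p) (he p) (hpe p)
  -- The transformation laws of `κ` and `c` place both pieces in the same coordinate with the same
  -- invariants, so they differ by a Lorentz transformation. Its uniqueness gives local constancy
  -- and the cocycle identity.
  have htr : ∀ i j, ∀ x ∈ W i ∩ W j, ∃ A, Intertwines A (f j) (n j) (f i) (n i) x := fun i j x hx =>
    ((hs j x hx.2).of_isAdapted hκ hc (hz j) (hz i) (he j) (he i)
      (hs i x hx.1).1).exists_intertwines (hs i x hx.1)
  choose! a ha using htr
  have huniq : ∀ i j, ∀ x ∈ W i ∩ W j, ∀ B, Intertwines B (f j) (n j) (f i) (n i) x → a i j x = B :=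
    fun i j x hx B hB => (hs j x hx.2).intertwines_unique (ha i j x hx) hB
  obtain ⟨b, hb, hba⟩ := exists_trivialization_of_cocycle W hW (fun p => ⟨p, hpW p⟩) a
    (fun i j x hx => by
      filter_upwards [(ha i j x hx).eventually, ((hW i).inter (hW j)).mem_nhds hx] with y hy hyW
      exact huniq i j y hyW _ hy)
    fun i j k x hx => (huniq i k x ⟨hx.1.1, hx.2⟩ _
      ((ha j k x ⟨hx.1.2, hx.2⟩).trans (ha i j x hx.1))).symm
  -- Patches are indexed by points, so `f x x` is the piece around `x` evaluated at its own centre.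
  -- After correction by `b` every other piece containing `x` gives the same value.
  have hglue : ∀ i, ∀ x ∈ W i, lorentzAct (b i x) (f i x) = lorentzAct (b x x) (f x x) ∧
      b i x (n i x) = b x x (n x x) := fun i x hx => by
    have h1 := (ha i x x ⟨hx, hpW x⟩).self_of_nhds
    rw [hba i x x ⟨hx, hpW x⟩, lorentzAct_mul, h1.1, Subgroup.coe_mul, LinearEquiv.mul_apply, h1.2]
    exact ⟨rfl, rfl⟩
  refine ⟨fun x => lorentzAct (b x x) (f x x), fun x => b x x (n x x), fun z hz' e' he' x hx => ?_⟩
  refine ((hs x x (hpW x)).of_intertwines (A := b x x) ?_).of_isAdapted hκ hc (hz x) hz' (he x) he'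
    hx
  filter_upwards [hb x x (hpW x), (hW x).mem_nhds (hpW x)] with y hy hyW
  rw [← hy]
  exact hglue x y hyW

/-- A surface over `M` with invariants coming from `M` is equivariant. -/
theorem hasMoebiusHolonomy_of_isSurfaceAt [ConnectedSpace M'] [IsManifold 𝓘(ℂ) ω M]
    (hπ : IsLocalHomeomorph π) (h : ∀ z ∈ holomorphicCoordinates M,
      ∀ e, IsAdapted π z e → ∀ x ∈ e.source, IsSurfaceAt e (κ z) (c z) f n x) :
    HasMoebiusHolonomy π f := by
  have key : ∀ γ : deckGroup π, ∃! A : orthochronousGroup, ∀ x,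
      lorentzAct A (f x) = f ((γ : M' ≃ₜ M') x) ∧ A (n x) = n ((γ : M' ≃ₜ M') x) := by
    rintro ⟨γ, hγ⟩
    refine exists_lorentz_of_isSurfaceAt (f₂ := fun x => f (γ x)) (n₂ := fun x => n (γ x))
      fun x => ?_
    have hz : chartAt ℂ (π (γ x)) ∈ holomorphicCoordinates M :=
      IsManifold.chart_mem_maximalAtlas (π (γ x))
    obtain ⟨e, he, hxe⟩ := exists_isAdapted hπ _ (mem_chart_source ℂ (π (γ x)))
    -- Since `π ∘ γ = π`, the chart `e ∘ γ` is adapted as well. In it `f ∘ γ` has the expression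
    -- that `f` has in `e`, so `f` and `f ∘ γ` have the same invariants.
    have he' : IsAdapted π (chartAt ℂ (π (γ x))) (γ.toOpenPartialHomeomorph.trans e) :=
      fun y hy => by
        have := he (γ y) hy.2
        rw [hγ y] at this
        exact this
    have hxe' : x ∈ (γ.toOpenPartialHomeomorph.trans e).source := ⟨trivial, hxe⟩
    refine ⟨_, _, _, h _ hz _ he' x hxe', hxe', ?_⟩
    obtain ⟨_, V, hVe, hV, hxV, hs⟩ := h _ hz e he _ hxe
    refine ⟨V, fun w hw => ⟨hVe hw, trivial⟩, hV, hxV, ?_⟩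
    exact hs.congr hV (fun w _ => congrArg f (γ.apply_symm_apply _))
      (fun w _ => congrArg n (γ.apply_symm_apply _)) (fun _ _ => rfl) fun _ _ => rfl
  choose A hA hAu using key
  -- Multiplicativity follows from uniqueness: `A γ * A δ` also matches `f` and `n` with their
  -- compositions with `γ δ`.
  refine ⟨moebiusHom.comp (MonoidHom.mk' A fun γ δ => (hAu (γ * δ) (A γ * A δ) fun x => ?_).symm),
    fun γ x => (hA γ x).1.symm⟩
  rw [lorentzAct_mul, (hA δ x).1, (hA γ _).1]
  refine ⟨rfl, ?_⟩
  change A γ (A δ (n x)) = _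
  rw [(hA δ x).2, (hA γ _).2]
  rfl

/-- A surface with the given invariants in adapted coordinates is a surface in every holomorphic
coordinate. -/
theorem exists_isSurfaceAt_of_isAdapted [IsManifold 𝓘(ℂ) ω M] [ChartedSpace ℂ M']
    (hπ : IsLocalHomeomorph π) (hπ' : MDifferentiable 𝓘(ℂ) 𝓘(ℂ) π)
    (h : ∀ z ∈ holomorphicCoordinates M,
      ∀ e, IsAdapted π z e → ∀ x ∈ e.source, IsSurfaceAt e (κ z) (c z) f n x)
    {z' : OpenPartialHomeomorph M' ℂ} (hz' : z' ∈ holomorphicCoordinates M') {x : M'}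
    (hx : x ∈ z'.source) : ∃ κ' c', IsSurfaceAt z' κ' c' f n x := by
  have hz : chartAt ℂ (π x) ∈ holomorphicCoordinates M :=
    IsManifold.chart_mem_maximalAtlas (π x)
  obtain ⟨e, he, hxe⟩ := exists_isAdapted hπ _ (mem_chart_source ℂ (π x))
  have hd : DifferentiableOn ℂ (z'.symm.trans e) (z'.symm.trans e).source :=
    DifferentiableOn.congr (f := fun w => chartAt ℂ (π x) (π (z'.symm w)))
      (fun w hw => (differentiableAt_inCoordinates hz hz' hπ' hw.1
        (he _ hw.2).1).differentiableWithinAt) fun w hw => (he _ hw.2).2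
  -- In an arbitrary coordinate of the covering the invariants are defined by the transformation
  -- laws, which therefore hold by definition.
  refine ⟨_, _, (h _ hz e he x hxe).change_coord hx (V := (z'.symm.trans e).source)
    (t := z'.symm.trans e) (z'.symm.trans e).open_source ⟨z'.map_source hx, ?_⟩ (fun _ _ => rfl) hd
    (fun w hw => deriv_ne_zero_of_openPartialHomeomorph _ hd hw) (fun _ _ => rfl) fun _ _ => rfl⟩
  change z'.symm (z' x) ∈ e.source
  rwa [z'.left_inv hx]

end Existence

end ConformalSurface

end

open ConformalSurface in
/-- Fundamental theorem of conformal surface theory. Uniqueness: conformal immersions of a Riemann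
surface into the 3-sphere with the same Hopf differential and Schwarzian differ by a Möbius
transformation. Existence: solutions of the conformal Gauss and Codazzi equations are realized by a
conformal immersion with Möbius holonomy, that is, by an equivariant conformal immersion of the
universal covering surface; its invariants are required to be the given ones in all holomorphic
coordinates `z'` of the covering surface that are restrictions of `z ∘ π`, with `z` a holomorphic
coordinate of the surface. -/
theorem mainTheorem1 {M : Type*} [TopologicalSpace M] [T2Space M] [ConnectedSpace M]
    [ChartedSpace ℂ M] [IsManifold 𝓘(ℂ) ω M] :
    (∀ (f₁ f₂ : M → S3) (n₁ n₂ : M → Fin 5 → ℝ) (κ c : OpenPartialHomeomorph M ℂ → ℂ → ℂ),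
      IsConformalImmersion f₁ → IsConformalImmersion f₂ →
      IsUnitNormal f₁ n₁ → IsUnitNormal f₂ n₂ →
      (∀ z ∈ holomorphicCoordinates M, HasHopfSchwarzian f₁ n₁ z (κ z) (c z)) →
      (∀ z ∈ holomorphicCoordinates M, HasHopfSchwarzian f₂ n₂ z (κ z) (c z)) →
      ∃ T ∈ moebiusGroup, ∀ p, T (f₁ p) = f₂ p) ∧
    (∀ (κ c : OpenPartialHomeomorph M ℂ → ℂ → ℂ),
      IsDensityQuadraticDifferential κ → IsSchwarzianType c →
      ConformalGauss κ c → ConformalCodazzi κ c →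
      ∀ {M' : Type*} [TopologicalSpace M'] [T2Space M'] [SimplyConnectedSpace M']
        [ChartedSpace ℂ M'] [IsManifold 𝓘(ℂ) ω M'] (π : M' → M),
        IsCoveringMap π → MDifferentiable 𝓘(ℂ) 𝓘(ℂ) π →
        ∃ (f : M' → S3) (n : M' → Fin 5 → ℝ),
          IsConformalImmersion f ∧ IsUnitNormal f n ∧ HasMoebiusHolonomy π f ∧
          ∀ z ∈ holomorphicCoordinates M, ∀ z' ∈ holomorphicCoordinates M',
            (∀ x ∈ z'.source, π x ∈ z.source ∧ z' x = z (π x)) →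
            HasHopfSchwarzian f n z' (κ z) (c z)) := by
  refine ⟨fun f₁ f₂ n₁ n₂ κ c hf₁ hf₂ hn₁ hn₂ h₁ h₂ =>
    exists_moebius_of_hasHopfSchwarzian hf₁ hf₂ hn₁ hn₂ h₁ h₂, ?_⟩
  intro κ c hκ hc gauss codazzi M' _ _ _ _ _ π hcov hhol
  have : LocallyPathConnectedSpace M' := ChartedSpace.locallyPathConnectedSpace ℂ M'
  have hπ := hcov.isLocalHomeomorph
  obtain ⟨f, n, h⟩ := exists_forall_isSurfaceAt hπ hκ hc gauss codazzi
  have h' := fun (z' : OpenPartialHomeomorph M' ℂ) hz' x (hx : x ∈ z'.source) =>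
    exists_isSurfaceAt_of_isAdapted hπ hhol h hz' hx
  exact ⟨f, n, isConformalImmersion_of_isSurfaceAt h', isUnitNormal_of_isSurfaceAt h',
    hasMoebiusHolonomy_of_isSurfaceAt hπ h, fun z hz z' _ hzz' =>
    hasHopfSchwarzian_of_isSurfaceAt (h z hz z' hzz')⟩
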